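/- **Setting.** Let $\mathrm{St}(n,r)=\{X\in\mathbb R^{n\times r}:X^\top X=I_r\}$, with tangent space $T_X=\{u:X^\top u+u^\top X=0\}$, orthogonal projection $\mathcal P_{T_X}(Z)=Z-\frac12X(X^\top Z+Z^\top X)$ and polar retraction $\mathcal R_X(v)=(X+v)(I_r+v^\top v)^{-1/2}$; $\|\cdot\|_F$ is the Frobenius norm, and $\mathrm{grad}\,\phi(X)=\mathcal P_{T_X}(\nabla\phi(X))$. There are $N$ agents with costs $f_i(X)=\mathbb E_{\xi_i}[F_i(X,\xi_i)]$, $f=\frac1N\sum_i f_i$ and $f^*=\min_{\mathrm{St}(n,r)}f$. Stack $\mathbf X=(X_1,\dots,X_N)$, $\|\mathbf X\|_F^2=\sum_i\|X_i\|_F^2$; an induced arithmetic mean is $\hat X\in\arg\min_{Y\in \mathrm{St}(n,r)}\sum_i\|Y-X_i\|_F^2$, and $\hat{\mathbf X}=(\hat X,\dots,\hat X)$. Assume: 1. The communication graph is undirected and connected; $W=(w_{ij})$ has $w_{ij}>0$ if $i=j$ or $(i,j)$ is an edge and $w_{ij}=0$ otherwise, $W=W^\top$ and $W\mathbf 1=\mathbf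 1$. 2. Each $f_i$ is differentiable on $\mathbb R^{n\times r}$ with $L$-Lipschitz Euclidean gradient. 3. The oracle $G_i(X,\xi_i)\in T_X$ satisfies, for all $X\in\mathrm{St}(n,r)$, $\mathbb E[G_i(X,\xi_i)]=\mathrm{grad}f_i(X)$ and $\mathbb E\|G_i(X,\xi_i)-\mathrm{grad}f_i(X)\|_F^2\le\sigma^2$. 4. For some $A_1>0$, almost surely $\|G_i(X,\xi_i)\|_F\le A_1$ for all $X\in\mathrm{St}(n,r)$ and all $i$. Let $A_2$ satisfy $\|\nabla f_i(X)\|_F\le A_2$ for all $i$ and all $X\in\mathrm{St}(n,r)$, $A=\max\{A_1,A_2\}$, $L_n=\max_i\max_{X\in\mathrm{St}(n,r)}\|\nabla f_i(X)\|_2$ and $L_G=L+2L_n$. **Algorithm.** $X_{i,k}$ being the variable of agent $i$, put $F_i(X_{i,k})=\frac1{N_k}\sum_{j=1}^{N_k}G_i(X_{i,k},\xi_{i,k}^{[j]})$, where $N_k\ge1$, all the samples $\xi^{[j]}_{i,k}$ are independent and $\xi^{[j]}_{i,k}$ is distributed as $\xi_i$. From a deterministic $\mathbf X_0$ and $Y_{i,0}=F_i(X_{i,0})$,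 and with $v_{i,k}=\mathcal P_{T_{X_{i,k}}}(Y_{i,k})$, $$X_{i,k+1}=\mathcal R_{X_{i,k}}\Big(\alpha\,\mathcal P_{T_{X_{i,k}}}\Big[\sum_j (W^t)_{ij}X_{j,k}\Big]-\beta v_{i,k}\Big),\qquad Y_{i,k+1}=\sum_j (W^t)_{ij}Y_{j,k}+F_i(X_{i,k+1})-F_i(X_{i,k}).$$ Let $\bar F_0=\frac1N\sum_iF_i(X_{i,0})$. **Parameters.** Let $\delta_2\le\frac16$, $\delta_1\le\frac{\delta_2}{5\sqrt r}$, and suppose $\mathbf X_0\in\mathcal S=\{\mathbf X\in\mathrm{St}(n,r)^N:\|\mathbf X-\hat{\mathbf X}\|_F^2\le N\delta_1^2,\ \max_i\|X_i-\hat X\|_F\le\delta_2\}$. Let $\sigma_2$ be the second largest singular value of $W$; let $t\ge1$ be an integer with $t\ge\log_{\sigma_2}\frac1{2\sqrt N}$ (nothing more than $t\ge 1$ is required if $\sigma_2=0$). Put $L_t=1-\lambda_{\min}(W^t)$. Let $M>0$ be a constant with $\|\mathcal R_X(v)-(X+v)\|_F\le M\|v\|_F^2$ for all $X\in\mathrm{St}(n,r)$,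 $v\in T_X$, and let $\Phi$ be a constant with $1\le\Phi\le 2-\max_i\|X_{i,0}-\hat X_0\|_F^2$. Define $$\rho_t=\sqrt{1-(\alpha L_t\Phi-\alpha^2L_t^2)},\quad \Gamma_0=\frac2{(1-\rho_t)^2},\quad \Gamma_1=\frac{2}{1-\rho_t^2}\|\mathbf X_0-\hat{\mathbf X}_0\|_F^2,\quad \Gamma_2=\frac2{(1-\sigma_2^t)^2},$$ $$\Gamma_3=\frac2{1-\sigma_2^{2t}}\cdot\frac1N\,\mathbb E\sum_i\|Y_{i,0}-\bar F_0\|_F^2,\qquad \bar\beta=\min\Big\{\frac{1-\rho_t}{10A+L_G}\delta_1,\ \frac{\alpha\delta_1}{5(10A+L_G)}\Big\},$$ $$D_1=(\delta_1^2+5)L_G+2MA,\quad D_4=\frac{4r\delta_1^2}{\beta^2L_G},\quad D_2=3L_G+2\alpha A+13L_G\frac{\delta_2^2}{r}\alpha^2+D_4,\quad D_3=\frac{1+4L_G^2\beta^2}{2L_G},\quad \tilde D_3=D_3+\frac{5\beta}8,$$ $$C_0=\frac{D_4\Gamma_0\alpha^2\delta_1^2}{25}+\Gamma_1(D_2+D_4),\quad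 C_1=D_2\Gamma_0+D_4\Gamma_0+D_1,\quad \tilde\Gamma_1=2L_G^2\beta\Gamma_1,\quad \tilde\Gamma_3=C_0+\frac\beta2\big(\Gamma_3+16\alpha^2L_G^2\Gamma_2\Gamma_1\big).$$ Suppose $0<\alpha\le\min\{1,\frac1M,\frac\Phi{L_t}\}$ and $0<\beta\le\min\Big\{\bar\beta,\ \frac1{9L_G},\ \frac1{4[\alpha\delta_1L_G(16\Gamma_0+\Gamma_2)+2C_1]}\Big\}$. **Conclusion.** For every $K\ge0$ (all expectations being finite), $$\min_{0\le k\le K}\frac1N\mathbb E\|\mathbf X_k-\hat{\mathbf X}_k\|_F^2\le\frac{8\beta\Gamma_0\Big(f(\hat X_0)-f^*+\tilde\Gamma_3+\sigma^2\sum_{k=0}^K\Big(\frac{2\Gamma_2\beta+D_3+\beta/2}{N_k}+\frac{2\beta\Gamma_2}{N_{k+1}}\Big)\Big)+\Gamma_1}{K+1},$$ $$\min_{0\le k\le K}\mathbb E\|\mathrm{grad}f(\hat X_k)\|_F^2\le\frac{\tilde\Gamma_1+(16+\Gamma_0\alpha^2\delta_1^2)\,[f(\hat X_0)-f^*+\tilde\Gamma_3]}{\beta(K+1)}+\frac{\sigma^2\sum_{k=0}^K\Big(\frac{2\beta\Gamma_2+\tilde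 D_3}{N_k}+\frac{2\beta\Gamma_2}{N_{k+1}}\Big)}{\beta(K+1)}.$$ -/

import Mathlib

open MeasureTheory ProbabilityTheory
open scoped Matrix Matrix.Norms.Frobenius

namespace DRSGT

/-- Real `n × r` matrices. The norm in force is the Frobenius norm. -/
abbrev Mat (n r : ℕ) : Type := Matrix (Fin n) (Fin r) ℝ

/-- Matrices carry the product (that is, entrywise Borel) σ-algebra. -/
instance instMeasurableSpaceMat {n r : ℕ} : MeasurableSpace (Matrix (Fin n) (Fin r) ℝ) :=
  inferInstanceAs (MeasurableSpace (Fin n → Fin r → ℝ))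

instance instBorelSpaceMat {n r : ℕ} : BorelSpace (Matrix (Fin n) (Fin r) ℝ) :=
  inferInstanceAs (BorelSpace (Fin n → Fin r → ℝ))

/-! ### Geometry of the Stiefel manifold -/

/-- The Stiefel manifold `St(n, r)`. -/
def St (n r : ℕ) : Set (Mat n r) := {X | Xᵀ * X = 1}

/-- The tangent space of the Stiefel manifold at `X`. -/
def tangent {n r : ℕ} (X : Mat n r) : Set (Mat n r) := {u | Xᵀ * u + uᵀ * X = 0}

/-- The orthogonal projection onto the tangent space at `X`. -/
noncomputable def projT {n r : ℕ} (X Z : Mat n r) : Mat n r :=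
  Z - (1 / 2 : ℝ) • (X * (Xᵀ * Z + Zᵀ * X))

/-- The polar retraction `(X + v) (I + vᵀ v) ^ (-1/2)`. -/
noncomputable def polarRetr {n r : ℕ} (X v : Mat n r) : Mat n r :=
  (X + v) * cfc (fun x : ℝ => x ^ (-(1 / 2) : ℝ)) (1 + vᵀ * v)

/-- The Euclidean gradient of `φ` at `X`: the matrix of partial derivatives. -/
noncomputable def eGrad {n r : ℕ} (φ : Mat n r → ℝ) (X : Mat n r) : Mat n r :=
  Matrix.of fun a b => fderiv ℝ φ X (Matrix.single a b 1)

/-- The Riemannian gradient of `φ` at a point `X` of the Stiefel manifold. -/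
noncomputable def rGrad {n r : ℕ} (φ : Mat n r → ℝ) (X : Mat n r) : Mat n r :=
  projT X (eGrad φ X)

/-- `φ` is differentiable with `L`-Lipschitz Euclidean gradient. -/
def LSmooth {n r : ℕ} (L : ℝ) (φ : Mat n r → ℝ) : Prop :=
  Differentiable ℝ φ ∧ ∀ X Y, ‖eGrad φ X - eGrad φ Y‖ ≤ L * ‖X - Y‖

/-- The spectral norm (largest singular value) of a matrix. -/
noncomputable def specNorm {n r : ℕ} (Z : Mat n r) : ℝ :=
  ‖LinearMap.toContinuousLinearMap (Matrix.toEuclideanLin Z)‖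

/-- `Y` is an induced arithmetic mean of `X₁, …, X_N`. -/
def IsIAM {N n r : ℕ} (X : Fin N → Mat n r) (Y : Mat n r) : Prop :=
  Y ∈ St n r ∧ ∀ Z ∈ St n r, ∑ i, ‖Y - X i‖ ^ 2 ≤ ∑ i, ‖Z - X i‖ ^ 2

theorem fderiv_eq_trace {n r : ℕ} (φ : Mat n r → ℝ) (X Z : Mat n r) :
    fderiv ℝ φ X Z = ((eGrad φ X)ᵀ * Z).trace := by
  conv_lhs => rw [Matrix.matrix_eq_sum_single Z]
  simp only [map_sum, Matrix.trace, Matrix.diag_apply, Matrix.mul_apply, Matrix.transpose_apply,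
    eGrad, Matrix.of_apply]
  rw [Finset.sum_comm]
  refine Finset.sum_congr rfl fun b _ => Finset.sum_congr rfl fun a _ => ?_
  have h : Matrix.single a b (Z a b) = Z a b • (Matrix.single a b (1 : ℝ) : Mat n r) := by
    simp [Matrix.smul_single]
  rw [h, map_smul, smul_eq_mul, mul_comm]

theorem projT_mem_tangent {n r : ℕ} {X : Mat n r} (hX : X ∈ St n r) (Z : Mat n r) :
    projT X Z ∈ tangent X := by
  have hX' : Xᵀ * X = 1 := hX
  simp only [tangent, Set.mem_ofPred_eq, projT, Matrix.mul_sub, Matrix.mul_smul,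
    Matrix.transpose_sub, Matrix.transpose_smul, Matrix.transpose_mul, Matrix.transpose_add,
    Matrix.transpose_transpose, Matrix.sub_mul, Matrix.smul_mul, Matrix.mul_assoc, hX',
    ← Matrix.mul_assoc Xᵀ X, Matrix.one_mul, Matrix.mul_one]
  ext a b
  simp only [Matrix.add_apply, Matrix.sub_apply, Matrix.smul_apply, Matrix.zero_apply, smul_eq_mul]
  ring

theorem projT_orthogonal {n r : ℕ} {X u : Mat n r} (hu : u ∈ tangent X) (Z : Mat n r) :
    ((Z - projT X Z)ᵀ * u).trace = 0 := by
  have hu' : Xᵀ * u = -(uᵀ * X) := eq_neg_of_add_eq_zero_left hu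
  set S : Matrix (Fin r) (Fin r) ℝ := Xᵀ * Z + Zᵀ * X with hS
  have hSt : Sᵀ = S := by
    simp [hS, Matrix.transpose_add, Matrix.transpose_mul, add_comm]
  have h0 : Z - projT X Z = (1 / 2 : ℝ) • (X * S) := by simp [projT, hS]
  have h1 : (S * (Xᵀ * u)).trace = -(S * (Xᵀ * u)).trace := by
    conv_lhs => rw [← Matrix.trace_transpose]
    rw [Matrix.transpose_mul, Matrix.transpose_mul, Matrix.transpose_transpose, hSt,
      Matrix.trace_mul_comm, hu']
    simp
  have h2 : (S * (Xᵀ * u)).trace = 0 := by linarith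
  rw [h0, Matrix.transpose_smul, Matrix.smul_mul, Matrix.trace_smul, Matrix.transpose_mul, hSt,
    Matrix.mul_assoc, h2, smul_zero]

/-! ### The problem, the algorithm and the constants -/

/-- The data of the distributed stochastic problem and of the algorithm with `N` agents on
`St(n, r)`. Agent `i` has data samples in `Ξ i`; the algorithm runs on the sample space `Ω`.
This is raw data only: what is assumed of it is stated separately below. -/
structure Model (N n r : ℕ) (Ω : Type*) (Ξ : Fin N → Type*)
    [MeasurableSpace Ω] [∀ i, MeasurableSpace (Ξ i)] where
  /-- communication graph -/
  graph : SimpleGraph (Fin N)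
  /-- weighted adjacency matrix -/
  W : Matrix (Fin N) (Fin N) ℝ
  /-- number of consensus steps per iteration -/
  t : ℕ
  /-- consensus step size -/
  α : ℝ
  /-- gradient step size -/
  β : ℝ
  /-- radius of the averaged local region -/
  δ₁ : ℝ
  /-- radius of the uniform local region -/
  δ₂ : ℝ
  /-- distribution of the data of agent `i` -/
  P : ∀ i, Measure (Ξ i)
  /-- sample costs -/
  cost : ∀ i, Mat n r → Ξ i → ℝ
  /-- stochastic Riemannian gradient oracle -/
  G : ∀ i, Mat n r → Ξ i → Mat n r
  /-- number of samples drawn by each agent at iteration `k` -/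
  batch : ℕ → ℕ
  /-- initial points -/
  X₀ : Fin N → Mat n r
  /-- probability on the sample space of the algorithm -/
  μ : Measure Ω
  /-- `ξ i k j` is the `j`-th sample of agent `i` at iteration `k` -/
  ξ : ∀ i, ℕ → ℕ → Ω → Ξ i
  /-- a selection of the induced arithmetic mean -/
  iam : (Fin N → Mat n r) → Mat n r
  /-- smoothness constant of the local costs -/
  L : ℝ
  /-- bound on the stochastic gradients -/
  A₁ : ℝ
  /-- bound on the Euclidean gradients of the local costs -/
  A₂ : ℝ
  /-- second order constant of the polar retraction -/
  M : ℝ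
  /-- consensus constant -/
  Φ : ℝ
  /-- standard deviation bound of the stochastic gradients -/
  σ : ℝ

namespace Model

variable {N n r : ℕ} {Ω : Type*} {Ξ : Fin N → Type*}
  [MeasurableSpace Ω] [∀ i, MeasurableSpace (Ξ i)] (p : Model N n r Ω Ξ)

/-- The local cost of agent `i`, an expectation. -/
noncomputable def fLoc (i : Fin N) (X : Mat n r) : ℝ := ∫ x, p.cost i X x ∂(p.P i)

/-- The global cost. -/
noncomputable def f (X : Mat n r) : ℝ := (1 / (N : ℝ)) * ∑ i, p.fLoc i X

/-- The minimum of the global cost over the Stiefel manifold. -/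
noncomputable def fStar : ℝ := sInf (p.f '' St n r)

/-- The averaged sampled gradient `F_i` of agent `i` at iteration `k`, evaluated at `X`. -/
noncomputable def sampGrad (i : Fin N) (k : ℕ) (ω : Ω) (X : Mat n r) : Mat n r :=
  (1 / (p.batch k : ℝ)) • ∑ j ∈ Finset.range (p.batch k), p.G i X (p.ξ i k j ω)

/-- The update of the variable of agent `i` from the current variables `X` and trackers `Y`. -/
noncomputable def stepX (X Y : Fin N → Mat n r) (i : Fin N) : Mat n r :=
  polarRetr (X i)
    (p.α • projT (X i) (∑ j, (p.W ^ p.t) i j • X j) - p.β • projT (X i) (Y i))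

/-- The algorithm: the pair (variables, trackers) after `k` iterations. -/
noncomputable def state : ℕ → Ω → (Fin N → Mat n r) × (Fin N → Mat n r)
  | 0, ω => (p.X₀, fun i => p.sampGrad i 0 ω (p.X₀ i))
  | k + 1, ω =>
    (p.stepX (state k ω).1 (state k ω).2,
     fun i => ∑ j, (p.W ^ p.t) i j • (state k ω).2 j
      + p.sampGrad i (k + 1) ω (p.stepX (state k ω).1 (state k ω).2 i)
      - p.sampGrad i k ω ((state k ω).1 i))

/-- The variables `X_{i,k}`. -/
noncomputable def X (k : ℕ) (ω : Ω) : Fin N → Mat n r := (p.state k ω).1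

/-- The gradient trackers `Y_{i,k}`. -/
noncomputable def Y (k : ℕ) (ω : Ω) : Fin N → Mat n r := (p.state k ω).2

/-- The induced arithmetic mean of the variables at iteration `k`. -/
noncomputable def Xhat (k : ℕ) (ω : Ω) : Mat n r := p.iam (p.X k ω)

/-- The squared consensus error of a stacked variable, `‖𝐗 - 𝐗̂‖²` in the Frobenius norm. -/
noncomputable def consErr (Z : Fin N → Mat n r) : ℝ := ∑ i, ‖Z i - p.iam Z‖ ^ 2

/-- The local region. -/
def region : Set (Fin N → Mat n r) :=
  {Z | (∀ i, Z i ∈ St n r) ∧ p.consErr Z ≤ N * p.δ₁ ^ 2 ∧ ∀ i, ‖Z i - p.iam Z‖ ≤ p.δ₂}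

/-! Assumptions -/

/-- The communication graph is connected; `W` is a symmetric, doubly stochastic weighted adjacency
matrix of it, with positive weights exactly on the edges and on the diagonal. -/
structure Network : Prop where
  connected : p.graph.Connected
  pos : ∀ i j, (i = j ∨ p.graph.Adj i j) → 0 < p.W i j
  zero : ∀ i j, ¬(i = j ∨ p.graph.Adj i j) → p.W i j = 0
  symm : p.Wᵀ = p.W
  rowSum : ∀ i, ∑ j, p.W i j = 1

/-- The local costs are well-defined expectations, and `L`-smooth on the Euclidean space. -/
structure Smooth : Prop where
  integrable : ∀ i X, Integrable (p.cost i X) (p.P i)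
  smooth : ∀ i, LSmooth p.L (p.fLoc i)

/-- The oracle returns tangent vectors, and is unbiased with variance at most `σ²`. -/
structure Oracle : Prop where
  prob : ∀ i, IsProbabilityMeasure (p.P i)
  measurable : ∀ i, Measurable (Function.uncurry (p.G i))
  tangent : ∀ i, ∀ X ∈ St n r, ∀ x, p.G i X x ∈ tangent X
  unbiased : ∀ i, ∀ X ∈ St n r, ∫ x, p.G i X x ∂(p.P i) = rGrad (p.fLoc i) X
  variance : ∀ i, ∀ X ∈ St n r,
    ∫ x, ‖p.G i X x - rGrad (p.fLoc i) X‖ ^ 2 ∂(p.P i) ≤ p.σ ^ 2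

/-- The stochastic gradients are uniformly bounded by `A₁ > 0` on the Stiefel manifold, and `A₂`
bounds the Euclidean gradients of the local costs there. -/
structure Bounded : Prop where
  pos : 0 < p.A₁
  oracle : ∀ i, ∀ᵐ x ∂(p.P i), ∀ X ∈ St n r, ‖p.G i X x‖ ≤ p.A₁
  gradient : ∀ i, ∀ X ∈ St n r, ‖eGrad (p.fLoc i) X‖ ≤ p.A₂

/-- All samples are independent, those of agent `i` have law `P i`, and at least one sample is
drawn at each iteration. -/
structure Sampling : Prop where
  prob : IsProbabilityMeasure p.μ
  measurable : ∀ i k j, Measurable (p.ξ i k j)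
  law : ∀ i k j, p.μ.map (p.ξ i k j) = p.P i
  indep : iIndepFun (fun (q : Fin N × ℕ × ℕ) => p.ξ q.1 q.2.1 q.2.2) p.μ
  batch_pos : ∀ k, 1 ≤ p.batch k

/-! Constants -/

/-- The second largest singular value of `W` (singular values are indexed from `0`). -/
noncomputable def σ₂ : ℝ := (Matrix.toEuclideanLin p.W).singularValues 1

/-- `L_t = 1 - λ_min(W^t)`. -/
noncomputable def Lt : ℝ := 1 - sInf (spectrum ℝ (p.W ^ p.t))

/-- The largest spectral norm of the Euclidean gradients of the local costs on `St(n, r)`. -/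
noncomputable def Ln : ℝ := sSup {s | ∃ i, ∃ X ∈ St n r, s = specNorm (eGrad (p.fLoc i) X)}

noncomputable def LG : ℝ := p.L + 2 * p.Ln

noncomputable def A : ℝ := max p.A₁ p.A₂

noncomputable def ρ : ℝ := √(1 - (p.α * p.Lt * p.Φ - p.α ^ 2 * p.Lt ^ 2))

noncomputable def βbar : ℝ :=
  min ((1 - p.ρ) / (10 * p.A + p.LG) * p.δ₁) (p.α * p.δ₁ / (5 * (10 * p.A + p.LG)))

noncomputable def Γ₀ : ℝ := 2 / (1 - p.ρ) ^ 2

noncomputable def Γ₁ : ℝ := 2 / (1 - p.ρ ^ 2) * p.consErr p.X₀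

noncomputable def Γ₂ : ℝ := 2 / (1 - p.σ₂ ^ p.t) ^ 2

/-- The mean of the sampled gradients `F_i(X_{i,k})` over the agents. -/
noncomputable def Fbar (k : ℕ) (ω : Ω) : Mat n r :=
  (1 / (N : ℝ)) • ∑ i, p.sampGrad i k ω (p.X k ω i)

noncomputable def Γ₃ : ℝ :=
  2 / (1 - p.σ₂ ^ (2 * p.t)) * ((1 / (N : ℝ)) * ∫ ω, ∑ i, ‖p.Y 0 ω i - p.Fbar 0 ω‖ ^ 2 ∂p.μ)

noncomputable def D₁ : ℝ := (p.δ₁ ^ 2 + 5) * p.LG + 2 * p.M * p.A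

noncomputable def D₄ : ℝ := 4 * r * p.δ₁ ^ 2 / (p.β ^ 2 * p.LG)

noncomputable def D₂ : ℝ :=
  3 * p.LG + 2 * p.α * p.A + 13 * p.LG * (p.δ₂ ^ 2 / r) * p.α ^ 2 + p.D₄

noncomputable def D₃ : ℝ := (1 + 4 * p.LG ^ 2 * p.β ^ 2) / (2 * p.LG)

noncomputable def D₃' : ℝ := p.D₃ + 5 * p.β / 8

noncomputable def C₀ : ℝ :=
  p.D₄ * p.Γ₀ * p.α ^ 2 * p.δ₁ ^ 2 / 25 + p.Γ₁ * (p.D₂ + p.D₄)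

noncomputable def C₁ : ℝ := p.D₂ * p.Γ₀ + p.D₄ * p.Γ₀ + p.D₁

noncomputable def Γ₁' : ℝ := 2 * p.LG ^ 2 * p.β * p.Γ₁

noncomputable def Γ₃' : ℝ :=
  p.C₀ + p.β / 2 * (p.Γ₃ + 16 * p.α ^ 2 * p.LG ^ 2 * p.Γ₂ * p.Γ₁)

/-- `M` is a constant for which the polar retraction agrees with `X + v` to second order. -/
def RetractionConst : Prop :=
  0 < p.M ∧ ∀ X ∈ St n r, ∀ v ∈ DRSGT.tangent X, ‖polarRetr X v - (X + v)‖ ≤ p.M * ‖v‖ ^ 2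

/-- The standing conditions on the parameters of the algorithm: `iam` selects an induced arithmetic
mean, the initial point lies in the local region, there are enough consensus steps, and the step
sizes are small enough. -/
structure Admissible : Prop where
  iam : ∀ Z : Fin N → Mat n r, (∀ i, Z i ∈ St n r) → IsIAM Z (p.iam Z)
  δ₁_le : p.δ₁ ≤ 1 / (5 * √r) * p.δ₂
  δ₂_le : p.δ₂ ≤ 1 / 6
  init : p.X₀ ∈ p.region
  one_le_t : 1 ≤ p.t
  le_t : Real.logb p.σ₂ (1 / (2 * √N)) ≤ p.t
  retr : p.RetractionConst
  one_le_Φ : 1 ≤ p.Φ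
  Φ_le : ∀ i, p.Φ ≤ 2 - ‖p.X₀ i - p.iam p.X₀‖ ^ 2
  α_pos : 0 < p.α
  α_le : p.α ≤ min 1 (min (1 / p.M) (p.Φ / p.Lt))
  β_pos : 0 < p.β
  β_le : p.β ≤ min p.βbar (min (1 / (9 * p.LG))
    (1 / (4 * (p.α * p.δ₁ * p.LG * (16 * p.Γ₀ + p.Γ₂) + 2 * p.C₁))))

end Model

end DRSGT

namespace DRSGT

/-! ### The Frobenius inner product -/

/-! The argument is pathwise. On the almost sure event where all sampled gradients are bounded by
`A`, deterministic recursions are proved for the consensus error E, the tracking error T, the mean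
squared direction U, the squared gradient G at the centre and the squared sampling error ν. They are
summed over the iterations and only then integrated. Probability is needed for measurability and for
E ν_k ≤ σ²/N_k: the iterate X_k depends on samples of earlier iterations only, so the errors within
a batch are centred given X_k and their cross terms vanish (`integral_norm_sq_batch_le`).

Geometry. For X, Y on the Stiefel manifold the symmetric part of Xᵀ(X - Y) is quadratic in X - Y, so
projections cost only second-order terms. The polar factor H of X + v satisfies H ≥ 1, so the
retraction is nonexpansive (`norm_polarRetr_sub_le`). First-order optimality of the induced mean c
gives avg = c(I - Q/2), with Q the second moment of the deviations. Hence the two means differ by at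
most E/2, and near consensus c is Lipschitz in the arithmetic mean.

Consensus and descent. W contracts mean zero vectors strictly (`Gossip.singularValue`), and s = σ₂^t
≤ 1/(2√N) < 0.354 because N ≥ 2. The consensus part of a step then contracts by 1 - 11α/20
(`rms_consensus_le`), the local region is invariant (`Near.step`) and the trackers stay below 6A.
Averaging over agents cancels the linear mixing term, so the centre follows a perturbed gradient
step and the cost descends (`Trajectory.descent`).

Closing the loop. Put Λ = 10A + L_G. Since D₄ contains 1/β², the step size conditions force 1600βΛΓ₀
≤ 1 and 640δ₁ ≤ α. All couplings between the sums are therefore small and the linear system can be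
solved (`solve_sums`). The rate ρ_t serves only for comparison: 1 - ρ_t ≤ αL_t ≤ 1.354α makes Γ₀ and
Γ₁ dominate the constants found here. A minimum is at most an average. -/

theorem frobenius_norm_sq_eq_trace {n r : ℕ} (A : Matrix (Fin n) (Fin r) ℝ) :
    ‖A‖ ^ 2 = (Aᵀ * A).trace := by
  rw [Matrix.frobenius_norm_def, ← Real.sqrt_eq_rpow, Real.sq_sqrt (by positivity)]
  simp only [Matrix.trace, Matrix.diag_apply, Matrix.mul_apply, Matrix.transpose_apply]
  rw [Finset.sum_comm]
  refine Finset.sum_congr rfl fun i _ => Finset.sum_congr rfl fun j _ => ?_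
  rw [Real.rpow_two, Real.norm_eq_abs, sq_abs, sq]

/-- The inner product of which the Frobenius norm is the norm. -/
noncomputable instance instInnerProductSpaceMat {n r : ℕ} :
    InnerProductSpace ℝ (Matrix (Fin n) (Fin r) ℝ) where
  inner A B := (Aᵀ * B).trace
  norm_sq_eq_re_inner A := by simpa using frobenius_norm_sq_eq_trace A
  conj_inner_symm A B := by
    simp only [conj_trivial]
    rw [← Matrix.trace_transpose, Matrix.transpose_mul, Matrix.transpose_transpose]
  add_left A B C := by simp [Matrix.add_mul]
  smul_left A B c := by simp

section Inner

variable {n r m : ℕ}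

theorem inner_eq_trace (A B : Mat n r) : inner ℝ A B = (Aᵀ * B).trace := rfl

theorem inner_mul_left_eq (X : Mat n m) (S : Mat m r) (B : Mat n r) :
    inner ℝ (X * S) B = inner ℝ S (Xᵀ * B) := by
  simp only [inner_eq_trace, Matrix.transpose_mul, Matrix.mul_assoc]

theorem inner_transpose (A B : Mat n r) : inner ℝ Aᵀ Bᵀ = inner ℝ A B := by
  rw [inner_eq_trace, inner_eq_trace, Matrix.transpose_transpose, ← Matrix.trace_transpose,
    Matrix.transpose_mul, Matrix.transpose_transpose, Matrix.trace_mul_comm]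

theorem inner_symmetric {S : Mat r r} (hS : Sᵀ = S) (B : Mat r r) :
    inner ℝ S B = (1 / 2) * inner ℝ S (B + Bᵀ) := by
  have h : inner ℝ S Bᵀ = inner ℝ S B := by
    conv_lhs => rw [← hS]
    exact inner_transpose S B
  rw [inner_add_right, h]; ring

theorem norm_mul_le' (A : Mat n m) (B : Mat m r) : ‖A * B‖ ≤ ‖A‖ * ‖B‖ :=
  Matrix.frobenius_norm_mul A B

theorem norm_transpose_mul_self_le (A : Mat n r) : ‖Aᵀ * A‖ ≤ ‖A‖ ^ 2 := by
  have := norm_mul_le' Aᵀ A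
  rwa [Matrix.frobenius_norm_transpose, ← sq] at this

end Inner

/-! ### Points and tangent vectors of the Stiefel manifold -/

section Stiefel

variable {n r m : ℕ} {X Y : Mat n r}

theorem norm_St_mul (hX : X ∈ St n r) (S : Mat r m) : ‖X * S‖ = ‖S‖ := by
  have hX' : Xᵀ * X = 1 := hX
  rw [← sq_eq_sq₀ (norm_nonneg _) (norm_nonneg _), ← real_inner_self_eq_norm_sq,
    ← real_inner_self_eq_norm_sq, inner_mul_left_eq, ← Matrix.mul_assoc, hX', Matrix.one_mul]

theorem norm_St_transpose_mul_le (hX : X ∈ St n r) (B : Mat n m) : ‖Xᵀ * B‖ ≤ ‖B‖ := by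
  rcases (norm_nonneg (Xᵀ * B)).eq_or_lt with h | h
  · rw [← h]; exact norm_nonneg _
  have h1 : ‖Xᵀ * B‖ ^ 2 ≤ ‖Xᵀ * B‖ * ‖B‖ := by
    rw [← real_inner_self_eq_norm_sq, ← inner_mul_left_eq]
    refine (real_inner_le_norm _ _).trans ?_
    rw [norm_St_mul hX]
  nlinarith

theorem norm_mul_St_le (hX : X ∈ St n r) (B : Mat m n) : ‖B * X‖ ≤ ‖B‖ := by
  have := norm_St_transpose_mul_le hX Bᵀ
  rwa [← Matrix.transpose_mul, Matrix.frobenius_norm_transpose,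
    Matrix.frobenius_norm_transpose] at this

theorem norm_sq_of_mem_St (hX : X ∈ St n r) : ‖X‖ ^ 2 = r := by
  have hX' : Xᵀ * X = 1 := hX
  rw [frobenius_norm_sq_eq_trace, hX']; simp

theorem mem_tangent_iff {X u : Mat n r} : u ∈ tangent X ↔ Xᵀ * u + uᵀ * X = 0 := Iff.rfl

/-- XᵀX and YᵀY are both the identity, so the first-order part cancels. This identity is the source
of the second-order curvature estimates below. -/
theorem St_transpose_sub_mul_sub (hX : X ∈ St n r) (hY : Y ∈ St n r) :
    Xᵀ * (X - Y) + (Xᵀ * (X - Y))ᵀ = (X - Y)ᵀ * (X - Y) := by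
  have hX' : Xᵀ * X = 1 := hX
  have hY' : Yᵀ * Y = 1 := hY
  simp only [Matrix.mul_sub, Matrix.sub_mul, Matrix.transpose_sub, Matrix.transpose_mul,
    Matrix.transpose_transpose, hX', hY', Matrix.transpose_one]
  abel

theorem inner_St_mul_sub (hX : X ∈ St n r) (hY : Y ∈ St n r) {S : Mat r r} (hS : Sᵀ = S) :
    inner ℝ (X * S) (X - Y) = (1 / 2) * inner ℝ S ((X - Y)ᵀ * (X - Y)) := by
  rw [inner_mul_left_eq, inner_symmetric hS, St_transpose_sub_mul_sub hX hY]

theorem inner_tangent_mul_symmetric {u : Mat n r} (hu : u ∈ tangent X) {S : Mat r r}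
    (hS : Sᵀ = S) : inner ℝ (X * S) u = 0 := by
  rw [inner_mul_left_eq, inner_symmetric hS, Matrix.transpose_mul, Matrix.transpose_transpose,
    mem_tangent_iff.1 hu]
  simp

theorem projT_add (X Z Z' : Mat n r) : projT X (Z + Z') = projT X Z + projT X Z' := by
  simp only [projT, Matrix.mul_add, Matrix.add_mul, Matrix.transpose_add, smul_add]
  abel

theorem projT_smul (X Z : Mat n r) (c : ℝ) : projT X (c • Z) = c • projT X Z := by
  simp only [projT, Matrix.mul_add, Matrix.transpose_smul, Matrix.mul_smul, Matrix.smul_mul,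
    smul_add, smul_sub, smul_comm c (1 / 2 : ℝ)]

/-- `projT X` as a linear map. -/
noncomputable def projTₗ (X : Mat n r) : Mat n r →ₗ[ℝ] Mat n r where
  toFun := projT X
  map_add' := projT_add X
  map_smul' c Z := projT_smul X Z c

theorem projT_sum {ι : Type*} (s : Finset ι) (X : Mat n r) (Z : ι → Mat n r) :
    projT X (∑ i ∈ s, Z i) = ∑ i ∈ s, projT X (Z i) := map_sum (projTₗ X) Z s

theorem projT_sub (X Z Z' : Mat n r) : projT X (Z - Z') = projT X Z - projT X Z' :=
  map_sub (projTₗ X) Z Z'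

theorem inner_projT {u : Mat n r} (hu : u ∈ tangent X) (Z : Mat n r) :
    inner ℝ (projT X Z) u = inner ℝ Z u := by
  have := projT_orthogonal hu Z
  rw [← inner_eq_trace, inner_sub_left] at this
  linarith

theorem norm_projT_le (hX : X ∈ St n r) (Z : Mat n r) : ‖projT X Z‖ ≤ ‖Z‖ := by
  have h := inner_projT (projT_mem_tangent hX Z) Z
  rw [real_inner_self_eq_norm_sq] at h
  have h2 := real_inner_le_norm Z (projT X Z)
  rcases (norm_nonneg (projT X Z)).eq_or_lt with h0 | h0
  · rw [← h0]; exact norm_nonneg _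
  nlinarith

/-- Projecting a second point of the manifold changes the chord Y - X only by an explicit normal
term, quadratic in the chord. -/
theorem projT_St (hX : X ∈ St n r) (hY : Y ∈ St n r) :
    projT X Y = Y - X + (1 / 2 : ℝ) • (X * ((X - Y)ᵀ * (X - Y))) := by
  have hX' : Xᵀ * X = 1 := hX
  have hY' : Yᵀ * Y = 1 := hY
  have h : (X - Y)ᵀ * (X - Y) = (2 : ℝ) • 1 - (Xᵀ * Y + Yᵀ * X) := by
    simp only [Matrix.mul_sub, Matrix.sub_mul, Matrix.transpose_sub, hX', hY', two_smul]
    abel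
  rw [h, projT, Matrix.mul_sub, smul_sub, Matrix.mul_smul, smul_smul]
  norm_num

theorem tangent_smul {u : Mat n r} (hu : u ∈ tangent X) (c : ℝ) : c • u ∈ tangent X := by
  rw [mem_tangent_iff] at *
  rw [Matrix.mul_smul, Matrix.transpose_smul, Matrix.smul_mul, ← smul_add, hu, smul_zero]

theorem tangent_add {u v : Mat n r} (hu : u ∈ tangent X) (hv : v ∈ tangent X) :
    u + v ∈ tangent X := by
  rw [mem_tangent_iff] at *
  rw [Matrix.mul_add, Matrix.transpose_add, Matrix.add_mul, add_add_add_comm, hu, hv, add_zero]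

theorem tangent_sub {u v : Mat n r} (hu : u ∈ tangent X) (hv : v ∈ tangent X) :
    u - v ∈ tangent X := by
  have := tangent_add hu (tangent_smul hv (-1))
  rwa [neg_one_smul, ← sub_eq_add_neg] at this

/-- The normal component `Z - projT X Z` pairs weakly with tangent vectors at nearby points. -/
theorem inner_sub_projT_le (hX : X ∈ St n r) {u : Mat n r} (hu : u ∈ tangent Y)
    (Z : Mat n r) : |inner ℝ u (Z - projT X Z)| ≤ ‖u‖ * ‖X - Y‖ * ‖Z‖ := by
  set S : Mat r r := (1 / 2 : ℝ) • (Xᵀ * Z + Zᵀ * X) with hS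
  have hSt : Sᵀ = S := by
    simp [hS, Matrix.transpose_add, Matrix.transpose_mul, add_comm]
  have h0 : Z - projT X Z = X * S := by rw [projT, hS, Matrix.mul_smul, sub_sub_cancel]
  -- The normal part X * S is compared with Y * S, which is normal at Y and hence orthogonal to u;
  -- the difference carries the factor X - Y.
  have h1 : inner ℝ (Y * S) u = 0 := inner_tangent_mul_symmetric hu hSt
  have h2 : inner ℝ u (X * S) = inner ℝ ((X - Y) * S) u := by
    rw [Matrix.sub_mul, inner_sub_left, h1, sub_zero, real_inner_comm]
  have h3 : ‖S‖ ≤ ‖Z‖ := by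
    rw [hS, norm_smul]
    have h4 : ‖Xᵀ * Z‖ ≤ ‖Z‖ := norm_St_transpose_mul_le hX Z
    have h5 : ‖Zᵀ * X‖ ≤ ‖Z‖ := by
      have := norm_mul_St_le hX Zᵀ
      rwa [Matrix.frobenius_norm_transpose] at this
    have := norm_add_le (Xᵀ * Z) (Zᵀ * X)
    norm_num
    linarith
  rw [h0, h2]
  refine (abs_real_inner_le_norm _ _).trans ?_
  calc ‖(X - Y) * S‖ * ‖u‖ ≤ (‖X - Y‖ * ‖Z‖) * ‖u‖ := by
        gcongr
        exact (norm_mul_le' _ _).trans (by gcongr)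
    _ = ‖u‖ * ‖X - Y‖ * ‖Z‖ := by ring

/-- A polar decomposition `Q * H` with `H ≥ c` is strongly monotone against points of `St`. -/
theorem inner_polar_sub_ge (hX : X ∈ St n r) (hY : Y ∈ St n r) {H : Mat r r} (hH : Hᵀ = H)
    {c : ℝ} (hc : ∀ D : Mat n r, c * ‖D‖ ^ 2 ≤ inner ℝ H (Dᵀ * D)) :
    c / 2 * ‖X - Y‖ ^ 2 ≤ inner ℝ (X * H) (X - Y) := by
  rw [inner_St_mul_sub hX hY hH]
  linarith [hc (X - Y)]

end Stiefel

/-! ### The polar retraction -/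

section Polar

variable {n r : ℕ}

theorem one_le_of_mem_spectrum {v : Mat n r} {x : ℝ}
    (hx : x ∈ spectrum ℝ (1 + vᵀ * v : Matrix (Fin r) (Fin r) ℝ)) : 1 ≤ x := by
  have hps : (vᵀ * v).PosSemidef := by
    simpa using Matrix.posSemidef_conjTranspose_mul_self v
  have h1 : x - 1 ∈ spectrum ℝ (vᵀ * v) := by
    rw [spectrum.mem_iff] at hx ⊢
    convert! hx using 2
    simp [map_sub]; abel
  rw [hps.isHermitian.spectrum_real_eq_range_eigenvalues] at h1
  obtain ⟨i, hi⟩ := h1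
  have := hps.eigenvalues_nonneg i
  linarith

/-- Tangency makes I + vᵀv the Gram matrix of X + v, so H is its square root. As the spectrum lies
in [1, ∞), H ≥ 1, which is stated in the weak form needed for monotonicity. -/
theorem exists_polar (X v : Mat n r) (hX : X ∈ St n r) (hv : v ∈ tangent X) :
    polarRetr X v ∈ St n r ∧ ∃ H : Mat r r, Hᵀ = H ∧ X + v = polarRetr X v * H ∧
      ∀ D : Mat n r, ‖D‖ ^ 2 ≤ inner ℝ H (Dᵀ * D) := by
  have hX' : Xᵀ * X = 1 := hX
  set B : Matrix (Fin r) (Fin r) ℝ := 1 + vᵀ * v with hB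
  have hBsa : IsSelfAdjoint B := by
    rw [IsSelfAdjoint, Matrix.star_eq_conjTranspose]
    simp [hB, Matrix.conjTranspose_eq_transpose_of_trivial]
  have hXv : (X + v)ᵀ * (X + v) = B := by
    have := mem_tangent_iff.1 hv
    rw [Matrix.transpose_add, Matrix.add_mul, Matrix.mul_add, Matrix.mul_add, hX', hB]
    calc 1 + Xᵀ * v + (vᵀ * X + vᵀ * v) = 1 + vᵀ * v + (Xᵀ * v + vᵀ * X) := by abel
      _ = _ := by rw [this, add_zero]
  -- The spectrum is finite, so every real function is continuous on it and the functional calculus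
  -- applies without side conditions.
  have hfin : (spectrum ℝ B).Finite := Matrix.finite_real_spectrum
  have hcont : ∀ f : ℝ → ℝ, ContinuousOn f (spectrum ℝ B) := fun f => hfin.continuousOn f
  have hsymm : ∀ f : ℝ → ℝ, (cfc f B)ᵀ = cfc f B := fun f => by
    have : IsSelfAdjoint (cfc f B) := cfc_predicate f B
    rwa [IsSelfAdjoint, Matrix.star_eq_conjTranspose,
      Matrix.conjTranspose_eq_transpose_of_trivial] at this
  set C := cfc (fun x : ℝ => x ^ (-(1 / 2) : ℝ)) B with hC
  set H := cfc (fun x : ℝ => √x) B with hH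
  -- E is the square root of H - 1; it turns H ≥ 1 into the nonnegativity of a squared norm.
  set E := cfc (fun x : ℝ => √(√x - 1)) B with hE
  have hR : polarRetr X v = (X + v) * C := rfl
  have hpos : ∀ x ∈ spectrum ℝ B, 1 ≤ x := fun x hx => one_le_of_mem_spectrum hx
  have hCH : C * H = 1 := by
    rw [hC, hH, ← cfc_mul _ _ B (hcont _) (hcont _), ← cfc_one ℝ B]
    refine cfc_congr fun x hx => ?_
    have hx1 := hpos x hx
    simp only [Pi.one_apply]
    rw [Real.sqrt_eq_rpow, ← Real.rpow_add (by linarith)]; norm_num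
  have hCBC : C * (B * C) = 1 := by
    have hid : B = cfc (fun x : ℝ => x) B := (cfc_id' ℝ B).symm
    rw [hC]
    conv_lhs => enter [2, 1]; rw [hid]
    rw [← cfc_mul _ _ B (hcont _) (hcont _), ← cfc_mul _ _ B (hcont _) (hcont _),
      ← cfc_one ℝ B]
    refine cfc_congr fun x hx => ?_
    have hx1 := hpos x hx
    have hx0 : 0 < x := by linarith
    simp only [Pi.one_apply]
    calc x ^ (-(1 / 2) : ℝ) * (x * x ^ (-(1 / 2) : ℝ))
        = x ^ (-(1 / 2) : ℝ) * (x ^ (1 : ℝ) * x ^ (-(1 / 2) : ℝ)) := by rw [Real.rpow_one]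
      _ = 1 := by rw [← Real.rpow_add hx0, ← Real.rpow_add hx0]; norm_num
  have hHE : H = 1 + E * E := by
    rw [hE, hH, ← cfc_mul _ _ B (hcont _) (hcont _), ← cfc_one ℝ B,
      ← cfc_add _ _ _ (hcont _) (hcont _)]
    refine cfc_congr fun x hx => ?_
    have hx1 : 1 ≤ √x := Real.one_le_sqrt.2 (hpos x hx)
    simp only [Pi.one_apply]
    rw [Real.mul_self_sqrt (by linarith)]; ring
  refine ⟨?_, H, hsymm _, ?_, fun D => ?_⟩
  · change (polarRetr X v)ᵀ * polarRetr X v = 1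
    rw [hR, Matrix.transpose_mul, hsymm, Matrix.mul_assoc, ← Matrix.mul_assoc (X + v)ᵀ, hXv, hCBC]
  · rw [hR, Matrix.mul_assoc, hCH, Matrix.mul_one]
  · have h1 : inner ℝ (1 : Mat r r) (Dᵀ * D) = ‖D‖ ^ 2 := by
      rw [inner_eq_trace, Matrix.transpose_one, Matrix.one_mul, frobenius_norm_sq_eq_trace]
    have h2 : inner ℝ (E * E) (Dᵀ * D) = ‖D * E‖ ^ 2 := by
      rw [frobenius_norm_sq_eq_trace, inner_eq_trace, Matrix.transpose_mul, Matrix.transpose_mul,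
        hsymm]
      rw [Matrix.mul_assoc, Matrix.trace_mul_comm, Matrix.mul_assoc, Matrix.mul_assoc,
        Matrix.mul_assoc]
    rw [hHE, inner_add_left, h1, h2]
    have := sq_nonneg ‖D * E‖
    linarith

theorem polarRetr_mem {X v : Mat n r} (hX : X ∈ St n r) (hv : v ∈ tangent X) :
    polarRetr X v ∈ St n r := (exists_polar X v hX hv).1

/-- The polar retraction is nonexpansive in `X + v`. -/
theorem norm_polarRetr_sub_le {X v X' v' : Mat n r} (hX : X ∈ St n r) (hv : v ∈ tangent X)
    (hX' : X' ∈ St n r) (hv' : v' ∈ tangent X') :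
    ‖polarRetr X v - polarRetr X' v'‖ ≤ ‖(X + v) - (X' + v')‖ := by
  obtain ⟨hR, H, hH, he, hc⟩ := exists_polar X v hX hv
  obtain ⟨hR', H', hH', he', hc'⟩ := exists_polar X' v' hX' hv'
  -- Each polar decomposition contributes half of the squared distance. The sum bounds ‖R - R'‖² by
  -- the inner product of R - R' with the difference of the arguments, and Cauchy–Schwarz concludes.
  have h1 := inner_polar_sub_ge hR hR' hH (c := 1) (by simpa using hc)
  have h2 := inner_polar_sub_ge hR' hR hH' (c := 1) (by simpa using hc')
  rw [← he] at h1
  rw [← he', ← neg_sub, inner_neg_right, norm_neg] at h2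
  have h3 := real_inner_le_norm ((X + v) - (X' + v')) (polarRetr X v - polarRetr X' v')
  rw [inner_sub_left] at h3
  rcases (norm_nonneg (polarRetr X v - polarRetr X' v')).eq_or_lt with h0 | h0
  · rw [← h0]; exact norm_nonneg _
  nlinarith

theorem zero_mem_tangent (X : Mat n r) : (0 : Mat n r) ∈ tangent X := by
  rw [mem_tangent_iff]; simp

theorem polarRetr_zero (X : Mat n r) : polarRetr X 0 = X := by
  simp [polarRetr]

theorem norm_polarRetr_sub_St_le {X v Z : Mat n r} (hX : X ∈ St n r) (hv : v ∈ tangent X)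
    (hZ : Z ∈ St n r) : ‖polarRetr X v - Z‖ ≤ ‖X + v - Z‖ := by
  simpa [polarRetr_zero] using norm_polarRetr_sub_le hX hv hZ (zero_mem_tangent Z)

end Polar

/-! ### Averages over the agents -/

section Average

variable {N n r : ℕ}

/-- The arithmetic mean of the agents' matrices. -/
noncomputable def avg (Z : Fin N → Mat n r) : Mat n r := (1 / (N : ℝ)) • ∑ i, Z i

/-- The mean of the agents' real values. -/
noncomputable def mean (x : Fin N → ℝ) : ℝ := (1 / (N : ℝ)) * ∑ i, x i

/-- The mean square norm of a stack. -/
noncomputable def msq (Z : Fin N → Mat n r) : ℝ := mean fun i => ‖Z i‖ ^ 2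

/-- The root mean square norm of a stack. -/
noncomputable def rms (Z : Fin N → Mat n r) : ℝ := √(msq Z)

theorem mean_mono {x y : Fin N → ℝ} (h : ∀ i, x i ≤ y i) : mean x ≤ mean y := by
  unfold mean
  gcongr with i
  exact h i

theorem mean_nonneg {x : Fin N → ℝ} (h : ∀ i, 0 ≤ x i) : 0 ≤ mean x :=
  mul_nonneg (by positivity) (Finset.sum_nonneg fun i _ => h i)

theorem mean_add (x y : Fin N → ℝ) : mean (fun i => x i + y i) = mean x + mean y := by
  simp only [mean, Finset.sum_add_distrib, mul_add]

theorem mean_mul (c : ℝ) (x : Fin N → ℝ) : mean (fun i => c * x i) = c * mean x := by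
  simp only [mean, ← Finset.mul_sum]; ring

theorem mean_const (hN : 0 < N) (c : ℝ) : mean (fun _ : Fin N => c) = c := by
  have : (N : ℝ) ≠ 0 := by positivity
  simp only [mean, Finset.sum_const, Finset.card_univ, Fintype.card_fin, nsmul_eq_mul]
  field_simp

theorem mean_le_of_le (hN : 0 < N) {x : Fin N → ℝ} {c : ℝ} (h : ∀ i, x i ≤ c) : mean x ≤ c :=
  (mean_mono h).trans_eq (mean_const hN c)

theorem msq_nonneg (Z : Fin N → Mat n r) : 0 ≤ msq Z := mean_nonneg fun _ => by positivity

theorem rms_nonneg (Z : Fin N → Mat n r) : 0 ≤ rms Z := Real.sqrt_nonneg _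

theorem rms_sq (Z : Fin N → Mat n r) : rms Z ^ 2 = msq Z := Real.sq_sqrt (msq_nonneg Z)

theorem rms_eq_norm (Z : Fin N → Mat n r) :
    rms Z = √(1 / (N : ℝ)) * ‖(WithLp.toLp 2 Z : PiLp 2 fun _ : Fin N => Mat n r)‖ := by
  rw [PiLp.norm_eq_of_L2, ← Real.sqrt_mul (by positivity)]
  rfl

theorem rms_add_le (Z Z' : Fin N → Mat n r) : rms (Z + Z') ≤ rms Z + rms Z' := by
  simp only [rms_eq_norm, WithLp.toLp_add, ← mul_add]
  gcongr
  exact norm_add_le _ _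

theorem rms_smul (c : ℝ) (Z : Fin N → Mat n r) : rms (c • Z) = |c| * rms Z := by
  simp only [rms_eq_norm, WithLp.toLp_smul, norm_smul, Real.norm_eq_abs]; ring

theorem rms_sub_le (Z Z' : Fin N → Mat n r) : rms (Z - Z') ≤ rms Z + rms Z' := by
  simp only [rms_eq_norm, WithLp.toLp_sub, ← mul_add]
  gcongr
  exact norm_sub_le _ _

theorem msq_mono {Z Z' : Fin N → Mat n r} (h : ∀ i, ‖Z i‖ ≤ ‖Z' i‖) : msq Z ≤ msq Z' :=
  mean_mono fun i => by gcongr; exact h i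

theorem rms_mono {Z Z' : Fin N → Mat n r} (h : ∀ i, ‖Z i‖ ≤ ‖Z' i‖) : rms Z ≤ rms Z' :=
  Real.sqrt_le_sqrt (msq_mono h)

theorem msq_le_of_le (hN : 0 < N) {Z : Fin N → Mat n r} {c : ℝ} (h : ∀ i, ‖Z i‖ ≤ c) :
    msq Z ≤ c ^ 2 := mean_le_of_le hN fun i => by gcongr; exact h i

theorem rms_le_of_le (hN : 0 < N) {Z : Fin N → Mat n r} {c : ℝ} (h : ∀ i, ‖Z i‖ ≤ c) :
    rms Z ≤ c :=
  Real.sqrt_le_iff.2 ⟨(norm_nonneg _).trans (h ⟨0, hN⟩), msq_le_of_le hN h⟩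

theorem norm_le_sqrt_mul_rms (hN : 0 < N) (Z : Fin N → Mat n r) (i : Fin N) :
    ‖Z i‖ ≤ √N * rms Z := by
  have hN' : (0 : ℝ) < N := by positivity
  rw [rms, ← Real.sqrt_mul hN'.le]
  refine Real.le_sqrt_of_sq_le ?_
  rw [msq, mean, ← mul_assoc, mul_one_div_cancel hN'.ne', one_mul]
  exact Finset.single_le_sum (f := fun i => ‖Z i‖ ^ 2) (fun _ _ => by positivity)
    (Finset.mem_univ i)

theorem avg_add (Z Z' : Fin N → Mat n r) : avg (Z + Z') = avg Z + avg Z' := by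
  simp [avg, Finset.sum_add_distrib, smul_add]

theorem avg_sub (Z Z' : Fin N → Mat n r) : avg (Z - Z') = avg Z - avg Z' := by
  simp [avg, Finset.sum_sub_distrib, smul_sub]

theorem avg_smul (c : ℝ) (Z : Fin N → Mat n r) : avg (c • Z) = c • avg Z := by
  simp [avg, ← Finset.smul_sum, smul_comm c]

theorem avg_const (hN : 0 < N) (C : Mat n r) : avg (fun _ : Fin N => C) = C := by
  have : (N : ℝ) ≠ 0 := by positivity
  rw [avg, Finset.sum_const, Finset.card_univ, Fintype.card_fin, ← Nat.cast_smul_eq_nsmul ℝ,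
    smul_smul, one_div_mul_cancel this, one_smul]

theorem inner_avg (C : Mat n r) (Z : Fin N → Mat n r) :
    inner ℝ C (avg Z) = mean fun i => inner ℝ C (Z i) := by
  rw [avg, inner_smul_right, inner_sum, mean]

theorem norm_avg_le_mean (Z : Fin N → Mat n r) : ‖avg Z‖ ≤ mean fun i => ‖Z i‖ := by
  rw [avg, norm_smul, Real.norm_of_nonneg (by positivity), mean]
  gcongr
  exact norm_sum_le _ _

theorem norm_avg_le (hN : 0 < N) {Z : Fin N → Mat n r} {c : ℝ} (h : ∀ i, ‖Z i‖ ≤ c) :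
    ‖avg Z‖ ≤ c := (norm_avg_le_mean Z).trans (mean_le_of_le hN h)

theorem avg_sub_avg (hN : 0 < N) (Z : Fin N → Mat n r) : avg (fun i => Z i - avg Z) = 0 := by
  have := avg_sub Z (fun _ => avg Z)
  rw [avg_const hN, sub_self] at this
  exact this

/-- Decomposition of the mean square into mean and fluctuation. -/
theorem msq_eq (hN : 0 < N) (Z : Fin N → Mat n r) :
    msq Z = ‖avg Z‖ ^ 2 + msq fun i => Z i - avg Z := by
  have h1 : ∀ i, ‖Z i‖ ^ 2 = ‖avg Z‖ ^ 2 + (2 * inner ℝ (avg Z) (Z i - avg Z)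
      + ‖Z i - avg Z‖ ^ 2) := fun i => by
    have := norm_add_sq_real (avg Z) (Z i - avg Z)
    rw [add_sub_cancel] at this
    rw [this]; ring
  rw [msq, funext h1, mean_add, mean_const hN, mean_add, mean_mul, ← inner_avg, avg_sub_avg hN,
    inner_zero_right, mul_zero, zero_add]
  rfl

theorem norm_avg_sq_le_msq (hN : 0 < N) (Z : Fin N → Mat n r) : ‖avg Z‖ ^ 2 ≤ msq Z := by
  rw [msq_eq hN Z]
  linarith [msq_nonneg fun i => Z i - avg Z]

theorem norm_avg_le_rms (hN : 0 < N) (Z : Fin N → Mat n r) : ‖avg Z‖ ≤ rms Z :=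
  Real.le_sqrt_of_sq_le (norm_avg_sq_le_msq hN Z)

theorem msq_sub_avg_le (hN : 0 < N) (Z : Fin N → Mat n r) :
    (msq fun i => Z i - avg Z) ≤ msq Z := by
  rw [msq_eq hN Z]
  linarith [sq_nonneg ‖avg Z‖]

theorem rms_sub_avg_le (hN : 0 < N) (Z : Fin N → Mat n r) :
    (rms fun i => Z i - avg Z) ≤ rms Z := Real.sqrt_le_sqrt (msq_sub_avg_le hN Z)

theorem mean_norm_le_rms (hN : 0 < N) (Z : Fin N → Mat n r) : (mean fun i => ‖Z i‖) ≤ rms Z := by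
  refine Real.le_sqrt_of_sq_le ?_
  have hN' : (0 : ℝ) < N := by positivity
  have h2 := sq_sum_le_card_mul_sum_sq (s := (Finset.univ : Finset (Fin N)))
    (f := fun i => ‖Z i‖)
  rw [Finset.card_univ, Fintype.card_fin] at h2
  rw [msq, mean, mean, mul_pow]
  calc (1 / (N : ℝ)) ^ 2 * (∑ i, ‖Z i‖) ^ 2 ≤ (1 / (N : ℝ)) ^ 2 * (N * ∑ i, ‖Z i‖ ^ 2) := by gcongr
    _ = _ := by field_simp

theorem msq_add_le (Z Z' : Fin N → Mat n r) : msq (Z + Z') ≤ 2 * msq Z + 2 * msq Z' := by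
  have := rms_add_le Z Z'
  rw [← rms_sq, ← rms_sq, ← rms_sq]
  nlinarith [rms_nonneg Z, rms_nonneg Z', rms_nonneg (Z + Z'), sq_nonneg (rms Z - rms Z')]

theorem msq_sub_le (Z Z' : Fin N → Mat n r) : msq (Z - Z') ≤ 2 * msq Z + 2 * msq Z' := by
  have := rms_sub_le Z Z'
  rw [← rms_sq, ← rms_sq, ← rms_sq]
  nlinarith [rms_nonneg Z, rms_nonneg Z', rms_nonneg (Z - Z'), sq_nonneg (rms Z - rms Z')]

theorem msq_smul (c : ℝ) (Z : Fin N → Mat n r) : msq (c • Z) = c ^ 2 * msq Z := by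
  rw [← rms_sq, ← rms_sq, rms_smul, mul_pow, sq_abs]

end Average

/-! ### Mixing matrices -/

/-- The averaging step with weights `V`. -/
noncomputable def mix {N n r : ℕ} (V : Matrix (Fin N) (Fin N) ℝ) (Z : Fin N → Mat n r)
    (i : Fin N) : Mat n r := ∑ j, V i j • Z j

/-- `V` is a symmetric doubly stochastic matrix contracting mean zero vectors by `s`, where `s` is
small compared to the number of agents. -/
structure Mixing {N : ℕ} (V : Matrix (Fin N) (Fin N) ℝ) (s : ℝ) : Prop where
  two_le : 2 ≤ N
  nonneg : ∀ i j, 0 ≤ V i j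
  symm : ∀ i j, V i j = V j i
  sum : ∀ i, ∑ j, V i j = 1
  s_nonneg : 0 ≤ s
  s_le : s ≤ 1 / (2 * √N)
  contract : ∀ x : Fin N → ℝ, ∑ i, x i = 0 →
    ∑ i, (∑ j, V i j * x j) ^ 2 ≤ s ^ 2 * ∑ i, x i ^ 2

section Mix

variable {N n r : ℕ} {V : Matrix (Fin N) (Fin N) ℝ} {s : ℝ}

theorem Mixing.pos (hV : Mixing V s) : 0 < N := lt_of_lt_of_le two_pos hV.two_le

theorem Mixing.sum' (hV : Mixing V s) (j : Fin N) : ∑ i, V i j = 1 := by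
  rw [← hV.sum j]
  exact Finset.sum_congr rfl fun i _ => hV.symm i j

theorem Mixing.s_mul_sqrt (hV : Mixing V s) : s * √N ≤ 1 / 2 := by
  have hN : (0 : ℝ) < √N := Real.sqrt_pos.2 (by exact_mod_cast hV.pos)
  have := mul_le_mul_of_nonneg_right hV.s_le hN.le
  rwa [show 1 / (2 * √N) * √N = 1 / 2 by field_simp] at this

/-- Rounding of 1/(2√2), available because there are at least two agents. All later numerical
constants rest on this value. -/
theorem Mixing.s_le_const (hV : Mixing V s) : s ≤ 354 / 1000 := by
  have h2 : (1.4125 : ℝ) ≤ √N := Real.le_sqrt_of_sq_le (by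
    have : (2 : ℝ) ≤ N := by exact_mod_cast hV.two_le
    norm_num; linarith)
  have := hV.s_mul_sqrt
  have := hV.s_nonneg
  nlinarith

theorem mix_sub (V : Matrix (Fin N) (Fin N) ℝ) (Z Z' : Fin N → Mat n r) :
    mix V (Z - Z') = mix V Z - mix V Z' := by
  funext i
  simp [mix, smul_sub, Finset.sum_sub_distrib]

theorem mix_const (hV : Mixing V s) (C : Mat n r) : mix V (fun _ => C) = fun _ => C := by
  funext i
  rw [mix, ← Finset.sum_smul, hV.sum, one_smul]

theorem avg_mix (hV : Mixing V s) (Z : Fin N → Mat n r) : avg (mix V Z) = avg Z := by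
  simp only [avg, mix]
  rw [Finset.sum_comm]
  congr 1
  refine Finset.sum_congr rfl fun j _ => ?_
  rw [← Finset.sum_smul, hV.sum', one_smul]

theorem frobenius_norm_sq_eq_sum (A : Mat n r) : ‖A‖ ^ 2 = ∑ a, ∑ b, A a b ^ 2 := by
  rw [Matrix.frobenius_norm_def, ← Real.sqrt_eq_rpow, Real.sq_sqrt (by positivity)]
  simp

/-- The squared Frobenius norm is a sum over entries, and mixing acts on each entry separately, so
the scalar contraction applies entry by entry. -/
theorem rms_mix_le_of_avg_eq_zero (hV : Mixing V s) {Z : Fin N → Mat n r} (hZ : avg Z = 0) :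
    rms (mix V Z) ≤ s * rms Z := by
  have hN : (0 : ℝ) < N := by exact_mod_cast hV.pos
  have h0 : ∀ a b, ∑ i, Z i a b = 0 := fun a b => by
    have h : ∑ i, Z i = 0 := by
      rw [avg] at hZ
      exact (smul_eq_zero.1 hZ).resolve_left (by positivity)
    have := congrFun (congrFun h a) b
    simpa [Matrix.sum_apply] using this
  refine Real.sqrt_le_iff.2 ⟨mul_nonneg hV.s_nonneg (rms_nonneg _), ?_⟩
  rw [mul_pow, rms_sq, msq, msq, mean, mean, mul_left_comm]
  gcongr
  simp only [frobenius_norm_sq_eq_sum]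
  have hsw : ∀ F : Fin N → Fin n → Fin r → ℝ,
      ∑ i, ∑ a, ∑ b, F i a b = ∑ a, ∑ b, ∑ i, F i a b := fun F => by
    rw [Finset.sum_comm]
    exact Finset.sum_congr rfl fun a _ => Finset.sum_comm
  rw [hsw, hsw, Finset.mul_sum]
  refine Finset.sum_le_sum fun a _ => ?_
  rw [Finset.mul_sum]
  refine Finset.sum_le_sum fun b _ => ?_
  have := hV.contract (fun i => Z i a b) (h0 a b)
  simpa [mix, Matrix.sum_apply] using this

theorem mix_sub_avg (hV : Mixing V s) (Z : Fin N → Mat n r) :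
    (fun i => mix V Z i - avg Z) = mix V fun i => Z i - avg Z := by
  have := mix_sub V Z fun _ => avg Z
  rw [mix_const hV] at this
  exact this.symm

theorem rms_mix_sub_avg_le (hV : Mixing V s) (Z : Fin N → Mat n r) :
    (rms fun i => mix V Z i - avg Z) ≤ s * rms fun i => Z i - avg Z := by
  rw [mix_sub_avg hV]
  exact rms_mix_le_of_avg_eq_zero hV (avg_sub_avg hV.pos Z)

/-- Passing from the root mean square to a single agent costs √N, which s√N ≤ 1/2 compensates. The
bounds on individual agents, for the variables and for the trackers, rest on this. -/
theorem norm_mix_sub_avg_le (hV : Mixing V s) (Z : Fin N → Mat n r) (i : Fin N) :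
    ‖mix V Z i - avg Z‖ ≤ 1 / 2 * rms Z := by
  have h1 := norm_le_sqrt_mul_rms hV.pos (fun i => mix V Z i - avg Z) i
  have h2 := rms_mix_sub_avg_le hV Z
  have h3 := rms_sub_avg_le hV.pos Z
  have h4 := hV.s_mul_sqrt
  have h5 := rms_nonneg Z
  calc ‖mix V Z i - avg Z‖ ≤ √N * (s * rms Z) := h1.trans <| by
        gcongr
        exact h2.trans (by gcongr; exact hV.s_nonneg)
    _ = (s * √N) * rms Z := by ring
    _ ≤ _ := by gcongr

theorem msq_mix_le (hV : Mixing V s) (Z : Fin N → Mat n r) : msq (mix V Z) ≤ msq Z := by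
  rw [msq_eq hV.pos, msq_eq hV.pos Z, avg_mix hV]
  gcongr
  have h := rms_mix_sub_avg_le hV Z
  have h2 := hV.s_le_const
  have h0 := rms_nonneg fun i => Z i - avg Z
  have h3 : (rms fun i => mix V Z i - avg Z) ≤ rms fun i => Z i - avg Z := by nlinarith
  rw [← rms_sq, ← rms_sq]
  gcongr
  exact rms_nonneg _

end Mix

/-! ### Induced arithmetic means -/

section IAM

variable {N n r : ℕ} {Z : Fin N → Mat n r} {Y : Mat n r}

theorem norm_sub_sq_St {A B : Mat n r} (hA : A ∈ St n r) (hB : B ∈ St n r) :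
    ‖A - B‖ ^ 2 = 2 * r - 2 * inner ℝ A B := by
  rw [norm_sub_sq_real, norm_sq_of_mem_St hA, norm_sq_of_mem_St hB]; ring

/-- All points of the manifold have the same norm, so minimising the sum of squared distances is
maximising a linear functional. -/
theorem IsIAM.inner_le (hN : 0 < N) (hZ : ∀ i, Z i ∈ St n r) (h : IsIAM Z Y) {W : Mat n r}
    (hW : W ∈ St n r) : inner ℝ W (avg Z) ≤ inner ℝ Y (avg Z) := by
  have h1 := h.2 W hW
  simp only [norm_sub_sq_St hW (hZ _), norm_sub_sq_St h.1 (hZ _), Finset.sum_sub_distrib,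
    ← Finset.mul_sum] at h1
  rw [inner_avg, inner_avg, mean, mean]
  gcongr ?_ * ?_
  linarith

/-- Otherwise retracting a small step along the projected mean would increase the linear functional
to first order, while the retraction errs only to second order. -/
theorem IsIAM.projT_avg_eq_zero (hN : 0 < N) (hZ : ∀ i, Z i ∈ St n r) (h : IsIAM Z Y) {M : ℝ}
    (hM : 0 < M) (hR : ∀ X ∈ St n r, ∀ v ∈ tangent X, ‖polarRetr X v - (X + v)‖ ≤ M * ‖v‖ ^ 2) :
    projT Y (avg Z) = 0 := by
  set ξ := projT Y (avg Z) with hξ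
  have hξt : ξ ∈ tangent Y := projT_mem_tangent h.1 _
  by_contra hne
  have hpos : 0 < ‖ξ‖ ^ 2 := by positivity
  set c : ℝ := ‖avg Z‖ * M with hc
  have hc0 : 0 ≤ c := by positivity
  -- Step length with s * c < 1, so that the first-order gain s‖ξ‖² beats the retraction error
  -- s²c‖ξ‖².
  set s : ℝ := 1 / (2 * (c + 1)) with hs
  have hs0 : 0 < s := by positivity
  have hsc : s * c < 1 := by
    rw [hs, div_mul_eq_mul_div, div_lt_one (by positivity)]; linarith
  have hst := tangent_smul hξt s
  have h1 := h.inner_le hN hZ (polarRetr_mem h.1 hst)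
  have h2 := hR Y h.1 _ hst
  set e := polarRetr Y (s • ξ) - (Y + s • ξ) with he
  have h3 : polarRetr Y (s • ξ) = Y + s • ξ + e := by rw [he]; abel
  rw [h3, inner_add_left, inner_add_left, inner_smul_left] at h1
  have h4 : inner ℝ ξ (avg Z) = ‖ξ‖ ^ 2 := by
    rw [← real_inner_self_eq_norm_sq, real_inner_comm, ← inner_projT hξt (avg Z)]
  have h5 := neg_le_of_abs_le (abs_real_inner_le_norm e (avg Z))
  rw [norm_smul, Real.norm_of_nonneg hs0.le, mul_pow] at h2
  rw [h4] at h1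
  simp only [conj_trivial] at h1
  have h6 : ‖e‖ * ‖avg Z‖ ≤ s * c * (s * ‖ξ‖ ^ 2) := by
    calc ‖e‖ * ‖avg Z‖ ≤ M * (s ^ 2 * ‖ξ‖ ^ 2) * ‖avg Z‖ := by gcongr
      _ = _ := by rw [hc]; ring
  have h7 : 0 < s * ‖ξ‖ ^ 2 := by positivity
  nlinarith

/-- The arithmetic mean is `Y * H` with an explicit symmetric `H`, if `Y` is an induced one. -/
theorem IsIAM.avg_eq (hN : 0 < N) (hZ : ∀ i, Z i ∈ St n r) (h : IsIAM Z Y)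
    (h0 : projT Y (avg Z) = 0) :
    avg Z = Y - (1 / 2 : ℝ) • (Y * avg fun i => (Y - Z i)ᵀ * (Y - Z i)) := by
  have h1 : projT Y (avg Z) = avg Z - Y
      + (1 / 2 : ℝ) • (Y * avg fun i => (Y - Z i)ᵀ * (Y - Z i)) := by
    have h2 : projT Y (avg Z) = avg fun i => projT Y (Z i) := by
      rw [avg, projT_smul, projT_sum]; rfl
    rw [h2, funext fun i => projT_St h.1 (hZ i)]
    have e1 := avg_add (fun i => Z i - Y)
      (fun i => (1 / 2 : ℝ) • (Y * ((Y - Z i)ᵀ * (Y - Z i))))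
    have e2 := avg_sub Z (fun _ => Y)
    have e3 : avg (fun i => (1 / 2 : ℝ) • (Y * ((Y - Z i)ᵀ * (Y - Z i))))
        = (1 / 2 : ℝ) • (Y * avg fun i => (Y - Z i)ᵀ * (Y - Z i)) := by
      simp only [avg, Matrix.mul_smul, Matrix.mul_sum, ← Finset.smul_sum]
      rw [smul_comm]
    rw [avg_const hN] at e2
    rw [← e3, ← e2]
    exact e1
  rw [h0] at h1
  have h3 := h1.symm
  rw [sub_add_eq_add_sub, sub_eq_zero] at h3
  exact eq_sub_of_add_eq h3

theorem norm_avg_transpose_mul_self_le (D : Fin N → Mat n r) :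
    ‖avg fun i => (D i)ᵀ * D i‖ ≤ msq D :=
  (norm_avg_le_mean _).trans (mean_mono fun _ => norm_transpose_mul_self_le _)

/-- The defect between the two means is exactly half of Y times the second moment of the deviations,
hence quadratic in the consensus error. -/
theorem IsIAM.norm_avg_sub_le (hN : 0 < N) (hZ : ∀ i, Z i ∈ St n r) (h : IsIAM Z Y)
    (h0 : projT Y (avg Z) = 0) : ‖avg Z - Y‖ ≤ 1 / 2 * msq fun i => Z i - Y := by
  have h1 := h.avg_eq hN hZ h0
  rw [h1, sub_sub_cancel_left, norm_neg, norm_smul, norm_St_mul h.1]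
  have h2 := norm_avg_transpose_mul_self_le fun i => Y - Z i
  have h3 : (msq fun i => Y - Z i) = msq fun i => Z i - Y := by
    simp only [msq, norm_sub_rev]
  rw [h3] at h2
  rw [Real.norm_of_nonneg (by norm_num)]
  linarith

/-- The induced arithmetic mean is Lipschitz in the arithmetic mean, near consensus. -/
theorem IsIAM.norm_sub_le (hN : 0 < N) {Z' : Fin N → Mat n r} {Y' : Mat n r}
    (hZ : ∀ i, Z i ∈ St n r) (hZ' : ∀ i, Z' i ∈ St n r) (h : IsIAM Z Y) (h' : IsIAM Z' Y')
    (h0 : projT Y (avg Z) = 0) (h0' : projT Y' (avg Z') = 0)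
    (hE : (msq fun i => Z i - Y) ≤ 1) (hE' : (msq fun i => Z' i - Y') ≤ 1) :
    ‖Y - Y'‖ ≤ 2 * ‖avg Z - avg Z'‖ := by
  -- The mean is Y(I - Q/2) with ‖Q‖ ≤ 1, so its symmetric factor is at least 1/2 and it is strongly
  -- monotone against points of the manifold. Using this for both stacks and adding gives the
  -- Lipschitz bound.
  have key : ∀ (Z : Fin N → Mat n r) (Y W : Mat n r), (∀ i, Z i ∈ St n r) → IsIAM Z Y →
      projT Y (avg Z) = 0 → (msq fun i => Z i - Y) ≤ 1 → W ∈ St n r →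
      1 / 4 * ‖Y - W‖ ^ 2 ≤ inner ℝ (avg Z) (Y - W) := by
    intro Z Y W hZ h h0 hE hW
    set Q := avg fun i => (Y - Z i)ᵀ * (Y - Z i) with hQ
    have hQn : ‖Q‖ ≤ 1 := by
      refine (norm_avg_transpose_mul_self_le fun i => Y - Z i).trans ?_
      simpa only [msq, norm_sub_rev] using hE
    have hQt : Qᵀ = Q := by
      simp [hQ, avg, Matrix.transpose_smul, Matrix.transpose_sum, Matrix.transpose_mul]
    have h1 : avg Z = Y * (1 - (1 / 2 : ℝ) • Q) := by
      rw [h.avg_eq hN hZ h0, Matrix.mul_sub, Matrix.mul_one, Matrix.mul_smul]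
    rw [h1]
    have h2 := inner_polar_sub_ge h.1 hW (H := 1 - (1 / 2 : ℝ) • Q) (c := 1 / 2)
      (by simp [hQt]) (fun D => by
        rw [inner_sub_left, inner_smul_left]
        have e1 : inner ℝ (1 : Mat r r) (Dᵀ * D) = ‖D‖ ^ 2 := by
          rw [inner_eq_trace, Matrix.transpose_one, Matrix.one_mul, frobenius_norm_sq_eq_trace]
        have e2 := real_inner_le_norm Q (Dᵀ * D)
        have e3 := norm_transpose_mul_self_le D
        have e4 : ‖Q‖ * ‖Dᵀ * D‖ ≤ 1 * ‖D‖ ^ 2 := by gcongr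
        rw [e1]
        simp only [conj_trivial]
        linarith)
    linarith
  have h1 := key Z Y Y' hZ h h0 hE h'.1
  have h2 := key Z' Y' Y hZ' h' h0' hE' h.1
  rw [← neg_sub, inner_neg_right, norm_neg] at h2
  have h3 := real_inner_le_norm (avg Z - avg Z') (Y - Y')
  rw [inner_sub_left] at h3
  rcases (norm_nonneg (Y - Y')).eq_or_lt with h4 | h4
  · rw [← h4]; positivity
  nlinarith

theorem IsIAM.msq_sub_le (h : IsIAM Z Y) {W : Mat n r} (hW : W ∈ St n r) :
    (msq fun i => Z i - Y) ≤ msq fun i => Z i - W := by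
  have := h.2 W hW
  simp only [msq, mean, norm_sub_rev (Z _)]
  gcongr

end IAM

/-! ### One step of the algorithm near consensus -/

section Step

variable {N n r : ℕ}

/-- The tangent displacement of agent `i` in one step. -/
noncomputable def disp (V : Matrix (Fin N) (Fin N) ℝ) (α β : ℝ) (Z B : Fin N → Mat n r)
    (i : Fin N) : Mat n r := α • projT (Z i) (mix V Z i) - β • projT (Z i) (B i)

/-- One step of the algorithm. -/
noncomputable def retrStep (V : Matrix (Fin N) (Fin N) ℝ) (α β : ℝ) (Z B : Fin N → Mat n r)
    (i : Fin N) : Mat n r := polarRetr (Z i) (disp V α β Z B i)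

/-- The projected directions. -/
noncomputable def dir (Z B : Fin N → Mat n r) (i : Fin N) : Mat n r := projT (Z i) (B i)

/-- The weighted second moment of the disagreement seen by agent `i`. -/
noncomputable def disagree (V : Matrix (Fin N) (Fin N) ℝ) (Z : Fin N → Mat n r) (i : Fin N) :
    Mat r r := ∑ j, V i j • ((Z i - Z j)ᵀ * (Z i - Z j))

/-- A stack of points of `St` which lies in the local region of radii `δ₁`, `δ₂` around `Xh`. -/
structure Near (δ₁ δ₂ : ℝ) (Z : Fin N → Mat n r) (Xh : Mat n r) : Prop where
  mem : ∀ i, Z i ∈ St n r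
  center : Xh ∈ St n r
  avg_le : ‖avg Z - Xh‖ ≤ 1 / 2 * msq fun i => Z i - Xh
  msq_le : (msq fun i => Z i - Xh) ≤ δ₁ ^ 2
  max_le : ∀ i, ‖Z i - Xh‖ ≤ δ₂

/-- Numerical conditions on step sizes and radii. -/
structure StepSizes (α β A M δ₁ δ₂ : ℝ) : Prop where
  α_pos : 0 < α
  α_le : α ≤ 1
  β_pos : 0 < β
  A_nonneg : 0 ≤ A
  M_pos : 0 < M
  Mα : M * α ≤ 1
  δ₁_pos : 0 < δ₁
  δ₁_le_α : 640 * δ₁ ≤ α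
  δ₁_le : 5 * δ₁ ≤ δ₂
  δ₂_le : δ₂ ≤ 1 / 6
  βA : 50 * (β * A) ≤ α * δ₁

variable {V : Matrix (Fin N) (Fin N) ℝ} {s α β A M δ₁ δ₂ : ℝ} {Z B : Fin N → Mat n r}
  {Xh : Mat n r}

theorem disp_mem_tangent (hZ : ∀ i, Z i ∈ St n r) (i : Fin N) :
    disp V α β Z B i ∈ tangent (Z i) :=
  tangent_sub (tangent_smul (projT_mem_tangent (hZ i) _) _)
    (tangent_smul (projT_mem_tangent (hZ i) _) _)

theorem retrStep_mem (hZ : ∀ i, Z i ∈ St n r) (i : Fin N) : retrStep V α β Z B i ∈ St n r :=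
  polarRetr_mem (hZ i) (disp_mem_tangent hZ i)

theorem disagree_transpose (i : Fin N) : (disagree V Z i)ᵀ = disagree V Z i := by
  simp [disagree, Matrix.transpose_sum, Matrix.transpose_smul, Matrix.transpose_mul]

/-- The weights sum to one, so the chord formula for single neighbours averages to an ordinary
linear consensus step plus a normal curvature correction. -/
theorem projT_mix (hV : Mixing V s) (hZ : ∀ i, Z i ∈ St n r) (i : Fin N) :
    projT (Z i) (mix V Z i) = mix V Z i - Z i + (1 / 2 : ℝ) • (Z i * disagree V Z i) := by
  have h : ∀ j, projT (Z i) (V i j • Z j) = V i j • Z j - V i j • Z i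
      + (1 / 2 : ℝ) • (V i j • (Z i * ((Z i - Z j)ᵀ * (Z i - Z j)))) := fun j => by
    rw [projT_smul, projT_St (hZ i) (hZ j), smul_add, smul_sub, smul_comm (V i j) (1 / 2 : ℝ)]
  rw [mix, projT_sum, Finset.sum_congr rfl fun j _ => h j, Finset.sum_add_distrib,
    Finset.sum_sub_distrib, ← Finset.sum_smul, hV.sum, one_smul, ← Finset.smul_sum, disagree,
    Matrix.mul_sum]
  simp only [Matrix.mul_smul]

theorem norm_disagree_le_sum (hV : Mixing V s) (i : Fin N) :
    ‖disagree V Z i‖ ≤ ∑ j, V i j * ‖Z i - Z j‖ ^ 2 := by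
  refine (norm_sum_le _ _).trans (Finset.sum_le_sum fun j _ => ?_)
  rw [norm_smul, Real.norm_of_nonneg (hV.nonneg i j)]
  exact mul_le_mul_of_nonneg_left (norm_transpose_mul_self_le _) (hV.nonneg i j)

theorem norm_sub_sq_le_two (A B C : Mat n r) :
    ‖A - B‖ ^ 2 ≤ 2 * ‖A - C‖ ^ 2 + 2 * ‖B - C‖ ^ 2 := by
  have h : ‖A - B‖ ≤ ‖A - C‖ + ‖B - C‖ := by
    have := norm_sub_le (A - C) (B - C)
    rwa [sub_sub_sub_cancel_right] at this
  nlinarith [norm_nonneg (A - B), norm_nonneg (A - C), norm_nonneg (B - C),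
    sq_nonneg (‖A - C‖ - ‖B - C‖)]

theorem norm_disagree_le (hV : Mixing V s) (hmax : ∀ i, ‖Z i - Xh‖ ≤ δ₂) (i : Fin N) :
    ‖disagree V Z i‖ ≤ 4 * δ₂ ^ 2 := by
  refine (norm_disagree_le_sum hV i).trans ?_
  calc ∑ j, V i j * ‖Z i - Z j‖ ^ 2 ≤ ∑ j, V i j * (4 * δ₂ ^ 2) := by
        refine Finset.sum_le_sum fun j _ => mul_le_mul_of_nonneg_left ?_ (hV.nonneg i j)
        have h1 := norm_sub_sq_le_two (Z i) (Z j) Xh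
        have h2 : ‖Z i - Xh‖ ^ 2 ≤ δ₂ ^ 2 := by gcongr; exact hmax i
        have h3 : ‖Z j - Xh‖ ^ 2 ≤ δ₂ ^ 2 := by gcongr; exact hmax j
        linarith
    _ = 4 * δ₂ ^ 2 := by rw [← Finset.sum_mul, hV.sum, one_mul]

theorem mean_norm_disagree_le (hV : Mixing V s) :
    (mean fun i => ‖disagree V Z i‖) ≤ 4 * msq fun i => Z i - Xh := by
  have h1 : ∀ i, ‖disagree V Z i‖ ≤ 2 * ‖Z i - Xh‖ ^ 2
      + 2 * ∑ j, V i j * ‖Z j - Xh‖ ^ 2 := fun i => by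
    refine (norm_disagree_le_sum hV i).trans ?_
    calc ∑ j, V i j * ‖Z i - Z j‖ ^ 2
        ≤ ∑ j, V i j * (2 * ‖Z i - Xh‖ ^ 2 + 2 * ‖Z j - Xh‖ ^ 2) :=
          Finset.sum_le_sum fun j _ => mul_le_mul_of_nonneg_left
            (norm_sub_sq_le_two _ _ _) (hV.nonneg i j)
      _ = _ := by
          simp only [mul_add, Finset.sum_add_distrib]
          rw [← Finset.sum_mul, hV.sum, one_mul, Finset.mul_sum]
          congr 1
          exact Finset.sum_congr rfl fun j _ => by ring
  have h2 : (mean fun i => ∑ j, V i j * ‖Z j - Xh‖ ^ 2) = msq fun i => Z i - Xh := by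
    simp only [mean, msq]
    rw [Finset.sum_comm]
    congr 1
    refine Finset.sum_congr rfl fun j _ => ?_
    rw [← Finset.sum_mul, hV.sum', one_mul]
  refine (mean_mono h1).trans_eq ?_
  rw [mean_add, mean_mul, mean_mul, h2]
  simp only [msq]
  ring

theorem mix_sub_const (hV : Mixing V s) (C : Mat n r) (i : Fin N) :
    mix V Z i - C = mix V (fun i => Z i - C) i := by
  have h := congrFun (mix_sub V Z fun _ => C) i
  rw [mix_const hV] at h
  exact h.symm

theorem norm_projT_mix_le (hZ : ∀ i, Z i ∈ St n r) (i : Fin N) :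
    ‖projT (Z i) (mix V Z i)‖ ≤ ‖mix V Z i - Z i‖ := by
  have h : projT (Z i) (mix V Z i) = projT (Z i) (mix V Z i - Z i) := by
    have h0 : projT (Z i) (Z i) = 0 := by
      rw [projT_St (hZ i) (hZ i)]; simp
    rw [projT_sub, h0, sub_zero]
  rw [h]
  exact norm_projT_le (hZ i) _

theorem msq_mix_sub_le (hV : Mixing V s) (Xh : Mat n r) :
    (msq fun i => mix V Z i - Z i) ≤ 4 * msq fun i => Z i - Xh := by
  have h : (fun i => mix V Z i - Z i) = mix V (fun i => Z i - Xh) - fun i => Z i - Xh := by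
    funext i
    rw [Pi.sub_apply, ← mix_sub_const hV]
    abel
  rw [h]
  have h1 := msq_sub_le (mix V fun i => Z i - Xh) fun i => Z i - Xh
  have h2 := msq_mix_le hV fun i => Z i - Xh
  linarith

theorem msq_disp_le (hV : Mixing V s) (hZ : ∀ i, Z i ∈ St n r) (Xh : Mat n r) :
    msq (disp V α β Z B)
      ≤ 8 * α ^ 2 * (msq fun i => Z i - Xh) + 2 * β ^ 2 * msq (dir Z B) := by
  have h := msq_sub_le (α • fun i => projT (Z i) (mix V Z i)) (β • dir Z B)
  rw [msq_smul, msq_smul] at h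
  have h1 : (msq fun i => projT (Z i) (mix V Z i)) ≤ 4 * msq fun i => Z i - Xh :=
    (msq_mono (norm_projT_mix_le hZ)).trans (msq_mix_sub_le hV Xh)
  have h2 : α ^ 2 * (msq fun i => projT (Z i) (mix V Z i))
      ≤ α ^ 2 * (4 * msq fun i => Z i - Xh) := by gcongr
  refine h.trans ?_
  linarith

theorem norm_retrStep_sub_le (hZ : ∀ i, Z i ∈ St n r) (i : Fin N) :
    ‖retrStep V α β Z B i - Z i‖ ≤ ‖disp V α β Z B i‖ := by
  have := norm_polarRetr_sub_St_le (hZ i)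
    (disp_mem_tangent (V := V) (α := α) (β := β) (B := B) hZ i) (hZ i)
  rwa [add_sub_cancel_left] at this

theorem msq_retrStep_sub_le (hV : Mixing V s) (hZ : ∀ i, Z i ∈ St n r) (Xh : Mat n r) :
    (msq fun i => retrStep V α β Z B i - Z i)
      ≤ 8 * α ^ 2 * (msq fun i => Z i - Xh) + 2 * β ^ 2 * msq (dir Z B) :=
  (msq_mono (norm_retrStep_sub_le hZ)).trans (msq_disp_le hV hZ Xh)

/-- Here 0.646 = 1 - 0.354 is the linear contraction, δ₁²/4 comes from the mean of the deviations
and α/18 from curvature. The rate 11/20 absorbs both. -/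
theorem StepSizes.contraction_le (hs : StepSizes α β A M δ₁ δ₂) :
    (1 - 646 / 1000 * α) ^ 2 + 1 / 4 * δ₁ ^ 2 + α / 18 ≤ (1 - 11 / 20 * α) ^ 2 := by
  have hα := hs.α_pos
  have hα1 := hs.α_le
  have h1 : δ₁ ^ 2 ≤ α / 1000 := by nlinarith [hs.δ₁_le_α, hs.δ₁_pos]
  have h2 : α ^ 2 ≤ α := by nlinarith
  linarith

/-- Removing the projection can only lengthen the step. In the cross term it changes a quarter of
the pairing of `disagree` with the squared deviation, and 4δ₂² ≤ 1/9 bounds that; doubling by the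
square gives α/18. -/
theorem norm_sub_add_projT_mix_sq_le (hV : Mixing V s) (hs : StepSizes α β A M δ₁ δ₂)
    (h : Near δ₁ δ₂ Z Xh) (i : Fin N) :
    ‖Z i - Xh + α • projT (Z i) (mix V Z i)‖ ^ 2
      ≤ ‖Z i - Xh + α • (mix V Z i - Z i)‖ ^ 2 + α / 18 * ‖Z i - Xh‖ ^ 2 := by
  have hα := hs.α_pos
  have hδ₂ : 0 < δ₂ := by linarith [hs.δ₁_le, hs.δ₁_pos]
  rw [norm_add_sq_real, norm_add_sq_real, norm_smul, norm_smul, inner_smul_right,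
    inner_smul_right, mul_pow, mul_pow]
  have e1 := norm_projT_mix_le h.mem i (V := V)
  have e2 : ‖α‖ ^ 2 * ‖projT (Z i) (mix V Z i)‖ ^ 2
      ≤ ‖α‖ ^ 2 * ‖mix V Z i - Z i‖ ^ 2 := by gcongr
  have e3 : inner ℝ (Z i - Xh) (projT (Z i) (mix V Z i))
      = inner ℝ (Z i - Xh) (mix V Z i - Z i)
        + 1 / 4 * inner ℝ (disagree V Z i) ((Z i - Xh)ᵀ * (Z i - Xh)) := by
    rw [projT_mix hV h.mem, inner_add_right, inner_smul_right,
      real_inner_comm (Z i * disagree V Z i) (Z i - Xh),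
      inner_St_mul_sub (h.mem i) h.center (disagree_transpose i)]
    ring
  have e4 : inner ℝ (disagree V Z i) ((Z i - Xh)ᵀ * (Z i - Xh)) ≤ 1 / 9 * ‖Z i - Xh‖ ^ 2 := by
    refine (real_inner_le_norm _ _).trans ?_
    have e5 := norm_disagree_le hV h.max_le i
    have e6 : 4 * δ₂ ^ 2 ≤ 1 / 9 := by nlinarith [hs.δ₂_le]
    have e7 := norm_transpose_mul_self_le (Z i - Xh)
    gcongr
    linarith
  have e8 := mul_le_mul_of_nonneg_left e4 hα.le
  rw [e3]
  linarith

/-- The consensus part of the step contracts. -/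
theorem rms_consensus_le (hV : Mixing V s) (hs : StepSizes α β A M δ₁ δ₂)
    (h : Near δ₁ δ₂ Z Xh) :
    (rms fun i => Z i - Xh + α • projT (Z i) (mix V Z i))
      ≤ (1 - 11 / 20 * α) * rms fun i => Z i - Xh := by
  have hα := hs.α_pos
  have hα1 := hs.α_le
  set D : Fin N → Mat n r := fun i => Z i - Xh with hD
  set E := msq D with hE
  have hE0 : 0 ≤ E := msq_nonneg D
  -- C is the step without projection, an affine combination of D and its mixture. Its fluctuation
  -- contracts linearly, while its mean is that of D, which is only quadratic in the error by
  -- optimality of the centre.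
  set C : Fin N → Mat n r := (1 - α) • D + α • mix V D with hC
  have hCi : ∀ i, C i = D i + α • (mix V Z i - Z i) := fun i => by
    have e1 : mix V D i = mix V Z i - Xh := (mix_sub_const hV Xh i).symm
    have e2 : D i = Z i - Xh := rfl
    simp only [hC, Pi.add_apply, Pi.smul_apply]
    rw [e1, e2]
    module
  have hpt : ∀ i, ‖D i + α • projT (Z i) (mix V Z i)‖ ^ 2
      ≤ ‖C i‖ ^ 2 + α / 18 * ‖D i‖ ^ 2 := fun i => by
    rw [hCi]
    exact norm_sub_add_projT_mix_sq_le hV hs h i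
  have hm : (msq fun i => D i + α • projT (Z i) (mix V Z i)) ≤ msq C + α / 18 * E := by
    refine (mean_mono hpt).trans_eq ?_
    rw [mean_add, mean_mul]; rfl
  have hDavg : ‖avg D‖ ≤ 1 / 2 * E := by
    have : avg D = avg Z - Xh := by
      have := avg_sub Z fun _ => Xh
      rwa [avg_const hV.pos] at this
    rw [this]; exact h.avg_le
  have hCavg : avg C = avg D := by
    rw [hC, avg_add, avg_smul, avg_smul, avg_mix hV, ← add_smul, sub_add_cancel, one_smul]
  have hfl : (rms fun i => C i - avg C) ≤ (1 - α * (1 - s)) * rms fun i => D i - avg D := by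
    have e1 : (fun i => C i - avg C) = (1 - α) • (fun i => D i - avg D)
        + α • fun i => mix V D i - avg D := by
      funext i
      rw [hCavg]
      simp only [hC, Pi.add_apply, Pi.smul_apply]
      module
    rw [e1]
    refine (rms_add_le _ _).trans ?_
    rw [rms_smul, rms_smul, abs_of_nonneg (by linarith), abs_of_pos hα]
    have e2 := mul_le_mul_of_nonneg_left (rms_mix_sub_avg_le hV D) hα.le
    linarith
  have hfl2 : (msq fun i => C i - avg C) ≤ (1 - 646 / 1000 * α) ^ 2 * E := by
    have e1 := hV.s_le_const
    have e2 := rms_sub_avg_le hV.pos D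
    have e3 := rms_nonneg fun i => D i - avg D
    have e4 : (rms fun i => C i - avg C) ≤ (1 - 646 / 1000 * α) * rms D := by
      refine hfl.trans (mul_le_mul (by nlinarith) e2 e3 (by linarith))
    rw [← rms_sq, hE, ← rms_sq, ← mul_pow]
    gcongr
    exact rms_nonneg _
  have hCm : msq C ≤ (1 - 646 / 1000 * α) ^ 2 * E + 1 / 4 * δ₁ ^ 2 * E := by
    rw [msq_eq hV.pos C]
    rw [hCavg] at hfl2 ⊢
    have e1 : ‖avg D‖ ^ 2 ≤ (1 / 2 * E) ^ 2 := by gcongr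
    have e2 : E * E ≤ δ₁ ^ 2 * E := by gcongr; exact h.msq_le
    linarith
  refine Real.sqrt_le_iff.2 ⟨mul_nonneg (by linarith) (rms_nonneg _), ?_⟩
  rw [mul_pow, rms_sq]
  change (msq fun i => D i + α • projT (Z i) (mix V Z i)) ≤ _ * E
  have := mul_le_mul_of_nonneg_right hs.contraction_le hE0
  linarith

theorem rms_retrStep_sub_le (hV : Mixing V s) (hs : StepSizes α β A M δ₁ δ₂)
    (h : Near δ₁ δ₂ Z Xh) :
    (rms fun i => retrStep V α β Z B i - Xh)
      ≤ (1 - 11 / 20 * α) * (rms fun i => Z i - Xh) + β * rms (dir Z B) := by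
  have h1 : (rms fun i => retrStep V α β Z B i - Xh)
      ≤ rms ((fun i => Z i - Xh + α • projT (Z i) (mix V Z i)) - β • dir Z B) := by
    refine rms_mono fun i => ?_
    refine (norm_polarRetr_sub_St_le (h.mem i) (disp_mem_tangent h.mem i) h.center).trans_eq ?_
    simp only [disp, dir, Pi.sub_apply, Pi.smul_apply]
    congr 1
    abel
  refine (h1.trans (rms_sub_le _ _)).trans ?_
  rw [rms_smul, abs_of_pos hs.β_pos]
  gcongr
  exact rms_consensus_le hV hs h

theorem rms_dir_le (hN : 0 < N) (hZ : ∀ i, Z i ∈ St n r) (hB : ∀ i, ‖B i‖ ≤ 6 * A) :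
    rms (dir Z B) ≤ 6 * A :=
  rms_le_of_le hN fun i => (norm_projT_le (hZ i) _).trans (hB i)

theorem Near.rms_le (h : Near δ₁ δ₂ Z Xh) (hδ : 0 < δ₁) : (rms fun i => Z i - Xh) ≤ δ₁ :=
  Real.sqrt_le_iff.2 ⟨hδ.le, h.msq_le⟩

/-- The gradient part moves by at most 6βA ≤ 0.12αδ₁, well within the gain 0.55αδ₁ of the consensus
part. -/
theorem rms_retrStep_sub_le_delta (hV : Mixing V s) (hs : StepSizes α β A M δ₁ δ₂)
    (h : Near δ₁ δ₂ Z Xh) (hB : ∀ i, ‖B i‖ ≤ 6 * A) :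
    (rms fun i => retrStep V α β Z B i - Xh) ≤ δ₁ := by
  refine (rms_retrStep_sub_le hV hs h).trans ?_
  have h1 := rms_dir_le hV.pos h.mem hB
  have h2 := h.rms_le hs.δ₁_pos
  have h3 := hs.βA
  have h4 := mul_le_mul_of_nonneg_left h1 hs.β_pos.le
  have h5 := mul_le_mul_of_nonneg_left h2 (by linarith [hs.α_le] : (0 : ℝ) ≤ 1 - 11 / 20 * α)
  have h6 : 0 < α * δ₁ := mul_pos hs.α_pos hs.δ₁_pos
  linarith

theorem rms_disp_le (hV : Mixing V s) (hs : StepSizes α β A M δ₁ δ₂)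
    (h : Near δ₁ δ₂ Z Xh) (hB : ∀ i, ‖B i‖ ≤ 6 * A) :
    rms (disp V α β Z B) ≤ 212 / 100 * (α * δ₁) := by
  have h0 := rms_sub_le (α • fun i => projT (Z i) (mix V Z i)) (β • dir Z B)
  rw [rms_smul, rms_smul, abs_of_pos hs.α_pos, abs_of_pos hs.β_pos] at h0
  have h1 : (rms fun i => projT (Z i) (mix V Z i)) ≤ 2 * δ₁ := by
    refine Real.sqrt_le_iff.2 ⟨by linarith [hs.δ₁_pos], ?_⟩
    have := (msq_mono (norm_projT_mix_le h.mem (V := V))).trans (msq_mix_sub_le hV Xh)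
    have := h.msq_le
    nlinarith
  have h2 := mul_le_mul_of_nonneg_left h1 hs.α_pos.le
  have h3 := mul_le_mul_of_nonneg_left (rms_dir_le hV.pos h.mem hB) hs.β_pos.le
  have h4 := hs.βA
  refine le_trans h0 ?_
  linarith

/-- Displacement of the centre. -/
theorem norm_center_sub_le (hN : 0 < N) {Z' : Fin N → Mat n r} {Xh' : Mat n r}
    (h : ‖avg Z - Xh‖ ≤ 1 / 2 * msq fun i => Z i - Xh)
    (h' : ‖avg Z' - Xh'‖ ≤ 1 / 2 * msq fun i => Z' i - Xh') :
    ‖Xh' - Xh‖ ≤ 1 / 2 * (msq fun i => Z' i - Xh') + 1 / 2 * (msq fun i => Z i - Xh)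
      + rms fun i => Z' i - Z i := by
  have h1 : Xh' - Xh = (avg Z - Xh) - (avg Z' - Xh') + avg (Z' - Z) := by
    rw [avg_sub]; abel
  rw [h1]
  have h2 := norm_add_le ((avg Z - Xh) - (avg Z' - Xh')) (avg (Z' - Z))
  have h3 := norm_sub_le (avg Z - Xh) (avg Z' - Xh')
  have h4 : ‖avg (Z' - Z)‖ ≤ rms fun i => Z' i - Z i := norm_avg_le_rms hN _
  linarith

/-- The local region is invariant. -/
theorem Near.step (hV : Mixing V s) (hs : StepSizes α β A M δ₁ δ₂) (h : Near δ₁ δ₂ Z Xh)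
    (hB : ∀ i, ‖B i‖ ≤ 6 * A) {Xh' : Mat n r} (hI : IsIAM (retrStep V α β Z B) Xh')
    (hI' : ‖avg (retrStep V α β Z B) - Xh'‖
      ≤ 1 / 2 * msq fun i => retrStep V α β Z B i - Xh') :
    Near δ₁ δ₂ (retrStep V α β Z B) Xh' := by
  have hα := hs.α_pos
  have hα1 := hs.α_le
  have hδ := hs.δ₁_pos
  have hαδ : 0 < α * δ₁ := mul_pos hα hδ
  have hδα : δ₁ ^ 2 ≤ α * δ₁ / 640 := by nlinarith [hs.δ₁_le_α]
  have hE' : (msq fun i => retrStep V α β Z B i - Xh') ≤ δ₁ ^ 2 := by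
    -- The new centre minimises the mean squared distance, so measuring from the old centre
    -- suffices.
    refine (hI.msq_sub_le h.center).trans ?_
    rw [← rms_sq]
    exact pow_le_pow_left₀ (rms_nonneg _) (rms_retrStep_sub_le_delta hV hs h hB) 2
  refine ⟨retrStep_mem h.mem, hI.1, hI', hE', fun i => ?_⟩
  have hc := norm_center_sub_le hV.pos h.avg_le hI'
  have hr : (rms fun i => retrStep V α β Z B i - Z i) ≤ 212 / 100 * (α * δ₁) :=
    (rms_mono (norm_retrStep_sub_le h.mem)).trans (rms_disp_le hV hs h hB)
  have hi : ‖retrStep V α β Z B i - Xh‖ ≤ ‖Z i + disp V α β Z B i - Xh‖ :=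
    norm_polarRetr_sub_St_le (h.mem i) (disp_mem_tangent h.mem i) h.center
  -- Only the first term has size δ₂, and its coefficient is 1 - α. The others are the mixing
  -- fluctuation, the defect of the mean, curvature and the gradient step.
  have he : Z i + disp V α β Z B i - Xh = (1 - α) • (Z i - Xh) + α • (mix V Z i - avg Z)
      + α • (avg Z - Xh) + (α / 2) • (Z i * disagree V Z i) - β • projT (Z i) (B i) := by
    rw [disp, projT_mix hV h.mem, smul_add, smul_smul, mul_one_div]
    module
  have ht1 : ‖(1 - α) • (Z i - Xh)‖ ≤ (1 - α) * δ₂ := by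
    rw [norm_smul, Real.norm_of_nonneg (by linarith)]
    exact mul_le_mul_of_nonneg_left (h.max_le i) (by linarith)
  have ht2 : ‖α • (mix V Z i - avg Z)‖ ≤ α * (1 / 2 * δ₁) := by
    rw [norm_smul, Real.norm_of_nonneg hα.le]
    gcongr
    have e := norm_mix_sub_avg_le hV (fun i => Z i - Xh) i
    have e2 : avg (fun i => Z i - Xh) = avg Z - Xh := by
      have := avg_sub Z fun _ => Xh
      rwa [avg_const hV.pos] at this
    rw [e2, ← mix_sub_const hV, sub_sub_sub_cancel_right] at e
    have := h.rms_le hδ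
    linarith
  have ht3 : ‖α • (avg Z - Xh)‖ ≤ α * δ₁ / 1280 := by
    rw [norm_smul, Real.norm_of_nonneg hα.le]
    have e1 := h.avg_le
    have e2 := h.msq_le
    have e3 : α * ‖avg Z - Xh‖ ≤ 1 * ‖avg Z - Xh‖ := by gcongr
    linarith
  have ht4 : ‖(α / 2) • (Z i * disagree V Z i)‖ ≤ α / 2 * (4 * δ₂ ^ 2) := by
    rw [norm_smul, norm_St_mul (h.mem i), Real.norm_of_nonneg (by positivity)]
    gcongr
    exact norm_disagree_le hV h.max_le i
  have ht5 : ‖β • projT (Z i) (B i)‖ ≤ 12 / 100 * (α * δ₁) := by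
    rw [norm_smul, Real.norm_of_nonneg hs.β_pos.le]
    have e1 := (norm_projT_le (h.mem i) (B i)).trans (hB i)
    have e2 := mul_le_mul_of_nonneg_left e1 hs.β_pos.le
    have := hs.βA
    linarith
  have hsum := norm_sub_le ((1 - α) • (Z i - Xh) + α • (mix V Z i - avg Z)
      + α • (avg Z - Xh) + (α / 2) • (Z i * disagree V Z i)) (β • projT (Z i) (B i))
  have hsum4 := norm_add₄_le (a := (1 - α) • (Z i - Xh)) (b := α • (mix V Z i - avg Z))
      (c := α • (avg Z - Xh)) (d := (α / 2) • (Z i * disagree V Z i))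
  rw [← he] at hsum
  have htri : ‖retrStep V α β Z B i - Xh'‖ ≤ ‖retrStep V α β Z B i - Xh‖ + ‖Xh' - Xh‖ := by
    have := norm_sub_le (retrStep V α β Z B i - Xh) (Xh' - Xh)
    rwa [sub_sub_sub_cancel_right] at this
  -- Budget: curvature costs at most αδ₂/3. The remaining terms, including the motion of the centre,
  -- stay below 2.75αδ₁ ≤ 0.55αδ₂. Together they are less than the αδ₂ gained.
  have hδ₂ : α * δ₂ ^ 2 ≤ 1 / 6 * (α * δ₂) := by
    have : 0 < δ₂ := by linarith [hs.δ₁_le]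
    nlinarith [hs.δ₂_le, mul_pos hα this]
  have h5 : 5 * (α * δ₁) ≤ α * δ₂ := by nlinarith [hs.δ₁_le]
  have := h.msq_le
  linarith

/-- The displacement of the arithmetic mean, tested against a tangent vector at the centre. -/
theorem inner_avg_retrStep_sub_le (hV : Mixing V s) (hs : StepSizes α β A M δ₁ δ₂)
    (h : Near δ₁ δ₂ Z Xh) (hB : ∀ i, ‖B i‖ ≤ 6 * A)
    (hR : ∀ X ∈ St n r, ∀ v ∈ tangent X, ‖polarRetr X v - (X + v)‖ ≤ M * ‖v‖ ^ 2)
    {g : Mat n r} (hg : g ∈ tangent Xh) (hgA : ‖g‖ ≤ A) :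
    inner ℝ g (avg (retrStep V α β Z B) - avg Z)
      ≤ A * M * msq (disp V α β Z B) + 2 * α * A * (msq fun i => Z i - Xh)
        - β * inner ℝ g (avg B) + β * (‖g‖ * (6 * A) * rms fun i => Z i - Xh) := by
  have hα := hs.α_pos
  have hA := hs.A_nonneg
  set e : Fin N → Mat n r := fun i => retrStep V α β Z B i - (Z i + disp V α β Z B i) with he
  have h1 : avg (retrStep V α β Z B) - avg Z = avg e + avg (disp V α β Z B) := by
    rw [← avg_sub, ← avg_add]
    congr 1
    funext i
    simp only [he, Pi.sub_apply, Pi.add_apply]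
    abel
  have h2 : inner ℝ g (avg e) ≤ A * M * msq (disp V α β Z B) := by
    refine (real_inner_le_norm _ _).trans ?_
    have : ‖avg e‖ ≤ M * msq (disp V α β Z B) := by
      refine (norm_avg_le_mean _).trans ?_
      rw [msq, ← mean_mul]
      exact mean_mono fun i => hR _ (h.mem i) _ (disp_mem_tangent h.mem i)
    calc ‖g‖ * ‖avg e‖ ≤ A * (M * msq (disp V α β Z B)) := by gcongr
      _ = _ := by ring
  have h3 : disp V α β Z B = α • ((mix V Z - Z)
      + (1 / 2 : ℝ) • fun i => Z i * disagree V Z i) - β • dir Z B := by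
    funext i
    simp only [disp, projT_mix hV h.mem, Pi.sub_apply, Pi.smul_apply, Pi.add_apply, dir]
  -- Mixing preserves the mean, so the linear consensus term disappears and only its quadratic
  -- curvature part remains.
  have h4 : avg (disp V α β Z B) = (α * (1 / 2)) • avg (fun i => Z i * disagree V Z i)
      - β • avg (dir Z B) := by
    rw [h3, avg_sub, avg_smul, avg_add, avg_sub, avg_mix hV, sub_self, zero_add, avg_smul,
      avg_smul, smul_smul]
  have h5 : inner ℝ g (avg fun i => Z i * disagree V Z i)
      ≤ A * (4 * msq fun i => Z i - Xh) := by
    refine (real_inner_le_norm _ _).trans ?_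
    have : ‖avg fun i => Z i * disagree V Z i‖ ≤ 4 * msq fun i => Z i - Xh := by
      refine (norm_avg_le_mean _).trans ?_
      simp only [norm_St_mul (h.mem _)]
      exact mean_norm_disagree_le hV
    gcongr
  -- The test vector is tangent at the centre, so replacing the directions by their projections at
  -- the agents costs only the distance to the centre.
  have h6 : inner ℝ g (avg B) - ‖g‖ * (6 * A) * (rms fun i => Z i - Xh)
      ≤ inner ℝ g (avg (dir Z B)) := by
    have e1 : ∀ i, inner ℝ g (B i)
        ≤ inner ℝ g (dir Z B i) + ‖g‖ * (6 * A) * ‖Z i - Xh‖ := fun i => by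
      have e2 := le_of_abs_le (inner_sub_projT_le (h.mem i) hg (B i))
      rw [inner_sub_right] at e2
      have e3 : ‖g‖ * ‖Z i - Xh‖ * ‖B i‖ ≤ ‖g‖ * ‖Z i - Xh‖ * (6 * A) := by
        gcongr; exact hB i
      simp only [dir]
      linarith
    have e4 := mean_mono e1
    rw [mean_add, mean_mul, ← inner_avg, ← inner_avg] at e4
    have e5 := mul_le_mul_of_nonneg_left (mean_norm_le_rms hV.pos fun i => Z i - Xh)
      (by positivity : 0 ≤ ‖g‖ * (6 * A))
    linarith
  rw [h1, h4, inner_add_right, inner_sub_right, inner_smul_right, inner_smul_right]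
  have h7 := mul_le_mul_of_nonneg_left h5 (by positivity : 0 ≤ α * (1 / 2))
  have h8 := mul_le_mul_of_nonneg_left h6 hs.β_pos.le
  linarith

end Step

/-! ### Smooth costs on the Stiefel manifold -/

section Costs

variable {N n r : ℕ} {φ : Mat n r → ℝ} {L A : ℝ}

theorem fderiv_eq_inner (φ : Mat n r → ℝ) (X Z : Mat n r) :
    fderiv ℝ φ X Z = inner ℝ (eGrad φ X) Z := fderiv_eq_trace φ X Z

theorem LSmooth.le_add (h : LSmooth L φ) (X Y : Mat n r) :
    φ Y ≤ φ X + inner ℝ (eGrad φ X) (Y - X) + L / 2 * ‖Y - X‖ ^ 2 := by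
  set d := Y - X with hd
  -- Along the segment ψ is the cost minus its quadratic model; the Lipschitz gradient makes it
  -- antitone on [0, 1].
  set ψ : ℝ → ℝ := fun s => φ (X + s • d) - s * inner ℝ (eGrad φ X) d - L / 2 * s ^ 2 * ‖d‖ ^ 2
    with hψ
  have hder : ∀ s, HasDerivAt ψ (inner ℝ (eGrad φ (X + s • d)) d - inner ℝ (eGrad φ X) d
      - L * s * ‖d‖ ^ 2) s := fun s => by
    have h1 : HasDerivAt (fun s : ℝ => X + s • d) d s := by
      have := ((hasDerivAt_id s).smul_const d).const_add X
      rwa [one_smul] at this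
    have h2 := ((h.1 (X + s • d)).hasFDerivAt.comp_hasDerivAt s h1).congr_deriv
      (fderiv_eq_inner φ (X + s • d) d)
    have h3 : HasDerivAt (fun s : ℝ => s * inner ℝ (eGrad φ X) d) (inner ℝ (eGrad φ X) d) s := by
      simpa using (hasDerivAt_id s).mul_const (inner ℝ (eGrad φ X) d)
    have h4 : HasDerivAt (fun s : ℝ => L / 2 * s ^ 2 * ‖d‖ ^ 2) (L * s * ‖d‖ ^ 2) s := by
      have := (((hasDerivAt_id s).pow 2).const_mul (L / 2)).mul_const (‖d‖ ^ 2)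
      refine this.congr_deriv ?_
      simp only [id, Nat.add_one_sub_one, pow_one, Nat.cast_ofNat]
      ring
    exact (h2.sub h3).sub h4
  have hanti : AntitoneOn ψ (Set.Icc 0 1) := by
    refine antitoneOn_of_deriv_nonpos (convex_Icc 0 1)
      (fun s _ => (hder s).continuousAt.continuousWithinAt)
      (fun s _ => (hder s).differentiableAt.differentiableWithinAt) fun s hs => ?_
    rw [interior_Icc] at hs
    rw [(hder s).deriv, ← inner_sub_left]
    have h1 := h.2 (X + s • d) X
    rw [add_sub_cancel_left, norm_smul, Real.norm_of_nonneg hs.1.le] at h1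
    have h2 := real_inner_le_norm (eGrad φ (X + s • d) - eGrad φ X) d
    have h3 := mul_le_mul_of_nonneg_right h1 (norm_nonneg d)
    linarith
  have h01 := hanti (Set.left_mem_Icc.2 zero_le_one) (Set.right_mem_Icc.2 zero_le_one) zero_le_one
  simp only [hψ, zero_smul, add_zero, one_smul, hd, add_sub_cancel] at h01
  linarith

/-- The normal part of the gradient, paired with a chord of the manifold, is quadratic in the chord;
it only enlarges the smoothness constant by A. -/
theorem LSmooth.le_add_rGrad (h : LSmooth L φ) {X Y : Mat n r} (hX : X ∈ St n r)
    (hY : Y ∈ St n r) (hA : ‖eGrad φ X‖ ≤ A) :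
    φ Y ≤ φ X + inner ℝ (rGrad φ X) (Y - X) + (L + A) / 2 * ‖Y - X‖ ^ 2 := by
  have h1 := h.le_add X Y
  set G := eGrad φ X with hG
  set S : Mat r r := (1 / 2 : ℝ) • (Xᵀ * G + Gᵀ * X) with hS
  have hSt : Sᵀ = S := by
    simp [hS, Matrix.transpose_add, Matrix.transpose_mul, add_comm]
  have hr : rGrad φ X = G - X * S := by rw [rGrad, projT, hS, Matrix.mul_smul]
  have hSn : ‖S‖ ≤ A := by
    rw [hS, norm_smul, Real.norm_of_nonneg (by norm_num)]
    have h4 : ‖Xᵀ * G‖ ≤ ‖G‖ := norm_St_transpose_mul_le hX G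
    have h5 : ‖Gᵀ * X‖ ≤ ‖G‖ := by
      have := norm_mul_St_le hX Gᵀ
      rwa [Matrix.frobenius_norm_transpose] at this
    have := norm_add_le (Xᵀ * G) (Gᵀ * X)
    linarith
  have h2 := inner_St_mul_sub hX hY hSt
  have h3 : |inner ℝ S ((X - Y)ᵀ * (X - Y))| ≤ A * ‖Y - X‖ ^ 2 := by
    refine (abs_real_inner_le_norm _ _).trans ?_
    rw [norm_sub_rev Y X]
    have := norm_transpose_mul_self_le (X - Y)
    have hA0 : 0 ≤ A := (norm_nonneg _).trans hA
    gcongr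
  have h4 : inner ℝ (X * S) (Y - X) = -inner ℝ (X * S) (X - Y) := by
    rw [← inner_neg_right, neg_sub]
  rw [hr, inner_sub_left, h4, h2]
  have := neg_le_of_abs_le h3
  linarith [abs_le.1 h3]

/-- The gradient contributes L and the change of the projection contributes 2A: the base point
occurs twice in the normal term, each time paired with a matrix of norm at most 2A and halved. -/
theorem LSmooth.norm_rGrad_sub_le (h : LSmooth L φ) {X Y : Mat n r} (hX : X ∈ St n r)
    (hY : Y ∈ St n r) (hA : ‖eGrad φ Y‖ ≤ A) :
    ‖rGrad φ X - rGrad φ Y‖ ≤ (L + 2 * A) * ‖X - Y‖ := by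
  set G := eGrad φ Y with hG
  have h1 : rGrad φ X - rGrad φ Y = projT X (eGrad φ X - G)
      + (1 / 2 : ℝ) • ((Y - X) * (Yᵀ * G + Gᵀ * Y)
        + X * ((Y - X)ᵀ * G + Gᵀ * (Y - X))) := by
    rw [projT_sub, rGrad, rGrad, ← hG]
    simp only [projT, Matrix.sub_mul, Matrix.mul_sub, Matrix.mul_add, Matrix.transpose_sub]
    module
  have h2 := (norm_projT_le hX (eGrad φ X - G)).trans (h.2 X Y)
  have e1 : ‖Yᵀ * G‖ ≤ ‖G‖ := norm_St_transpose_mul_le hY G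
  have e2 : ‖Gᵀ * Y‖ ≤ ‖G‖ := by
    have := norm_mul_St_le hY Gᵀ
    rwa [Matrix.frobenius_norm_transpose] at this
  have e3 : ‖(Y - X) * (Yᵀ * G + Gᵀ * Y)‖ ≤ ‖X - Y‖ * (2 * A) := by
    rw [norm_sub_rev X Y]
    refine (norm_mul_le' _ _).trans ?_
    gcongr
    refine (norm_add_le _ _).trans ?_
    linarith
  have e4 : ‖X * ((Y - X)ᵀ * G + Gᵀ * (Y - X))‖ ≤ ‖X - Y‖ * (2 * A) := by
    rw [norm_St_mul hX, norm_sub_rev X Y]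
    have f1 := norm_mul_le' (Y - X)ᵀ G
    have f2 := norm_mul_le' Gᵀ (Y - X)
    rw [Matrix.frobenius_norm_transpose] at f1 f2
    have f3 := mul_le_mul_of_nonneg_left hA (norm_nonneg (Y - X))
    refine (norm_add_le _ _).trans ?_
    linarith
  have h3 : ‖(1 / 2 : ℝ) • ((Y - X) * (Yᵀ * G + Gᵀ * Y)
        + X * ((Y - X)ᵀ * G + Gᵀ * (Y - X)))‖ ≤ 2 * A * ‖X - Y‖ := by
    rw [norm_smul, Real.norm_of_nonneg (by norm_num)]
    have := norm_add_le ((Y - X) * (Yᵀ * G + Gᵀ * Y)) (X * ((Y - X)ᵀ * G + Gᵀ * (Y - X)))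
    linarith
  rw [h1]
  refine (norm_add_le _ _).trans ?_
  linarith

/-- The average of the local costs. -/
noncomputable def tot (φ : Fin N → Mat n r → ℝ) (X : Mat n r) : ℝ :=
  (1 / (N : ℝ)) * ∑ i, φ i X

theorem eGrad_tot {φ : Fin N → Mat n r → ℝ} (h : ∀ i, Differentiable ℝ (φ i)) (X : Mat n r) :
    eGrad (tot φ) X = avg fun i => eGrad (φ i) X := by
  have hd : fderiv ℝ (tot φ) X = (1 / (N : ℝ)) • ∑ i, fderiv ℝ (φ i) X := by
    have h1 : HasFDerivAt (fun X => ∑ i, φ i X) (∑ i, fderiv ℝ (φ i) X) X :=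
      HasFDerivAt.fun_sum fun i _ => (h i X).hasFDerivAt
    exact (h1.const_mul (1 / (N : ℝ))).fderiv
  ext a b
  simp [eGrad, hd, avg, Matrix.sum_apply]

theorem differentiable_tot {φ : Fin N → Mat n r → ℝ} (h : ∀ i, Differentiable ℝ (φ i)) :
    Differentiable ℝ (tot φ) := by
  have : Differentiable ℝ fun X => ∑ i, φ i X := Differentiable.fun_sum fun i _ => h i
  exact this.const_mul _

theorem rGrad_tot {φ : Fin N → Mat n r → ℝ} (h : ∀ i, Differentiable ℝ (φ i)) (X : Mat n r) :
    rGrad (tot φ) X = avg fun i => rGrad (φ i) X := by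
  rw [rGrad, eGrad_tot h, avg, projT_smul, projT_sum]; rfl

theorem LSmooth.tot {φ : Fin N → Mat n r → ℝ} (hN : 0 < N) (h : ∀ i, LSmooth L (φ i)) :
    LSmooth L (tot φ) := by
  refine ⟨differentiable_tot fun i => (h i).1, fun X Y => ?_⟩
  rw [eGrad_tot fun i => (h i).1, eGrad_tot fun i => (h i).1, ← avg_sub]
  exact norm_avg_le hN fun i => (h i).2 X Y

theorem norm_eGrad_tot_le {φ : Fin N → Mat n r → ℝ} (hN : 0 < N) (h : ∀ i, LSmooth L (φ i))
    {X : Mat n r} (hA : ∀ i, ‖eGrad (φ i) X‖ ≤ A) : ‖eGrad (DRSGT.tot φ) X‖ ≤ A := by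
  rw [eGrad_tot fun i => (h i).1]
  exact norm_avg_le hN hA

end Costs

/-! ### A trajectory of the algorithm -/

/-- Numerical conditions relating the step sizes to the costs. -/
structure CostSizes (α β A M L Λ : ℝ) : Prop where
  Λ_pos : 0 < Λ
  A_le : 10 * A ≤ Λ
  L_le : L + 2 * A ≤ Λ
  βΛ : 3200 * (β * Λ) ≤ 1
  βMA : 16 * (β * M * A) ≤ 1

/-- The costs are `L`-smooth with gradients bounded by `A` on `St`. -/
structure GoodCosts {N n r : ℕ} (φ : Fin N → Mat n r → ℝ) (L A : ℝ) : Prop where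
  smooth : ∀ i, LSmooth L (φ i)
  bound : ∀ i, ∀ X ∈ St n r, ‖eGrad (φ i) X‖ ≤ A

/-- A realization of the algorithm: variables `X`, trackers `Y`, sampled gradients `F`, induced
arithmetic means `c`. -/
structure Trajectory {N n r : ℕ} (V : Matrix (Fin N) (Fin N) ℝ) (α β A δ₁ δ₂ : ℝ)
    (X Y F : ℕ → Fin N → Mat n r) (c : ℕ → Mat n r) : Prop where
  X_succ : ∀ k, X (k + 1) = retrStep V α β (X k) (Y k)
  Y_zero : Y 0 = F 0
  Y_succ : ∀ k, Y (k + 1) = mix V (Y k) + F (k + 1) - F k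
  F_le : (∀ k i, X k i ∈ St n r) → ∀ k i, ‖F k i‖ ≤ A
  near : ∀ i, X 0 i ∈ St n r
  near_msq : (msq fun i => X 0 i - c 0) ≤ δ₁ ^ 2
  near_max : ∀ i, ‖X 0 i - c 0‖ ≤ δ₂
  iam : ∀ k, (∀ i, X k i ∈ St n r) → IsIAM (X k) (c k)

section Trajectory

variable {N n r : ℕ} {V : Matrix (Fin N) (Fin N) ℝ} {s α β A M L Λ δ₁ δ₂ : ℝ}
  {X Y F : ℕ → Fin N → Mat n r} {c : ℕ → Mat n r} {φ : Fin N → Mat n r → ℝ}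

theorem Trajectory.mem (h : Trajectory V α β A δ₁ δ₂ X Y F c) (k : ℕ) (i : Fin N) :
    X k i ∈ St n r := by
  induction k generalizing i with
  | zero => exact h.near i
  | succ k ih => rw [h.X_succ]; exact retrStep_mem ih i

theorem Trajectory.isIAM (h : Trajectory V α β A δ₁ δ₂ X Y F c) (k : ℕ) : IsIAM (X k) (c k) :=
  h.iam k (h.mem k)

theorem Trajectory.norm_F_le (h : Trajectory V α β A δ₁ δ₂ X Y F c) (k : ℕ) (i : Fin N) :
    ‖F k i‖ ≤ A := h.F_le h.mem k i

/-- Tracking invariant: mixing preserves the mean and the increments of the sampled gradients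
telescope. -/
theorem Trajectory.avg_Y (h : Trajectory V α β A δ₁ δ₂ X Y F c) (hV : Mixing V s) (k : ℕ) :
    avg (Y k) = avg (F k) := by
  induction k with
  | zero => rw [h.Y_zero]
  | succ k ih => rw [h.Y_succ, avg_sub, avg_add, avg_mix hV, ih]; abel

/-- The induction closes at 6A: the mixed fluctuation is at most half of 6A, and the mean and the
two sampled gradients add 3A. -/
theorem Trajectory.norm_Y_le (h : Trajectory V α β A δ₁ δ₂ X Y F c) (hV : Mixing V s)
    (hA : 0 ≤ A) (k : ℕ) (i : Fin N) : ‖Y k i‖ ≤ 6 * A := by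
  induction k generalizing i with
  | zero =>
    rw [h.Y_zero]
    linarith [h.norm_F_le 0 i]
  | succ k ih =>
    rw [h.Y_succ]
    have h1 : (mix V (Y k) + F (k + 1) - F k) i
        = (mix V (Y k) i - avg (Y k)) + avg (F k) + F (k + 1) i - F k i := by
      rw [h.avg_Y hV]; simp
    have h2 := norm_sub_le (mix V (Y k) i - avg (Y k) + avg (F k) + F (k + 1) i) (F k i)
    have h3 := norm_add₃_le (a := mix V (Y k) i - avg (Y k)) (b := avg (F k)) (c := F (k + 1) i)
    have h4 := norm_mix_sub_avg_le hV (Y k) i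
    have h5 := rms_le_of_le hV.pos ih
    have h6 := norm_avg_le hV.pos (h.norm_F_le k)
    have h7 := h.norm_F_le k i
    have h8 := h.norm_F_le (k + 1) i
    rw [h1]
    linarith

/-- The polar retraction agrees with `X + v` to second order, with constant `M`. -/
def RetrBound (n r : ℕ) (M : ℝ) : Prop :=
  ∀ X ∈ St n r, ∀ v ∈ tangent X, ‖polarRetr X v - (X + v)‖ ≤ M * ‖v‖ ^ 2

theorem Trajectory.norm_avg_sub_le (h : Trajectory V α β A δ₁ δ₂ X Y F c) (hV : Mixing V s)
    (hM : 0 < M) (hR : RetrBound n r M) (k : ℕ) :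
    ‖avg (X k) - c k‖ ≤ 1 / 2 * msq fun i => X k i - c k :=
  (h.isIAM k).norm_avg_sub_le hV.pos (h.mem k)
    ((h.isIAM k).projT_avg_eq_zero hV.pos (h.mem k) hM hR)

theorem Trajectory.near_all (h : Trajectory V α β A δ₁ δ₂ X Y F c) (hV : Mixing V s)
    (hs : StepSizes α β A M δ₁ δ₂) (hR : RetrBound n r M) (k : ℕ) :
    Near δ₁ δ₂ (X k) (c k) := by
  induction k with
  | zero => exact ⟨h.mem 0, (h.isIAM 0).1, h.norm_avg_sub_le hV hs.M_pos hR 0, h.near_msq,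
      h.near_max⟩
  | succ k ih =>
    have h1 := h.isIAM (k + 1)
    have h2 := h.norm_avg_sub_le hV hs.M_pos hR (k + 1)
    rw [h.X_succ] at h1 h2 ⊢
    exact ih.step hV hs (h.norm_Y_le hV hs.A_nonneg k) h1 h2

theorem GoodCosts.norm_rGrad_sub_le (hφ : GoodCosts φ L A) (hc : CostSizes α β A M L Λ)
    (i : Fin N) {Z W : Mat n r} (hZ : Z ∈ St n r) (hW : W ∈ St n r) :
    ‖rGrad (φ i) Z - rGrad (φ i) W‖ ≤ Λ * ‖Z - W‖ :=
  ((hφ.smooth i).norm_rGrad_sub_le hZ hW (hφ.bound i W hW)).trans (by gcongr; exact hc.L_le)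

theorem GoodCosts.norm_rGrad_tot_le (hφ : GoodCosts φ L A) (hN : 0 < N) {Z : Mat n r}
    (hZ : Z ∈ St n r) : ‖rGrad (tot φ) Z‖ ≤ A :=
  (norm_projT_le hZ _).trans (norm_eGrad_tot_le hN hφ.smooth fun i => hφ.bound i Z hZ)

theorem sq_add_le_of_lt_one {a b t : ℝ} (ht0 : 0 ≤ t) (ht : t < 1) :
    (t * a + b) ^ 2 ≤ t * a ^ 2 + 1 / (1 - t) * b ^ 2 := by
  have h1 : 0 < 1 - t := by linarith
  have h2 : t * a ^ 2 + 1 / (1 - t) * b ^ 2 - (t * a + b) ^ 2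
      = t / (1 - t) * ((1 - t) * a - b) ^ 2 := by
    field_simp
    ring
  have h3 : 0 ≤ t / (1 - t) * ((1 - t) * a - b) ^ 2 := by positivity
  linarith

/-- Young's inequality with the weight that keeps the factor 1 - x/4 beyond 1 - x; the defect is an
exact square. The resulting gap x(5 - x)/4 is large enough for the comparison with Γ₀ and Γ₁. -/
theorem sq_contract_le {a b x : ℝ} (hx0 : 0 < x) (hx : x < 1) :
    ((1 - x) * a + b) ^ 2 ≤ (1 - x) * (1 - x / 4) * a ^ 2 + (4 - x) / (3 * x) * b ^ 2 := by
  have h1 : 0 < 1 - x := by linarith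
  have h2 : (1 - x) * (1 - x / 4) * a ^ 2 + (4 - x) / (3 * x) * b ^ 2 - ((1 - x) * a + b) ^ 2
      = (1 - x) / (12 * x) * (3 * x * a - 4 * b) ^ 2 := by
    field_simp
    ring
  have h3 : 0 ≤ (1 - x) / (12 * x) * (3 * x * a - 4 * b) ^ 2 := by positivity
  linarith

/-- Consensus error recursion. -/
theorem Trajectory.consensus_succ_le (h : Trajectory V α β A δ₁ δ₂ X Y F c) (hV : Mixing V s)
    (hs : StepSizes α β A M δ₁ δ₂) (hR : RetrBound n r M) (k : ℕ) :
    (msq fun i => X (k + 1) i - c (k + 1))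
      ≤ (1 - 11 / 20 * α) * (1 - 11 / 20 * α / 4) * (msq fun i => X k i - c k)
        + (4 - 11 / 20 * α) / (3 * (11 / 20 * α)) * (β ^ 2 * msq (dir (X k) (Y k))) := by
  have hn := h.near_all hV hs hR k
  have h1 := rms_retrStep_sub_le hV hs hn (B := Y k)
  have h2 := (h.isIAM (k + 1)).msq_sub_le hn.center
  rw [h.X_succ] at h2 ⊢
  have hα := hs.α_pos
  have hα1 := hs.α_le
  refine h2.trans ?_
  rw [← rms_sq, ← rms_sq, ← rms_sq, ← mul_pow]
  exact (pow_le_pow_left₀ (rms_nonneg _) h1 2).trans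
    (sq_contract_le (by linarith) (by linarith))

theorem Trajectory.msq_F_sub_le (h : Trajectory V α β A δ₁ δ₂ X Y F c) (hV : Mixing V s)
    (hφ : GoodCosts φ L A) (hc : CostSizes α β A M L Λ) (k : ℕ) :
    msq (F (k + 1) - F k) ≤ 2 * Λ ^ 2 * (8 * α ^ 2 * (msq fun i => X k i - c k)
        + 2 * β ^ 2 * msq (dir (X k) (Y k)))
      + 4 * (msq fun i => F k i - rGrad (φ i) (X k i))
      + 4 * (msq fun i => F (k + 1) i - rGrad (φ i) (X (k + 1) i)) := by
  set P : ℕ → Fin N → Mat n r := fun k i => rGrad (φ i) (X k i) with hP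
  -- The increment of the true gradients is Lipschitz in the displacement; the rest is the
  -- difference of two sampling errors.
  have h1 : F (k + 1) - F k
      = (P (k + 1) - P k) + ((F (k + 1) - P (k + 1)) - (F k - P k)) := by abel
  have h2 := msq_add_le (P (k + 1) - P k) ((F (k + 1) - P (k + 1)) - (F k - P k))
  have h3 := msq_sub_le (F (k + 1) - P (k + 1)) (F k - P k)
  have h4 : msq (P (k + 1) - P k) ≤ Λ ^ 2 * msq fun i => X (k + 1) i - X k i := by
    rw [← msq_smul]
    refine msq_mono fun i => ?_
    simp only [Pi.smul_apply, norm_smul, Real.norm_of_nonneg hc.Λ_pos.le]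
    exact hφ.norm_rGrad_sub_le hc i (h.mem _ i) (h.mem _ i)
  have h5 := msq_retrStep_sub_le hV (h.mem k) (c k) (α := α) (β := β) (B := Y k)
  rw [← h.X_succ] at h5
  have h6 := mul_le_mul_of_nonneg_left h5 (sq_nonneg Λ)
  rw [h1]
  change _ ≤ _ + 4 * msq (F k - P k) + 4 * msq (F (k + 1) - P (k + 1))
  linarith

/-- Tracking error recursion. -/
theorem Trajectory.tracking_succ_le (h : Trajectory V α β A δ₁ δ₂ X Y F c) (hV : Mixing V s)
    (k : ℕ) :
    (msq fun i => Y (k + 1) i - avg (F (k + 1)))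
      ≤ s * (msq fun i => Y k i - avg (F k)) + 1 / (1 - s) * msq (F (k + 1) - F k) := by
  have hs1 := hV.s_le_const
  have h1 : (fun i => Y (k + 1) i - avg (F (k + 1)))
      = (fun i => mix V (Y k) i - avg (Y k))
        + fun i => (F (k + 1) - F k) i - avg (F (k + 1) - F k) := by
    funext i
    rw [h.Y_succ, avg_sub, h.avg_Y hV]
    simp only [Pi.add_apply, Pi.sub_apply]
    abel
  have h2 : (rms fun i => Y (k + 1) i - avg (F (k + 1)))
      ≤ s * (rms fun i => Y k i - avg (F k)) + rms (F (k + 1) - F k) := by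
    rw [h1, ← h.avg_Y hV k]
    exact (rms_add_le _ _).trans (add_le_add (rms_mix_sub_avg_le hV _)
      (rms_sub_avg_le hV.pos _))
  rw [← rms_sq, ← rms_sq, ← rms_sq (F (k + 1) - F k)]
  exact (pow_le_pow_left₀ (rms_nonneg _) h2 2).trans
    (sq_add_le_of_lt_one hV.s_nonneg (by linarith))

theorem Trajectory.rms_F_sub_le (h : Trajectory V α β A δ₁ δ₂ X Y F c) (hV : Mixing V s)
    (hφ : GoodCosts φ L A) (hc : CostSizes α β A M L Λ) (k : ℕ) :
    ‖avg (F k) - rGrad (tot φ) (c k)‖ ≤ (rms fun i => F k i - rGrad (φ i) (X k i))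
      + Λ * rms fun i => X k i - c k := by
  rw [rGrad_tot fun i => (hφ.smooth i).1, ← avg_sub]
  refine (norm_avg_le_rms hV.pos _).trans ?_
  have h1 : (F k - fun i => rGrad (φ i) (c k)) = (fun i => F k i - rGrad (φ i) (X k i))
      + fun i => rGrad (φ i) (X k i) - rGrad (φ i) (c k) := by
    funext i
    simp only [Pi.add_apply, Pi.sub_apply]
    abel
  rw [h1]
  refine (rms_add_le _ _).trans ?_
  gcongr
  have h2 := rms_smul Λ fun i => X k i - c k
  rw [abs_of_pos hc.Λ_pos] at h2
  rw [← h2]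
  refine rms_mono fun i => ?_
  simp only [Pi.smul_apply, norm_smul, Real.norm_of_nonneg hc.Λ_pos.le]
  exact hφ.norm_rGrad_sub_le hc i (h.mem _ i) (h.isIAM k).1

/-- The directions are controlled by the gradient at the centre. -/
theorem Trajectory.msq_dir_le (h : Trajectory V α β A δ₁ δ₂ X Y F c) (hV : Mixing V s)
    (hφ : GoodCosts φ L A) (hc : CostSizes α β A M L Λ) (k : ℕ) :
    msq (dir (X k) (Y k)) ≤ 5 / 4 * ‖rGrad (tot φ) (c k)‖ ^ 2
      + 10 * Λ ^ 2 * (msq fun i => X k i - c k)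
      + 10 * (msq fun i => F k i - rGrad (φ i) (X k i))
      + msq fun i => Y k i - avg (F k) := by
  have h1 : msq (dir (X k) (Y k)) ≤ msq (Y k) :=
    msq_mono fun i => norm_projT_le (h.mem k i) _
  have h2 := msq_eq hV.pos (Y k)
  rw [h.avg_Y hV] at h2
  have h3 := h.rms_F_sub_le hV hφ hc k
  set g := rGrad (tot φ) (c k)
  have h4 : ‖avg (F k)‖ ≤ ‖g‖ + ‖avg (F k) - g‖ := by
    have := norm_add_le g (avg (F k) - g)
    rwa [add_sub_cancel] at this
  rw [← rms_sq (fun i => X k i - c k), ← rms_sq fun i => F k i - rGrad (φ i) (X k i)]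
  set a := rms fun i => F k i - rGrad (φ i) (X k i)
  set b := rms fun i => X k i - c k
  have ha : 0 ≤ a := rms_nonneg _
  have hb : 0 ≤ Λ * b := mul_nonneg hc.Λ_pos.le (rms_nonneg _)
  -- The constants come from (g + w)² ≤ 5/4 g² + 5w² and w² ≤ 2a² + 2(Λb)².
  have h5 : ‖avg (F k)‖ ^ 2 ≤ (‖g‖ + (a + Λ * b)) ^ 2 :=
    pow_le_pow_left₀ (norm_nonneg _) (by linarith) 2
  nlinarith [sq_nonneg (‖g‖ - 4 * (a + Λ * b)), sq_nonneg (a - Λ * b)]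

theorem Near.msq_le_one (hs : StepSizes α β A M δ₁ δ₂) {Z : Fin N → Mat n r} {W : Mat n r}
    (h : Near δ₁ δ₂ Z W) : (msq fun i => Z i - W) ≤ 1 := by
  refine h.msq_le.trans ?_
  have := hs.δ₁_le_α
  have := hs.δ₁_pos
  have := hs.α_le
  nlinarith

/-- Squared displacement of the centres. -/
theorem Trajectory.norm_center_sub_sq_le (h : Trajectory V α β A δ₁ δ₂ X Y F c)
    (hV : Mixing V s) (hs : StepSizes α β A M δ₁ δ₂) (hR : RetrBound n r M) (k : ℕ) :
    ‖c (k + 1) - c k‖ ^ 2 ≤ (msq fun i => X (k + 1) i - c (k + 1))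
      + 25 * (msq fun i => X k i - c k) + 6 * β ^ 2 * msq (dir (X k) (Y k)) := by
  have hn := h.near_all hV hs hR k
  have hn' := h.near_all hV hs hR (k + 1)
  have h6 := norm_center_sub_le hV.pos hn.avg_le hn'.avg_le
  have h7 : (rms fun i => X (k + 1) i - X k i) ^ 2
      ≤ 8 * α ^ 2 * (msq fun i => X k i - c k) + 2 * β ^ 2 * msq (dir (X k) (Y k)) := by
    rw [rms_sq, h.X_succ]
    exact msq_retrStep_sub_le hV hn.mem (c k)
  have hE1 := hn.msq_le_one hs
  have hE1' := hn'.msq_le_one hs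
  have hE0 : 0 ≤ msq fun i => X k i - c k := msq_nonneg _
  have hE0' : 0 ≤ msq fun i => X (k + 1) i - c (k + 1) := msq_nonneg _
  generalize (msq fun i => X k i - c k) = E at *
  generalize (msq fun i => X (k + 1) i - c (k + 1)) = E' at *
  generalize (rms fun i => X (k + 1) i - X k i) = d at *
  generalize msq (dir (X k) (Y k)) = U at *
  have e1 := pow_le_pow_left₀ (norm_nonneg _) h6 2
  have e2 : (1 / 2 * E' + 1 / 2 * E + d) ^ 2
      ≤ 3 * ((1 / 2 * E') ^ 2 + (1 / 2 * E) ^ 2 + d ^ 2) := by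
    nlinarith [sq_nonneg (1 / 2 * E' - 1 / 2 * E), sq_nonneg (1 / 2 * E - d),
      sq_nonneg (1 / 2 * E' - d)]
  have e3 : E' ^ 2 ≤ E' := by nlinarith
  have e4 : E ^ 2 ≤ E := by nlinarith
  have hα2 : α ^ 2 ≤ 1 := by nlinarith [hs.α_pos, hs.α_le]
  have e5 : α ^ 2 * E ≤ E := by nlinarith
  linarith

/-- Displacement of the centres, tested against the gradient. -/
theorem Trajectory.inner_center_sub_le (h : Trajectory V α β A δ₁ δ₂ X Y F c)
    (hV : Mixing V s) (hs : StepSizes α β A M δ₁ δ₂) (hR : RetrBound n r M)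
    (hφ : GoodCosts φ L A) (hc : CostSizes α β A M L Λ) (k : ℕ) :
    inner ℝ (rGrad (tot φ) (c k)) (c (k + 1) - c k)
      ≤ A * (1 / 2 * msq fun i => X (k + 1) i - c (k + 1))
        + A * (1 / 2 * msq fun i => X k i - c k)
        + A * M * (8 * α ^ 2 * (msq fun i => X k i - c k) + 2 * β ^ 2 * msq (dir (X k) (Y k)))
        + 2 * α * A * (msq fun i => X k i - c k)
        - β * (‖rGrad (tot φ) (c k)‖ ^ 2 - ‖rGrad (tot φ) (c k)‖
          * ((rms fun i => F k i - rGrad (φ i) (X k i)) + Λ * rms fun i => X k i - c k))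
        + β * (‖rGrad (tot φ) (c k)‖ * (6 * A) * rms fun i => X k i - c k) := by
  have hn := h.near_all hV hs hR k
  have hn' := h.near_all hV hs hR (k + 1)
  have hA := hs.A_nonneg
  have h3 := h.rms_F_sub_le hV hφ hc k
  have hgt : rGrad (tot φ) (c k) ∈ tangent (c k) := projT_mem_tangent hn.center _
  have hgA : ‖rGrad (tot φ) (c k)‖ ≤ A := hφ.norm_rGrad_tot_le hV.pos hn.center
  generalize rGrad (tot φ) (c k) = g at *
  have h1 := inner_avg_retrStep_sub_le hV hs hn (h.norm_Y_le hV hA k) hR hgt hgA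
  rw [← h.X_succ, h.avg_Y hV] at h1
  have h2 := mul_le_mul_of_nonneg_left
    (msq_disp_le hV hn.mem (c k) (α := α) (β := β) (B := Y k)) (mul_nonneg hA hs.M_pos.le)
  have h4 : ‖g‖ ^ 2 - ‖g‖ * ((rms fun i => F k i - rGrad (φ i) (X k i))
      + Λ * rms fun i => X k i - c k) ≤ inner ℝ g (avg (F k)) := by
    have e1 := neg_le_of_abs_le (abs_real_inner_le_norm g (avg (F k) - g))
    rw [inner_sub_right, real_inner_self_eq_norm_sq] at e1
    have e2 := mul_le_mul_of_nonneg_left h3 (norm_nonneg g)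
    linarith
  have h4' := mul_le_mul_of_nonneg_left h4 hs.β_pos.le
  -- The motion of the centre is that of the arithmetic mean, up to two defects quadratic in the
  -- consensus errors.
  have e1 : c (k + 1) - c k = -(avg (X (k + 1)) - c (k + 1)) + (avg (X k) - c k)
      + (avg (X (k + 1)) - avg (X k)) := by abel
  rw [e1, inner_add_right, inner_add_right]
  have e2 := real_inner_le_norm g (-(avg (X (k + 1)) - c (k + 1)))
  have e3 := real_inner_le_norm g (avg (X k) - c k)
  rw [norm_neg] at e2
  have e4 := mul_le_mul hgA hn'.avg_le (norm_nonneg _) hA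
  have e5 := mul_le_mul hgA hn.avg_le (norm_nonneg _) hA
  linarith

/-- The cross terms spend 1/8 + 1/16 of βg², leaving 13/16. The coefficient of βU is 1/8 from the
retraction plus 3/3200 from smoothness, and everything in A is absorbed by 10A ≤ Λ. -/
theorem descent_arith {E E' e w U g : ℝ} (hs : StepSizes α β A M δ₁ δ₂)
    (hc : CostSizes α β A M L Λ) (hE0 : 0 ≤ E) (hE0' : 0 ≤ E') (hU0 : 0 ≤ U)
    (he2 : e ^ 2 = E) :
    A * (1 / 2 * E') + A * (1 / 2 * E) + A * M * (8 * α ^ 2 * E + 2 * β ^ 2 * U)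
        + 2 * α * A * E - β * (g ^ 2 - g * (w + Λ * e)) + β * (g * (6 * A) * e)
        + Λ / 2 * (E' + 25 * E + 6 * β ^ 2 * U)
      ≤ -(13 / 16 * β * g ^ 2) + 4 * β * w ^ 2 + 126 / 1000 * β * U + Λ * E' + 14 * Λ * E := by
  have hβ := hs.β_pos
  have hα := hs.α_pos
  have hα1 := hs.α_le
  have hA := hs.A_nonneg
  have hΛ := hc.Λ_pos
  have hAΛ := hc.A_le
  have y1 : β * (g * (w + Λ * e)) ≤ β * (1 / 8 * g ^ 2 + 4 * w ^ 2 + 4 * Λ ^ 2 * E) := by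
    gcongr
    rw [← he2]
    linarith [sq_nonneg (g - 8 * w), sq_nonneg (g - 8 * (Λ * e))]
  have y2 : β * (g * (6 * A) * e) ≤ β * (1 / 16 * g ^ 2 + 144 * A ^ 2 * E) := by
    gcongr
    rw [← he2]
    linarith [sq_nonneg (g - 48 * (A * e))]
  have hAE : 0 ≤ A * E := mul_nonneg hA hE0
  have hβU : 0 ≤ β * U := mul_nonneg hβ.le hU0
  have hΛE : 0 ≤ Λ * E := mul_nonneg hΛ.le hE0
  have hΛE' : 0 ≤ Λ * E' := mul_nonneg hΛ.le hE0'
  have c1 : A * M * (8 * α ^ 2 * E) ≤ 8 * (A * E) := by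
    have e1 : M * α * α ≤ 1 := by
      have := mul_le_mul hs.Mα hα1 hα.le zero_le_one
      linarith
    have := mul_le_mul_of_nonneg_right e1 hAE
    linarith
  have c2 : A * M * (2 * β ^ 2 * U) ≤ 1 / 8 * (β * U) := by
    have := mul_le_mul_of_nonneg_right hc.βMA hβU
    linarith
  have c3 : 2 * α * A * E ≤ 2 * (A * E) := by
    have := mul_le_mul_of_nonneg_right hα1 hAE
    linarith
  have c4 : Λ / 2 * (6 * β ^ 2 * U) ≤ 3 / 3200 * (β * U) := by
    have := mul_le_mul_of_nonneg_right hc.βΛ hβU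
    linarith
  have c5 : β * (4 * Λ ^ 2 * E) ≤ 4 / 3200 * (Λ * E) := by
    have := mul_le_mul_of_nonneg_right hc.βΛ hΛE
    linarith
  have c6 : β * (144 * A ^ 2 * E) ≤ 2 / 3200 * (Λ * E) := by
    have e1 : A ^ 2 ≤ Λ ^ 2 / 100 := by nlinarith
    have e4 := mul_le_mul_of_nonneg_left (mul_le_mul_of_nonneg_right e1 hE0) hβ.le
    have := mul_le_mul_of_nonneg_right hc.βΛ hΛE
    linarith
  have c7 : A * E ≤ Λ / 10 * E := by gcongr; linarith
  have c8 : A * E' ≤ Λ / 10 * E' := by gcongr; linarith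
  linarith

/-- Descent of the global cost along the centres. -/
theorem Trajectory.descent (h : Trajectory V α β A δ₁ δ₂ X Y F c) (hV : Mixing V s)
    (hs : StepSizes α β A M δ₁ δ₂) (hR : RetrBound n r M) (hφ : GoodCosts φ L A)
    (hc : CostSizes α β A M L Λ) (k : ℕ) :
    tot φ (c (k + 1)) ≤ tot φ (c k) - 13 / 16 * β * ‖rGrad (tot φ) (c k)‖ ^ 2
      + 4 * β * (msq fun i => F k i - rGrad (φ i) (X k i))
      + 126 / 1000 * β * msq (dir (X k) (Y k))
      + Λ * (msq fun i => X (k + 1) i - c (k + 1)) + 14 * Λ * msq fun i => X k i - c k := by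
  have hC := (h.isIAM k).1
  have h1 := h.inner_center_sub_le hV hs hR hφ hc k
  have h2 := h.norm_center_sub_sq_le hV hs hR k
  have h3 := (LSmooth.tot hV.pos hφ.smooth).le_add_rGrad hC (h.isIAM (k + 1)).1
    (norm_eGrad_tot_le hV.pos hφ.smooth fun i => hφ.bound i _ hC)
  have h4 : (L + A) / 2 * ‖c (k + 1) - c k‖ ^ 2 ≤ Λ / 2 * ‖c (k + 1) - c k‖ ^ 2 := by
    gcongr
    linarith [hc.L_le, hs.A_nonneg]
  have h5 := mul_le_mul_of_nonneg_left h2 (by linarith [hc.Λ_pos] : 0 ≤ Λ / 2)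
  have h6 := descent_arith (g := ‖rGrad (tot φ) (c k)‖)
    (w := rms fun i => F k i - rGrad (φ i) (X k i)) hs hc
    (msq_nonneg fun i => X k i - c k)
    (msq_nonneg fun i => X (k + 1) i - c (k + 1)) (msq_nonneg (dir (X k) (Y k)))
    (rms_sq fun i => X k i - c k)
  rw [rms_sq fun i => F k i - rGrad (φ i) (X k i)] at h6
  linarith

end Trajectory

/-! ### Summation of the recursions -/

section Sums

theorem sum_le_of_recursion {y z : ℕ → ℝ} {q : ℝ} (hq : 0 ≤ q) (hy : ∀ k, 0 ≤ y k)
    (h : ∀ k, y (k + 1) ≤ q * y k + z k) (n : ℕ) :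
    (1 - q) * ∑ k ∈ Finset.range (n + 1), y k ≤ y 0 + ∑ k ∈ Finset.range n, z k := by
  have h1 : ∑ k ∈ Finset.range (n + 1), y k ≤ y 0 + (q * ∑ k ∈ Finset.range n, y k
      + ∑ k ∈ Finset.range n, z k) := by
    rw [Finset.sum_range_succ', add_comm, Finset.mul_sum, ← Finset.sum_add_distrib]
    gcongr with k
    exact h k
  have h2 : q * ∑ k ∈ Finset.range n, y k ≤ q * ∑ k ∈ Finset.range (n + 1), y k := by
    rw [Finset.sum_range_succ]
    have := hy n
    gcongr
    linarith
  linarith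

/-- The linear system satisfied by the sums of the error quantities, solved. -/
theorem solve_sums {SE SU ST Sν SG e0 T0 F β Λ Γ : ℝ} (hβ : 0 < β) (hΛ : 0 < Λ) (hΓ : 0 < Γ)
    (hSU : 0 ≤ SU) (hSE : 0 ≤ SE) (hT0 : 0 ≤ T0) (hSν : 0 ≤ Sν)
    (he0 : 0 ≤ e0) (hF : 0 ≤ F)
    (hβΛ : 3200 * (β * Λ) ≤ 1) (hβΛΓ : 1600 * (β * Λ * Γ) ≤ 1)
    (h1 : SE ≤ e0 + 33 / 10 * (Γ * (β ^ 2 * SU)))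
    (h2 : ST ≤ T0 + 24 / 10 * (2 * Λ ^ 2 * (8 * SE + 2 * (β ^ 2 * SU)) + 8 * Sν))
    (h3 : SU ≤ 5 / 4 * SG + 10 * Λ ^ 2 * SE + 10 * Sν + ST)
    (h4 : 13 / 16 * β * SG ≤ F + 4 * β * Sν + 126 / 1000 * β * SU + 15 * Λ * SE) :
    SE ≤ e0 + Γ * β * (7 * F + 170 * (β * Sν) + 45 / 10 * (β * T0) + 120 * (Λ * e0)) ∧
    β * SG ≤ 5 / 3 * F + 15 * (β * Sν) + 3 / 10 * (β * T0) + 30 * (Λ * e0) := by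
  have hu : 0 ≤ β * SU := by positivity
  have hy : 0 ≤ Λ * SE := by positivity
  -- Here 33/16000 is 33/10 times the bound 1/1600 on βΛΓ: consensus errors feed back into the
  -- directions only weakly.
  have a1 : Λ * SE ≤ Λ * e0 + 33 / 16000 * (β * SU) := by
    have e1 := mul_le_mul_of_nonneg_left h1 hΛ.le
    have e2 := mul_le_mul_of_nonneg_right hβΛΓ hu
    linarith
  have a2 : β * (Λ ^ 2 * SE) ≤ Λ * SE / 3200 := by
    have := mul_le_mul_of_nonneg_right hβΛ hy
    linarith
  have a3 : β * (Λ ^ 2 * (β ^ 2 * SU)) ≤ β * SU / 3200 := by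
    have e0 : 0 ≤ β * Λ := by positivity
    have e1 : 3200 * ((β * Λ) * (β * Λ)) ≤ 1 := by nlinarith
    have := mul_le_mul_of_nonneg_right e1 hu
    linarith
  have a4 := mul_le_mul_of_nonneg_left h3 hβ.le
  have a5 := mul_le_mul_of_nonneg_left h2 hβ.le
  have p1 : 0 ≤ β * Sν := by positivity
  have p2 : 0 ≤ β * T0 := by positivity
  have p3 : 0 ≤ Λ * e0 := by positivity
  -- The system is linear and its loop gain is small, mainly 0.126 · 5/4 against 13/16, so G can be
  -- isolated; U then follows by back substitution.
  have b1 : β * SG ≤ 5 / 3 * F + 15 * (β * Sν) + 3 / 10 * (β * T0) + 30 * (Λ * e0) := by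
    linarith
  have b2 : β * SU ≤ 2115 / 1000 * F + 515 / 10 * (β * Sν) + 136 / 100 * (β * T0)
      + 36 * (Λ * e0) := by
    linarith
  refine ⟨h1.trans ?_, b1⟩
  have b3 := mul_le_mul_of_nonneg_left b2 (by positivity : 0 ≤ 33 / 10 * (Γ * β))
  have q0 : 0 ≤ Γ * β := by positivity
  have q1 := mul_nonneg q0 hF
  have q2 := mul_nonneg q0 p1
  have q3 := mul_nonneg q0 p2
  have q4 := mul_nonneg q0 p3
  linarith

variable {N n r : ℕ} {V : Matrix (Fin N) (Fin N) ℝ} {s α β A M L Λ Γ δ₁ δ₂ : ℝ}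
  {X Y F : ℕ → Fin N → Mat n r} {c : ℕ → Mat n r} {φ : Fin N → Mat n r → ℝ}

/-- The minimum is written as an infimum, which needs a lower bound. The descent inequality from an
arbitrary point to a fixed one gives it on the bounded manifold; if the manifold is empty nothing is
needed. -/
theorem bddBelow_tot (hN : 0 < N) (hφ : GoodCosts φ L A) :
    BddBelow (tot φ '' St n r) := by
  by_cases hne : (St n r).Nonempty
  · obtain ⟨Z, hZ⟩ := hne
    have hZn : ‖Z‖ ≤ √r := by
      rw [← norm_sq_of_mem_St hZ, Real.sqrt_sq (norm_nonneg _)]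
    refine ⟨tot φ Z - (A * (2 * √r) + |L + A| / 2 * (2 * √r) ^ 2), ?_⟩
    rintro _ ⟨W, hW, rfl⟩
    have h1 := (LSmooth.tot hN hφ.smooth).le_add_rGrad hW hZ
      (norm_eGrad_tot_le hN hφ.smooth fun i => hφ.bound i W hW)
    have hWn : ‖W‖ ≤ √r := by
      rw [← norm_sq_of_mem_St hW, Real.sqrt_sq (norm_nonneg _)]
    have h2 : ‖Z - W‖ ≤ 2 * √r := by linarith [norm_sub_le Z W]
    have h3 : ‖rGrad (tot φ) W‖ ≤ A :=
      (norm_projT_le hW _).trans (norm_eGrad_tot_le hN hφ.smooth fun i => hφ.bound i W hW)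
    have h4 := real_inner_le_norm (rGrad (tot φ) W) (Z - W)
    have h5 : ‖rGrad (tot φ) W‖ * ‖Z - W‖ ≤ A * (2 * √r) :=
      mul_le_mul h3 h2 (norm_nonneg _) ((norm_nonneg _).trans h3)
    have h6 : (L + A) / 2 * ‖Z - W‖ ^ 2 ≤ |L + A| / 2 * (2 * √r) ^ 2 := by
      gcongr
      exact le_abs_self _
    linarith
  · rw [Set.not_nonempty_iff_eq_empty] at hne
    simp [hne]

theorem sInf_tot_le (hN : 0 < N) (hφ : GoodCosts φ L A) {Z : Mat n r} (hZ : Z ∈ St n r) :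
    sInf (tot φ '' St n r) ≤ tot φ Z :=
  csInf_le (bddBelow_tot hN hφ) ⟨Z, hZ, rfl⟩

/-- With x = 11α/20 the quotient of the two coefficients is 4(4 - x)/(3x²(5 - x)) ≤ 16/(15x²), and
the bound on Γα² makes this at most 33Γ/10. -/
theorem consensus_coeff_le {α Γ U : ℝ} (hα : 0 < α) (hα1 : α ≤ 1) (hΓ : 109 / 100 ≤ Γ * α ^ 2)
    (hU : 0 ≤ U) :
    (4 - 11 / 20 * α) / (3 * (11 / 20 * α)) * U
      ≤ (1 - (1 - 11 / 20 * α) * (1 - 11 / 20 * α / 4)) * (33 / 10 * (Γ * U)) := by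
  set x := 11 / 20 * α with hx
  have hx0 : 0 < x := by positivity
  have hx1 : x ≤ 1 := by linarith
  have h1 : 16 / 15 ≤ 33 / 10 * (Γ * x ^ 2) := by
    rw [hx]; nlinarith
  have h2 : (4 - x) / (3 * x) ≤ (1 - (1 - x) * (1 - x / 4)) * (33 / 10 * Γ) := by
    rw [div_le_iff₀ (by positivity)]
    have e1 : (1 - (1 - x) * (1 - x / 4)) * (33 / 10 * Γ) * (3 * x)
        = 3 * (5 - x) / 4 * (33 / 10 * (Γ * x ^ 2)) := by ring
    rw [e1]
    have e2 := mul_le_mul_of_nonneg_left h1 (by linarith : 0 ≤ 3 * (5 - x) / 4)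
    linarith
  have := mul_le_mul_of_nonneg_right h2 hU
  linarith

/-- Summation of the coupled recursions for consensus error `E`, tracking error `T`, directions `U`,
noise `ν`, gradients `G`, increments `W` and costs `f`. -/
theorem sums_le_of_recursions {E T U ν G W f : ℕ → ℝ} {e0 fs : ℝ}
    (hs : StepSizes α β A M δ₁ δ₂) (hc : CostSizes α β A M L Λ) (hΓ : 109 / 100 ≤ Γ * α ^ 2)
    (hβΛΓ : 1600 * (β * Λ * Γ) ≤ 1) (hs0 : 0 ≤ s) (hs1 : s ≤ 354 / 1000)
    (hE0 : ∀ k, 0 ≤ E k) (hT0 : ∀ k, 0 ≤ T k) (hU0 : ∀ k, 0 ≤ U k) (hν0 : ∀ k, 0 ≤ ν k)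
    (hW0 : ∀ k, 0 ≤ W k) (hlow : ∀ k, fs ≤ f k)
    (he0 : E 0 = (1 - (1 - 11 / 20 * α) * (1 - 11 / 20 * α / 4)) * e0)
    (rec_E : ∀ k, E (k + 1) ≤ (1 - 11 / 20 * α) * (1 - 11 / 20 * α / 4) * E k
      + (4 - 11 / 20 * α) / (3 * (11 / 20 * α)) * (β ^ 2 * U k))
    (rec_T : ∀ k, T (k + 1) ≤ s * T k + 1 / (1 - s) * W k)
    (bd_W : ∀ k, W k ≤ 2 * Λ ^ 2 * (8 * α ^ 2 * E k + 2 * β ^ 2 * U k) + 4 * ν k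
      + 4 * ν (k + 1))
    (bd_U : ∀ k, U k ≤ 5 / 4 * G k + 10 * Λ ^ 2 * E k + 10 * ν k + T k)
    (desc : ∀ k, f (k + 1) ≤ f k - 13 / 16 * β * G k + 4 * β * ν k + 126 / 1000 * β * U k
      + Λ * E (k + 1) + 14 * Λ * E k) (K : ℕ) :
    ∑ k ∈ Finset.range (K + 1), E k
      ≤ e0 + Γ * β * (7 * (f 0 - fs) + 170 * (β * ∑ k ∈ Finset.range (K + 1), ν k)
        + 45 / 10 * (β * (T 0 / (1 - s))) + 120 * (Λ * e0)) ∧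
    β * ∑ k ∈ Finset.range (K + 1), G k
      ≤ 5 / 3 * (f 0 - fs) + 15 * (β * ∑ k ∈ Finset.range (K + 1), ν k)
        + 3 / 10 * (β * (T 0 / (1 - s))) + 30 * (Λ * e0) := by
  have hα := hs.α_pos
  have hα1 := hs.α_le
  have hβ := hs.β_pos
  have hΛ := hc.Λ_pos
  have hΓ0 : 0 < Γ := by
    by_contra hneg
    have := mul_nonpos_of_nonpos_of_nonneg (not_lt.1 hneg) (sq_nonneg α)
    linarith
  set κ := 1 - (1 - 11 / 20 * α) * (1 - 11 / 20 * α / 4) with hκ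
  have hκ0 : 0 < κ := by rw [hκ]; nlinarith
  have hSE : ∀ k, 0 ≤ ∑ j ∈ Finset.range k, E j := fun k => Finset.sum_nonneg fun j _ => hE0 j
  have hSU : 0 ≤ ∑ j ∈ Finset.range (K + 1), U j := Finset.sum_nonneg fun j _ => hU0 j
  have hSν : 0 ≤ ∑ j ∈ Finset.range (K + 1), ν j := Finset.sum_nonneg fun j _ => hν0 j
  have he00 : 0 ≤ e0 := by
    have := hE0 0
    rw [he0] at this
    exact nonneg_of_mul_nonneg_right this hκ0
  -- E is summed one index further than the rest, because the descent inequality at index K involves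
  -- E at K + 1.
  have hSE_le : ∑ j ∈ Finset.range (K + 1), E j ≤ ∑ j ∈ Finset.range (K + 2), E j := by
    rw [Finset.sum_range_succ _ (K + 1)]
    linarith [hE0 (K + 1)]
  have h1 : ∑ j ∈ Finset.range (K + 2), E j
      ≤ e0 + 33 / 10 * (Γ * (β ^ 2 * ∑ j ∈ Finset.range (K + 1), U j)) := by
    have e1 := sum_le_of_recursion (y := E) (by nlinarith) hE0 rec_E (K + 1)
    rw [← Finset.mul_sum, ← Finset.mul_sum] at e1
    have e2 := consensus_coeff_le hα hα1 hΓ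
      (mul_nonneg (sq_nonneg β) hSU)
    have e3 : κ * ∑ j ∈ Finset.range (K + 2), E j
        ≤ κ * (e0 + 33 / 10 * (Γ * (β ^ 2 * ∑ j ∈ Finset.range (K + 1), U j))) := by
      rw [mul_add]
      rw [← hκ] at e1 e2
      have e4 : E 0 = κ * e0 := he0
      linarith
    exact le_of_mul_le_mul_left e3 hκ0
  have h2 : ∑ j ∈ Finset.range (K + 1), T j ≤ T 0 / (1 - s)
      + 24 / 10 * (2 * Λ ^ 2 * (8 * ∑ j ∈ Finset.range (K + 2), E j
        + 2 * (β ^ 2 * ∑ j ∈ Finset.range (K + 1), U j))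
        + 8 * ∑ j ∈ Finset.range (K + 1), ν j) := by
    have e1 := sum_le_of_recursion (y := T) hs0 hT0 rec_T K
    rw [← Finset.mul_sum] at e1
    have e2 : ∑ k ∈ Finset.range K, W k ≤ 2 * Λ ^ 2 * (8 * ∑ j ∈ Finset.range (K + 2), E j
        + 2 * (β ^ 2 * ∑ j ∈ Finset.range (K + 1), U j))
        + 8 * ∑ j ∈ Finset.range (K + 1), ν j := by
      have f1 : ∑ k ∈ Finset.range K, W k ≤ ∑ k ∈ Finset.range K,
          (2 * Λ ^ 2 * (8 * E k + 2 * (β ^ 2 * U k)) + 4 * ν k + 4 * ν (k + 1)) := by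
        refine Finset.sum_le_sum fun k _ => (bd_W k).trans ?_
        have g1 : α ^ 2 * E k ≤ E k := by
          have : α ^ 2 ≤ 1 := by nlinarith
          nlinarith [hE0 k]
        have g2 := mul_le_mul_of_nonneg_left g1 (sq_nonneg Λ)
        linarith
      have f2 : ∑ k ∈ Finset.range K, E k ≤ ∑ j ∈ Finset.range (K + 2), E j := by
        refine le_trans ?_ hSE_le
        rw [Finset.sum_range_succ]
        linarith [hE0 K]
      have f3 : ∑ k ∈ Finset.range K, U k ≤ ∑ j ∈ Finset.range (K + 1), U j := by
        rw [Finset.sum_range_succ]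
        linarith [hU0 K]
      have f4 : ∑ k ∈ Finset.range K, ν k ≤ ∑ j ∈ Finset.range (K + 1), ν j := by
        rw [Finset.sum_range_succ]
        linarith [hν0 K]
      -- Tracking errors up to index K involve increments up to K - 1 only, so the shifted noise
      -- still ends at K.
      have f5 : ∑ k ∈ Finset.range K, ν (k + 1) ≤ ∑ j ∈ Finset.range (K + 1), ν j := by
        rw [Finset.sum_range_succ']
        linarith [hν0 0]
      refine f1.trans ?_
      simp only [Finset.sum_add_distrib, ← Finset.mul_sum]
      have f6 : 2 * Λ ^ 2 * (8 * ∑ k ∈ Finset.range K, E k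
          + 2 * (β ^ 2 * ∑ k ∈ Finset.range K, U k))
          ≤ 2 * Λ ^ 2 * (8 * ∑ j ∈ Finset.range (K + 2), E j
          + 2 * (β ^ 2 * ∑ j ∈ Finset.range (K + 1), U j)) := by gcongr
      linarith
    have hs2 : 0 < 1 - s := by linarith
    -- One factor 1/(1 - s) comes from Young's inequality and one from summing the recursion;
    -- 1/0.646² < 2.4.
    have e3 : (1 / (1 - s)) ^ 2 ≤ 24 / 10 := by
      rw [div_pow, one_pow, div_le_iff₀ (by positivity)]
      nlinarith
    have e4 : 0 ≤ ∑ k ∈ Finset.range K, W k := Finset.sum_nonneg fun k _ => hW0 k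
    have e5 : ∑ j ∈ Finset.range (K + 1), T j
        ≤ T 0 / (1 - s) + (1 / (1 - s)) ^ 2 * ∑ k ∈ Finset.range K, W k := by
      have := (le_div_iff₀' hs2).2 e1
      refine this.trans_eq ?_
      field_simp
    refine e5.trans ?_
    have e6 := mul_le_mul_of_nonneg_right e3 e4
    have e7 := mul_le_mul_of_nonneg_left e2 (by norm_num : (0 : ℝ) ≤ 24 / 10)
    linarith
  have h3 : ∑ j ∈ Finset.range (K + 1), U j ≤ 5 / 4 * ∑ j ∈ Finset.range (K + 1), G j
      + 10 * Λ ^ 2 * ∑ j ∈ Finset.range (K + 2), E j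
      + 10 * ∑ j ∈ Finset.range (K + 1), ν j + ∑ j ∈ Finset.range (K + 1), T j := by
    have e1 := Finset.sum_le_sum fun k (_ : k ∈ Finset.range (K + 1)) => bd_U k
    simp only [Finset.sum_add_distrib, ← Finset.mul_sum] at e1
    have e2 := mul_le_mul_of_nonneg_left hSE_le (by positivity : 0 ≤ 10 * Λ ^ 2)
    linarith
  have h4 : 13 / 16 * β * ∑ j ∈ Finset.range (K + 1), G j ≤ (f 0 - fs)
      + 4 * β * ∑ j ∈ Finset.range (K + 1), ν j
      + 126 / 1000 * β * ∑ j ∈ Finset.range (K + 1), U j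
      + 15 * Λ * ∑ j ∈ Finset.range (K + 2), E j := by
    have e0 : ∀ k ∈ Finset.range (K + 1), 13 / 16 * β * G k ≤ (f k - f (k + 1))
        + 4 * β * ν k + 126 / 1000 * β * U k + Λ * E (k + 1) + 14 * Λ * E k := fun k _ => by
      have := desc k
      linarith
    have e1 := Finset.sum_le_sum e0
    simp only [Finset.sum_add_distrib, ← Finset.mul_sum] at e1
    rw [Finset.sum_range_sub' f] at e1
    have e2 : ∑ k ∈ Finset.range (K + 1), E (k + 1) ≤ ∑ j ∈ Finset.range (K + 2), E j := by
      rw [Finset.sum_range_succ' _ (K + 1)]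
      linarith [hE0 0]
    have e3 := mul_le_mul_of_nonneg_left e2 hΛ.le
    have e4 := mul_le_mul_of_nonneg_left hSE_le hΛ.le
    have e5 := hlow (K + 1)
    linarith
  have hT00 : 0 ≤ T 0 / (1 - s) := div_nonneg (hT0 0) (by linarith)
  have hF0 : 0 ≤ f 0 - fs := by linarith [hlow 0]
  obtain ⟨r1, r2⟩ := solve_sums hβ hΛ hΓ0 hSU (hSE _) hT00 hSν he00 hF0 hc.βΛ hβΛΓ h1 h2 h3 h4
  exact ⟨hSE_le.trans r1, r2⟩

/-- The pathwise convergence estimates. -/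
theorem Trajectory.sums_le (h : Trajectory V α β A δ₁ δ₂ X Y F c) (hV : Mixing V s)
    (hs : StepSizes α β A M δ₁ δ₂) (hR : RetrBound n r M) (hφ : GoodCosts φ L A)
    (hc : CostSizes α β A M L Λ) (hΓ : 109 / 100 ≤ Γ * α ^ 2)
    (hβΛΓ : 1600 * (β * Λ * Γ) ≤ 1) {e0 : ℝ}
    (he0 : (msq fun i => X 0 i - c 0)
      = (1 - (1 - 11 / 20 * α) * (1 - 11 / 20 * α / 4)) * e0) (K : ℕ) :
    ∑ k ∈ Finset.range (K + 1), (msq fun i => X k i - c k)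
      ≤ e0 + Γ * β * (7 * (tot φ (c 0) - sInf (tot φ '' St n r))
        + 170 * (β * ∑ k ∈ Finset.range (K + 1), msq fun i => F k i - rGrad (φ i) (X k i))
        + 45 / 10 * (β * ((msq fun i => Y 0 i - avg (F 0)) / (1 - s))) + 120 * (Λ * e0)) ∧
    β * ∑ k ∈ Finset.range (K + 1), ‖rGrad (tot φ) (c k)‖ ^ 2
      ≤ 5 / 3 * (tot φ (c 0) - sInf (tot φ '' St n r))
        + 15 * (β * ∑ k ∈ Finset.range (K + 1), msq fun i => F k i - rGrad (φ i) (X k i))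
        + 3 / 10 * (β * ((msq fun i => Y 0 i - avg (F 0)) / (1 - s))) + 30 * (Λ * e0) :=
  sums_le_of_recursions (E := fun k => msq fun i => X k i - c k)
    (T := fun k => msq fun i => Y k i - avg (F k)) (U := fun k => msq (dir (X k) (Y k)))
    (ν := fun k => msq fun i => F k i - rGrad (φ i) (X k i))
    (G := fun k => ‖rGrad (tot φ) (c k)‖ ^ 2) (W := fun k => msq (F (k + 1) - F k))
    (f := fun k => tot φ (c k)) hs hc hΓ hβΛΓ hV.s_nonneg hV.s_le_const
    (fun _ => msq_nonneg _) (fun _ => msq_nonneg _) (fun _ => msq_nonneg _)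
    (fun _ => msq_nonneg _) (fun _ => msq_nonneg _)
    (fun k => sInf_tot_le hV.pos hφ (h.isIAM k).1) he0
    (h.consensus_succ_le hV hs hR) (h.tracking_succ_le hV) (h.msq_F_sub_le hV hφ hc)
    (h.msq_dir_le hV hφ hc) (h.descent hV hs hR hφ hc) K

end Sums

/-! ### The communication network -/

section Network

variable {N : ℕ} {W : Matrix (Fin N) (Fin N) ℝ} {G : SimpleGraph (Fin N)}

/-- `W` is a symmetric doubly stochastic matrix with positive diagonal, positive on the edges of
the connected graph `G`. -/
structure Gossip (G : SimpleGraph (Fin N)) (W : Matrix (Fin N) (Fin N) ℝ) : Prop where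
  connected : G.Connected
  pos : ∀ i j, (i = j ∨ G.Adj i j) → 0 < W i j
  nonneg : ∀ i j, 0 ≤ W i j
  symm : Wᵀ = W
  rowSum : ∀ i, ∑ j, W i j = 1

theorem Gossip.symm_apply (h : Gossip G W) (i j : Fin N) : W i j = W j i := by
  conv_lhs => rw [← h.symm]
  rfl

theorem Gossip.colSum (h : Gossip G W) (j : Fin N) : ∑ i, W i j = 1 := by
  rw [← h.rowSum j]
  exact Finset.sum_congr rfl fun i _ => h.symm_apply i j

theorem Gossip.sum_mulVec (h : Gossip G W) (x : Fin N → ℝ) : ∑ i, (W *ᵥ x) i = ∑ i, x i := by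
  simp only [Matrix.mulVec, dotProduct]
  rw [Finset.sum_comm]
  refine Finset.sum_congr rfl fun j _ => ?_
  rw [← Finset.sum_mul, h.colSum, one_mul]

/-- The energy lost by one averaging step. -/
theorem Gossip.energy (h : Gossip G W) (x : Fin N → ℝ) :
    ∑ i, x i ^ 2 - ∑ i, (W *ᵥ x) i ^ 2
      = 1 / 2 * ∑ i, ∑ j, ∑ l, W i j * W i l * (x j - x l) ^ 2 := by
  have h1 : ∑ i, x i ^ 2 = ∑ i, ∑ j, W i j * x j ^ 2 := by
    rw [Finset.sum_comm]
    refine Finset.sum_congr rfl fun j _ => ?_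
    rw [← Finset.sum_mul, h.colSum, one_mul]
  rw [h1, ← Finset.sum_sub_distrib, Finset.mul_sum]
  refine Finset.sum_congr rfl fun i _ => ?_
  have h2 : ∑ j, ∑ l, W i j * W i l * (x j - x l) ^ 2
      = ∑ j, ∑ l, (W i j * x j ^ 2 * W i l + W i j * (W i l * x l ^ 2)
        - 2 * (W i j * x j * (W i l * x l))) :=
    Finset.sum_congr rfl fun j _ => Finset.sum_congr rfl fun l _ => by ring
  rw [h2]
  simp only [Finset.sum_sub_distrib, Finset.sum_add_distrib, ← Finset.mul_sum, ← Finset.sum_mul,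
    h.rowSum, Matrix.mulVec, dotProduct]
  ring

theorem Gossip.energy_nonneg (h : Gossip G W) (x : Fin N → ℝ) (i j l : Fin N) :
    0 ≤ W i j * W i l * (x j - x l) ^ 2 :=
  mul_nonneg (mul_nonneg (h.nonneg _ _) (h.nonneg _ _)) (sq_nonneg _)

theorem Gossip.sum_sq_mulVec_le (h : Gossip G W) (x : Fin N → ℝ) :
    ∑ i, (W *ᵥ x) i ^ 2 ≤ ∑ i, x i ^ 2 := by
  have h1 := h.energy x
  have h2 : 0 ≤ ∑ i, ∑ j, ∑ l, W i j * W i l * (x j - x l) ^ 2 :=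
    Finset.sum_nonneg fun i _ => Finset.sum_nonneg fun j _ => Finset.sum_nonneg fun l _ =>
      h.energy_nonneg x i j l
  linarith

/-- If no energy is lost, each term of the energy identity vanishes. The term (i, i, j) has positive
weight along an edge because the diagonal of W is positive, and connectedness propagates the
equality. -/
theorem Gossip.eq_of_sum_sq_eq (h : Gossip G W) {x : Fin N → ℝ}
    (hx : ∑ i, (W *ᵥ x) i ^ 2 = ∑ i, x i ^ 2) (i j : Fin N) : x i = x j := by
  have hadj : ∀ i j, G.Adj i j → x i = x j := fun i j hij => by
    have h1 := h.energy x
    rw [hx, sub_self] at h1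
    have h2 : ∑ i, ∑ j, ∑ l, W i j * W i l * (x j - x l) ^ 2 = 0 := by linarith
    rw [Finset.sum_eq_zero_iff_of_nonneg fun i _ => Finset.sum_nonneg fun j _ =>
      Finset.sum_nonneg fun l _ => h.energy_nonneg x i j l] at h2
    have h3 := h2 i (Finset.mem_univ i)
    rw [Finset.sum_eq_zero_iff_of_nonneg fun j _ =>
      Finset.sum_nonneg fun l _ => h.energy_nonneg x i j l] at h3
    have h4 := h3 i (Finset.mem_univ i)
    rw [Finset.sum_eq_zero_iff_of_nonneg fun l _ => h.energy_nonneg x i i l] at h4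
    have h5 := h4 j (Finset.mem_univ j)
    have h6 : 0 < W i i * W i j := mul_pos (h.pos i i (Or.inl rfl)) (h.pos i j (Or.inr hij))
    have h7 := (mul_eq_zero.1 h5).resolve_left h6.ne'
    exact sub_eq_zero.1 (pow_eq_zero_iff two_ne_zero |>.1 h7)
  obtain ⟨w⟩ := h.connected.preconnected i j
  induction w with
  | nil => rfl
  | cons hij _ ih => exact (hadj _ _ hij).trans ih

theorem euclidean_norm_sq (x : EuclideanSpace ℝ (Fin N)) : ‖x‖ ^ 2 = ∑ i, x i ^ 2 := by
  rw [EuclideanSpace.norm_sq_eq]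
  simp

/-- The second largest singular value is less than one and contracts mean zero vectors. -/
theorem Gossip.singularValue (h : Gossip G W) (hN : 2 ≤ N) :
    (Matrix.toEuclideanLin W).singularValues 1 < 1 ∧
    ∀ x : Fin N → ℝ, ∑ i, x i = 0 → ∑ i, (W *ᵥ x) i ^ 2
      ≤ (Matrix.toEuclideanLin W).singularValues 1 ^ 2 * ∑ i, x i ^ 2 := by
  set T := Matrix.toEuclideanLin W with hT
  have hn : Module.finrank ℝ (EuclideanSpace ℝ (Fin N)) = N := by simp
  have hTx : ∀ x : EuclideanSpace ℝ (Fin N), ‖T x‖ ^ 2 = ∑ i, (W *ᵥ x.ofLp) i ^ 2 := fun x => by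
    rw [euclidean_norm_sq]; rfl
  have hTadj : LinearMap.adjoint T = T := by
    rw [hT, ← Matrix.toEuclideanLin_conjTranspose_eq_adjoint,
      Matrix.conjTranspose_eq_transpose_of_trivial, h.symm]
  have hSy := T.isSymmetric_adjoint_comp_self
  -- The squared singular values of T are the eigenvalues of S in decreasing order, so index 1
  -- denotes the second largest.
  set S := LinearMap.adjoint T ∘ₗ T with hS
  set b := hSy.eigenvectorBasis hn with hb
  set d := hSy.eigenvalues hn with hd
  have hSb : ∀ i, S (b i) = d i • b i := fun i => hSy.apply_eigenvectorBasis hn i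
  have hTS : ∀ x, ‖T x‖ ^ 2 = inner ℝ (S x) x := fun x => by
    rw [hS, LinearMap.comp_apply, LinearMap.adjoint_inner_left, real_inner_self_eq_norm_sq]
  have hexp : ∀ x, ‖T x‖ ^ 2 = ∑ i, d i * inner ℝ (b i) x ^ 2 := fun x => by
    rw [hTS, ← b.sum_inner_mul_inner]
    refine Finset.sum_congr rfl fun i _ => ?_
    rw [hSy x (b i), hSb, inner_smul_right, real_inner_comm x (b i)]
    ring
  have hle : ∀ x, ‖T x‖ ^ 2 ≤ ‖x‖ ^ 2 := fun x => by
    rw [hTx, euclidean_norm_sq]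
    exact h.sum_sq_mulVec_le _
  have hd1 : ∀ i, d i ≤ 1 := fun i => by
    have h1 := hle (b i)
    rw [hTS, hSb, inner_smul_left, real_inner_self_eq_norm_sq, b.orthonormal.1 i] at h1
    simpa using h1
  set o : EuclideanSpace ℝ (Fin N) := WithLp.toLp 2 fun _ => 1 with ho
  have hinner : ∀ x : EuclideanSpace ℝ (Fin N), inner ℝ o x = ∑ i, x i := fun x => by
    simp [ho, PiLp.inner_apply]
  have hTo : T o = o := by
    ext i
    have : (W *ᵥ fun _ => (1 : ℝ)) i = 1 := by simp [Matrix.mulVec, dotProduct, h.rowSum]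
    exact this
  have hSo : S o = o := by rw [hS, LinearMap.comp_apply, hTo, hTadj, hTo]
  have ho0 : o ≠ 0 := fun h0 => by
    have h1 : o ⟨0, by omega⟩ = 1 := rfl
    rw [h0] at h1
    simp at h1
  have hσ : T.singularValues 1 ^ 2 = d ⟨1, by omega⟩ := T.sq_singularValues_of_lt hn _
  have hσ0 := T.singularValues_nonneg 1
  -- Otherwise the eigenvalue 1 of S would be at least double, and its eigenspace would contain a
  -- nonzero vector orthogonal to the constants. Such a vector loses no energy, so it is constant,
  -- hence zero.
  have hlt : T.singularValues 1 < 1 := by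
    by_contra hge
    have hge' : 1 ≤ d ⟨1, by omega⟩ := by rw [← hσ]; nlinarith
    have hd0 : d ⟨0, by omega⟩ = 1 := le_antisymm (hd1 _)
      (hge'.trans (hSy.eigenvalues_antitone hn (by simp)))
    have hd1' : d ⟨1, by omega⟩ = 1 := le_antisymm (hd1 _) hge'
    set b0 := b ⟨0, by omega⟩ with hb0
    set b1 := b ⟨1, by omega⟩ with hb1
    have hSb0 : S b0 = b0 := by rw [hb0, hSb, hd0, one_smul]
    have hSb1 : S b1 = b1 := by rw [hb1, hSb, hd1', one_smul]
    have h01 : inner ℝ b0 b1 = 0 := b.orthonormal.2 (by simp)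
    have hn0 : ‖b0‖ = 1 := b.orthonormal.1 _
    have hn1 : ‖b1‖ = 1 := b.orthonormal.1 _
    have hex : ∃ x : EuclideanSpace ℝ (Fin N), x ≠ 0 ∧ S x = x ∧ inner ℝ o x = 0 := by
      by_cases hz : inner ℝ o b0 = 0
      · exact ⟨b0, fun h0 => by simp [h0] at hn0, hSb0, hz⟩
      · refine ⟨inner ℝ o b1 • b0 - inner ℝ o b0 • b1, fun h0 => ?_, ?_, ?_⟩
        · have := congrArg (fun y => inner ℝ y b1) h0
          simp only [inner_sub_left, inner_smul_left, h01, inner_zero_left,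
            real_inner_self_eq_norm_sq, hn1] at this
          simp at this
          exact hz this
        · rw [map_sub, map_smul, map_smul, hSb0, hSb1]
        · rw [inner_sub_right, inner_smul_right, inner_smul_right]; ring
    obtain ⟨x, hx0, hSx, hox⟩ := hex
    have h1 : ‖T x‖ ^ 2 = ‖x‖ ^ 2 := by rw [hTS, hSx, real_inner_self_eq_norm_sq]
    rw [hTx, euclidean_norm_sq] at h1
    have h2 := h.eq_of_sum_sq_eq h1
    rw [hinner] at hox
    apply hx0
    ext i
    have h3 : ∑ j, x j = N * x i := by
      rw [Finset.sum_congr rfl fun j _ => h2 j i]; simp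
    rw [h3] at hox
    exact (mul_eq_zero.1 hox).resolve_left (by positivity)
  refine ⟨hlt, fun x hx => ?_⟩
  have hlt' : d ⟨1, by omega⟩ < 1 := by rw [← hσ]; nlinarith
  have hdle : ∀ i : Fin N, i ≠ ⟨0, by omega⟩ → d i ≤ d ⟨1, by omega⟩ := fun i hi =>
    hSy.eigenvalues_antitone hn (by
      rw [Fin.le_def]
      have : i.val ≠ 0 := fun h0 => hi (Fin.ext h0)
      simp only
      omega)
  -- Eigenvectors with eigenvalue below 1 are orthogonal to the fixed vector o. Hence o is parallel
  -- to the first basis vector, and mean zero vectors have no component along it.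
  have hbo : ∀ i : Fin N, i ≠ ⟨0, by omega⟩ → inner ℝ (b i) o = 0 := fun i hi => by
    have h1 := hSy (b i) o
    rw [hSo, hSb, inner_smul_left] at h1
    simp only [conj_trivial] at h1
    have h2 := hdle i hi
    have h3 : (1 - d i) * inner ℝ (b i) o = 0 := by linarith
    exact (mul_eq_zero.1 h3).resolve_left (by linarith)
  set y : EuclideanSpace ℝ (Fin N) := WithLp.toLp 2 x with hy
  have hoy : inner ℝ o y = 0 := by rw [hinner]; exact hx
  have hb0y : inner ℝ (b ⟨0, by omega⟩) y = 0 := by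
    rw [← b.sum_inner_mul_inner, Finset.sum_eq_single ⟨0, by omega⟩
      (fun i _ hi => by rw [real_inner_comm, hbo i hi, zero_mul])
      (fun hne => absurd (Finset.mem_univ _) hne)] at hoy
    refine (mul_eq_zero.1 hoy).resolve_left fun h0 => ho0 ?_
    have h1 : ‖o‖ ^ 2 = 0 := by
      rw [← real_inner_self_eq_norm_sq, ← b.sum_inner_mul_inner]
      refine Finset.sum_eq_zero fun i _ => ?_
      by_cases hi : i = ⟨0, by omega⟩
      · rw [hi, h0, zero_mul]
      · rw [hbo i hi, mul_zero]
    exact norm_eq_zero.1 (pow_eq_zero_iff two_ne_zero |>.1 h1)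
  have h1 : ‖T y‖ ^ 2 ≤ d ⟨1, by omega⟩ * ‖y‖ ^ 2 := by
    rw [hexp, ← real_inner_self_eq_norm_sq, ← b.sum_inner_mul_inner, Finset.mul_sum]
    refine Finset.sum_le_sum fun i _ => ?_
    rw [real_inner_comm (b i) y, ← sq]
    by_cases hi : i = ⟨0, by omega⟩
    · rw [hi, hb0y]; simp
    · exact mul_le_mul_of_nonneg_right (hdle i hi) (sq_nonneg _)
  rw [hTx, euclidean_norm_sq, ← hσ] at h1
  exact h1

theorem Gossip.pow_nonneg (h : Gossip G W) (t : ℕ) (i j : Fin N) : 0 ≤ (W ^ t) i j := by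
  induction t generalizing i j with
  | zero =>
    rw [pow_zero, Matrix.one_apply]
    split_ifs <;> norm_num
  | succ t ih =>
    rw [pow_succ, Matrix.mul_apply]
    exact Finset.sum_nonneg fun l _ => mul_nonneg (ih i l) (h.nonneg l j)

theorem Gossip.pow_symm (h : Gossip G W) (t : ℕ) (i j : Fin N) : (W ^ t) i j = (W ^ t) j i := by
  conv_lhs => rw [← h.symm, ← Matrix.transpose_pow]
  rfl

theorem Gossip.pow_rowSum (h : Gossip G W) (t : ℕ) (i : Fin N) : ∑ j, (W ^ t) i j = 1 := by
  induction t generalizing i with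
  | zero => simp [Matrix.one_apply]
  | succ t ih =>
    rw [pow_succ']
    simp only [Matrix.mul_apply]
    rw [Finset.sum_comm]
    simp only [← Finset.mul_sum, ih, mul_one, h.rowSum]

theorem Gossip.pow_contract (h : Gossip G W) {σ : ℝ}
    (hc : ∀ x : Fin N → ℝ, ∑ i, x i = 0 → ∑ i, (W *ᵥ x) i ^ 2 ≤ σ ^ 2 * ∑ i, x i ^ 2) (t : ℕ)
    (x : Fin N → ℝ) (hx : ∑ i, x i = 0) :
    ∑ i, ((W ^ t) *ᵥ x) i ^ 2 ≤ (σ ^ t) ^ 2 * ∑ i, x i ^ 2 := by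
  induction t generalizing x with
  | zero => simp
  | succ t ih =>
    rw [pow_succ, ← Matrix.mulVec_mulVec]
    have h1 := ih (W *ᵥ x) (by rw [h.sum_mulVec, hx])
    have h2 := mul_le_mul_of_nonneg_left (hc x hx) (sq_nonneg (σ ^ t))
    calc _ ≤ _ := h1
      _ ≤ _ := h2
      _ = _ := by ring

theorem Gossip.mixing_pow (h : Gossip G W) (hN : 2 ≤ N) {t : ℕ} (ht : 1 ≤ t)
    (hlog : Real.logb ((Matrix.toEuclideanLin W).singularValues 1) (1 / (2 * √N)) ≤ t) :
    Mixing (W ^ t) ((Matrix.toEuclideanLin W).singularValues 1 ^ t) := by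
  obtain ⟨h1, h2⟩ := h.singularValue hN
  have h0 := (Matrix.toEuclideanLin W).singularValues_nonneg 1
  set σ := (Matrix.toEuclideanLin W).singularValues 1
  have hNpos : (0 : ℝ) < √N := Real.sqrt_pos.2 (by exact_mod_cast lt_of_lt_of_le two_pos hN)
  refine ⟨hN, h.pow_nonneg t, h.pow_symm t, h.pow_rowSum t, _root_.pow_nonneg h0 t, ?_,
    fun x hx => h.pow_contract h2 t x hx⟩
  -- If σ₂ = 0 the logarithmic condition says nothing, but t ≥ 1 makes the power vanish. Otherwise
  -- the base is below one, which reverses the inequality.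
  rcases h0.eq_or_lt with hz | hpos
  · rw [← hz, zero_pow (by omega)]
    positivity
  · have h3 := (Real.logb_le_iff_le_rpow_of_base_lt_one hpos h1 (by positivity)).1 hlog
    rwa [Real.rpow_natCast] at h3

/-- An eigenvector for an eigenvalue other than 1 has mean zero, since mixing preserves the mean;
the contraction then bounds the eigenvalue. This gives L_t ≤ 1 + s. -/
theorem Mixing.neg_le_of_mem_spectrum {V : Matrix (Fin N) (Fin N) ℝ} {s : ℝ} (hV : Mixing V s)
    {l : ℝ} (hl : l ∈ spectrum ℝ V) : -s ≤ l := by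
  rw [spectrum.mem_iff, Matrix.isUnit_iff_isUnit_det, isUnit_iff_ne_zero, not_not,
    ← Matrix.exists_mulVec_eq_zero_iff] at hl
  obtain ⟨x, hx0, hx⟩ := hl
  rw [Matrix.sub_mulVec, sub_eq_zero, Algebra.algebraMap_eq_smul_one, Matrix.smul_mulVec,
    Matrix.one_mulVec] at hx
  have hxi : ∀ i, ∑ j, V i j * x j = l * x i := fun i => (congrFun hx i).symm
  have hs0 := hV.s_nonneg
  by_cases hl1 : l = 1
  · linarith
  have hsum : ∑ i, x i = 0 := by
    have h1 : ∑ i, ∑ j, V i j * x j = ∑ j, x j := by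
      rw [Finset.sum_comm]
      refine Finset.sum_congr rfl fun j _ => ?_
      rw [← Finset.sum_mul, hV.sum', one_mul]
    simp only [hxi, ← Finset.mul_sum] at h1
    have h2 : (l - 1) * ∑ i, x i = 0 := by linarith
    exact (mul_eq_zero.1 h2).resolve_left (sub_ne_zero.2 hl1)
  have h1 := hV.contract x hsum
  simp only [hxi, mul_pow, ← Finset.mul_sum] at h1
  have h2 : 0 < ∑ i, x i ^ 2 := by
    obtain ⟨i, hi⟩ := Function.ne_iff.1 hx0
    have : x i ≠ 0 := hi
    exact Finset.sum_pos' (fun _ _ => sq_nonneg _) ⟨i, Finset.mem_univ i, by positivity⟩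
  have h3 := le_of_mul_le_mul_right h1 h2
  exact (abs_le_of_sq_le_sq' h3 hs0).1

theorem Mixing.spectrum_nonempty {V : Matrix (Fin N) (Fin N) ℝ} {s : ℝ} (hV : Mixing V s) :
    (spectrum ℝ V).Nonempty := by
  refine ⟨1, ?_⟩
  rw [spectrum.mem_iff, Matrix.isUnit_iff_isUnit_det, isUnit_iff_ne_zero, not_not,
    ← Matrix.exists_mulVec_eq_zero_iff]
  refine ⟨fun _ => 1, fun h => ?_, ?_⟩
  · have := congrFun h ⟨0, hV.pos⟩
    simp at this
  · rw [map_one, Matrix.sub_mulVec, Matrix.one_mulVec, sub_eq_zero]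
    funext i
    simp [Matrix.mulVec, dotProduct, hV.sum]

theorem Mixing.one_sub_sInf_le {V : Matrix (Fin N) (Fin N) ℝ} {s : ℝ} (hV : Mixing V s) :
    1 - sInf (spectrum ℝ V) ≤ 1354 / 1000 := by
  have h1 := le_csInf hV.spectrum_nonempty fun _ hl => hV.neg_le_of_mem_spectrum hl
  have h2 := hV.s_le_const
  linarith

theorem Gossip.one_sub_sInf_eq_zero {W : Matrix (Fin 1) (Fin 1) ℝ} {G : SimpleGraph (Fin 1)}
    (h : Gossip G W) (t : ℕ) : 1 - sInf (spectrum ℝ (W ^ t)) = 0 := by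
  have hW : W = 1 := by
    ext i j
    have := h.rowSum i
    simp only [Fin.sum_univ_one] at this
    rw [Subsingleton.elim j 0, this, Subsingleton.elim i 0]; simp
  rw [hW, one_pow, spectrum.one_eq, csInf_singleton, sub_self]

end Network

/-! ### Measurability -/

section Measurability

variable {n r N : ℕ}

instance instSecondCountableMat : SecondCountableTopology (Matrix (Fin n) (Fin r) ℝ) :=
  inferInstanceAs (SecondCountableTopology (Fin n → Fin r → ℝ))

/-- The norm topology of matrices is the product topology. -/
instance instBorelSpaceMatNorm : @BorelSpace (Matrix (Fin n) (Fin r) ℝ)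
    (@UniformSpace.toTopologicalSpace _ PseudoMetricSpace.toUniformSpace) _ := instBorelSpaceMat

instance instSecondCountableMatNorm : @SecondCountableTopology (Matrix (Fin n) (Fin r) ℝ)
    (@UniformSpace.toTopologicalSpace _ PseudoMetricSpace.toUniformSpace) := instSecondCountableMat

theorem continuous_projT : Continuous fun q : Mat n r × Mat n r => projT q.1 q.2 := by
  unfold projT
  fun_prop

theorem continuous_eGrad {L : ℝ} {φ : Mat n r → ℝ} (h : LSmooth L φ) :
    Continuous (eGrad φ) := by
  refine (LipschitzWith.of_dist_le_mul (K := L.toNNReal) fun X Y => ?_).continuous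
  rw [dist_eq_norm, dist_eq_norm]
  exact (h.2 X Y).trans (by gcongr; exact Real.le_coe_toNNReal L)

theorem continuous_rGrad {L : ℝ} {φ : Mat n r → ℝ} (h : LSmooth L φ) :
    Continuous (rGrad φ) :=
  continuous_projT.comp (continuous_id.prodMk (continuous_eGrad h))

theorem measurable_projT {Ω : Type*} [MeasurableSpace Ω] {x z : Ω → Mat n r}
    (hx : Measurable x) (hz : Measurable z) : Measurable fun ω => projT (x ω) (z ω) :=
  continuous_projT.measurable.comp (hx.prodMk hz)

/-- Nonexpansiveness makes the retraction continuous on the set of points with tangent vectors,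
which avoids any regularity of the functional calculus. -/
theorem measurable_polarRetr {Ω : Type*} [MeasurableSpace Ω] {x v : Ω → Mat n r}
    (hx : Measurable x) (hv : Measurable v) (hxS : ∀ ω, x ω ∈ St n r)
    (hvT : ∀ ω, v ω ∈ tangent (x ω)) : Measurable fun ω => polarRetr (x ω) (v ω) := by
  set S : Set (Mat n r × Mat n r) := {q | q.1 ∈ St n r ∧ q.2 ∈ tangent q.1}
  have hc : Continuous fun q : S => polarRetr q.1.1 q.1.2 := by
    refine continuous_iff_continuousAt.2 fun q₀ => tendsto_iff_norm_sub_tendsto_zero.2 ?_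
    have h1 : Filter.Tendsto (fun q : S => ‖(q.1.1 + q.1.2) - (q₀.1.1 + q₀.1.2)‖) (nhds q₀)
        (nhds 0) := by
      have hcont : Continuous fun q : S => ‖(q.1.1 + q.1.2) - (q₀.1.1 + q₀.1.2)‖ := by fun_prop
      simpa using hcont.tendsto q₀
    exact squeeze_zero (fun _ => norm_nonneg _)
      (fun q => norm_polarRetr_sub_le q.2.1 q.2.2 q₀.2.1 q₀.2.2) h1
  have hm : Measurable fun ω => (⟨(x ω, v ω), hxS ω, hvT ω⟩ : S) :=
    (hx.prodMk hv).subtype_mk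
  exact hc.measurable.comp hm

/-- S itself need not be measurable: it is replaced by a measurable event of full measure on which u
takes values in S. -/
theorem aemeasurable_comp_of_continuousOn {Ω A B : Type*} [MeasurableSpace Ω] {μ : Measure Ω}
    [TopologicalSpace A] [MeasurableSpace A] [OpensMeasurableSpace A]
    [TopologicalSpace B] [MeasurableSpace B] [BorelSpace B] {u : Ω → A} (hu : Measurable u)
    {S : Set A} {g : A → B} (hg : ContinuousOn g S) (hS : ∀ᵐ ω ∂μ, u ω ∈ S) :
    AEMeasurable (fun ω => g (u ω)) μ := by
  obtain ⟨s, hs, hsm, hsS⟩ := hS.exists_measurable_mem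
  rw [← Measure.restrict_eq_self_of_ae_mem (μ := μ) (s := s) hs,
    aemeasurable_restrict_iff_comap_subtype hsm]
  have h1 : Measurable fun ω : s => (⟨u ω, hsS ω ω.2⟩ : S) :=
    (hu.comp measurable_subtype_coe).subtype_mk
  exact ((continuousOn_iff_continuous_domRestrict.1 hg).measurable.comp h1).aemeasurable

end Measurability

/-! ### Averages of independent samples -/

section Independence

variable {Ω A B : Type*} [MeasurableSpace Ω] [MeasurableSpace A] [MeasurableSpace B]
  {μ : Measure Ω} [IsProbabilityMeasure μ]

theorem integral_indep {u : Ω → A} {v : Ω → B} (hu : Measurable u) (hv : Measurable v)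
    (huv : IndepFun u v μ) {φ : A × B → ℝ} (hφ : Measurable φ)
    (hint : Integrable (fun ω => φ (u ω, v ω)) μ) :
    ∫ ω, φ (u ω, v ω) ∂μ = ∫ ω, ∫ b, φ (u ω, b) ∂(μ.map v) ∂μ := by
  have hmap := (indepFun_iff_map_prod_eq_prod_map_map hu.aemeasurable hv.aemeasurable).1 huv
  have hv' : IsProbabilityMeasure (μ.map v) := Measure.isProbabilityMeasure_map hv.aemeasurable
  have hu' : IsProbabilityMeasure (μ.map u) := Measure.isProbabilityMeasure_map hu.aemeasurable
  have hint' : Integrable φ ((μ.map u).prod (μ.map v)) := by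
    rw [← hmap]
    exact (integrable_map_measure hφ.aestronglyMeasurable (hu.prodMk hv).aemeasurable).2 hint
  rw [← integral_map (hu.prodMk hv).aemeasurable hφ.aestronglyMeasurable, hmap,
    integral_prod _ hint', integral_map hu.aemeasurable]
  exact hφ.aestronglyMeasurable.integral_prod_right'

end Independence

section Batch

variable {E : Type*} [NormedAddCommGroup E] [InnerProductSpace ℝ E] [CompleteSpace E]
  [MeasurableSpace E] [BorelSpace E] [SecondCountableTopology E]
  {Ω Ξ : Type*} [MeasurableSpace Ω] [MeasurableSpace Ξ]
  {μ : Measure Ω} [IsProbabilityMeasure μ] {P : Measure Ξ} [IsProbabilityMeasure P]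

theorem integral_sub_const_eq_zero {g : Ξ → E} {c : E} {C : ℝ} (hg : Measurable g)
    (hC : ∀ᵐ y ∂P, ‖g y‖ ≤ C) (hc : ∫ y, g y ∂P = c) : ∫ y, (g y - c) ∂P = 0 := by
  rw [integral_sub (Integrable.of_bound hg.aestronglyMeasurable C hC) (integrable_const c), hc]
  simp

/-- The variance of an average of samples drawn independently at a random point. -/
theorem integral_norm_sq_batch_le {x : Ω → E} {ξ : ℕ → Ω → Ξ} {H : E → Ξ → E}
    {S : Set (E)} {C σ : ℝ} {m : ℕ} (hm : 1 ≤ m) (hC : 0 ≤ C)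
    (hx : Measurable x) (hξ : ∀ j, Measurable (ξ j)) (hlaw : ∀ j, μ.map (ξ j) = P)
    (hH : Measurable (Function.uncurry H)) (hxS : ∀ ω, x ω ∈ S)
    (hind : ∀ j, IndepFun x (ξ j) μ)
    (hind2 : ∀ j l, j ≠ l → IndepFun (fun ω => (x ω, ξ j ω)) (ξ l) μ)
    (hbd : ∀ᵐ y ∂P, ∀ X ∈ S, ‖H X y‖ ≤ C)
    (hmean : ∀ X ∈ S, ∫ y, H X y ∂P = 0)
    (hvar : ∀ X ∈ S, ∫ y, ‖H X y‖ ^ 2 ∂P ≤ σ ^ 2) :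
    ∫ ω, ‖(1 / (m : ℝ)) • ∑ j ∈ Finset.range m, H (x ω) (ξ j ω)‖ ^ 2 ∂μ ≤ σ ^ 2 / m := by
  have hm' : (0 : ℝ) < m := by exact_mod_cast hm
  have hHm : ∀ j, Measurable fun ω => H (x ω) (ξ j ω) := fun j =>
    hH.comp (hx.prodMk (hξ j))
  have hHb : ∀ j, ∀ᵐ ω ∂μ, ‖H (x ω) (ξ j ω)‖ ≤ C := fun j => by
    have h1 : ∀ᵐ y ∂(μ.map (ξ j)), ∀ X ∈ S, ‖H X y‖ ≤ C := by rw [hlaw]; exact hbd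
    filter_upwards [ae_of_ae_map (hξ j).aemeasurable h1] with ω hω
    exact hω _ (hxS ω)
  have hint : ∀ j l, Integrable (fun ω => inner ℝ (H (x ω) (ξ j ω)) (H (x ω) (ξ l ω))) μ :=
    fun j l => by
      refine Integrable.of_bound ((hHm j).inner (hHm l)).aestronglyMeasurable (C * C) ?_
      filter_upwards [hHb j, hHb l] with ω h1 h2
      exact (norm_inner_le_norm _ _).trans (mul_le_mul h1 h2 (norm_nonneg _) hC)
  have hHint : ∀ X ∈ S, Integrable (H X) P := fun X hX => by
    refine Integrable.of_bound (hH.comp measurable_prodMk_left).aestronglyMeasurable C ?_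
    filter_upwards [hbd] with y hy
    exact hy X hX
  have hdiag : ∀ j, ∫ ω, inner ℝ (H (x ω) (ξ j ω)) (H (x ω) (ξ j ω)) ∂μ ≤ σ ^ 2 := fun j => by
    rw [integral_indep hx (hξ j) (hind j)
      (φ := fun q => inner ℝ (H q.1 q.2) (H q.1 q.2)) (hH.inner hH) (hint j j), hlaw]
    simp only [real_inner_self_eq_norm_sq]
    refine (integral_mono_of_nonneg (Filter.Eventually.of_forall fun ω =>
      integral_nonneg fun y => sq_nonneg _) (integrable_const (σ ^ 2))
      (Filter.Eventually.of_forall fun ω => hvar _ (hxS ω))).trans_eq ?_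
    simp
  -- Integrating the last sample first, with the point and the other sample frozen, leaves the inner
  -- product with a zero mean.
  have hoff : ∀ j l, j ≠ l → ∫ ω, inner ℝ (H (x ω) (ξ j ω)) (H (x ω) (ξ l ω)) ∂μ = 0 :=
    fun j l hjl => by
      have hφ : Measurable fun q : (E × Ξ) × Ξ => (inner ℝ (H q.1.1 q.1.2) (H q.1.1 q.2) : ℝ) :=
        (hH.comp measurable_fst).inner
          (hH.comp ((measurable_fst.comp measurable_fst).prodMk measurable_snd))
      rw [integral_indep (u := fun ω => (x ω, ξ j ω)) (hx.prodMk (hξ j)) (hξ l) (hind2 j l hjl)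
        (φ := fun q => inner ℝ (H q.1.1 q.1.2) (H q.1.1 q.2)) hφ (hint j l), hlaw]
      refine (integral_congr_ae (Filter.Eventually.of_forall fun ω => ?_)).trans
        (integral_zero _ _)
      simp only
      rw [integral_inner (hHint _ (hxS ω)), hmean _ (hxS ω), inner_zero_right]
  have hexp : ∀ ω, ‖(1 / (m : ℝ)) • ∑ j ∈ Finset.range m, H (x ω) (ξ j ω)‖ ^ 2
      = (1 / (m : ℝ)) ^ 2 * ∑ j ∈ Finset.range m, ∑ l ∈ Finset.range m,
        inner ℝ (H (x ω) (ξ j ω)) (H (x ω) (ξ l ω)) := fun ω => by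
    rw [norm_smul, mul_pow, Real.norm_of_nonneg (by positivity), ← real_inner_self_eq_norm_sq,
      sum_inner]
    simp only [inner_sum]
  simp only [hexp]
  rw [integral_const_mul, integral_finsetSum _
    fun j _ => integrable_finsetSum _ fun l _ => hint j l]
  have hsum : ∑ j ∈ Finset.range m, ∫ ω, ∑ l ∈ Finset.range m,
      inner ℝ (H (x ω) (ξ j ω)) (H (x ω) (ξ l ω)) ∂μ ≤ ∑ j ∈ Finset.range m, σ ^ 2 := by
    refine Finset.sum_le_sum fun j hj => ?_
    rw [integral_finsetSum _ fun l _ => hint j l, Finset.sum_eq_single j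
      (fun l _ hl => hoff j l hl.symm) (fun h => absurd hj h)]
    exact hdiag j
  rw [Finset.sum_const, Finset.card_range, nsmul_eq_mul] at hsum
  calc _ ≤ (1 / (m : ℝ)) ^ 2 * (m * σ ^ 2) := by gcongr
    _ = σ ^ 2 / m := by field_simp

end Batch

/-! ### Measurability of the iterates -/

section Iterates

variable {N n r : ℕ}

/-- The σ-algebra is explicit, so that the lemma applies to the information of a subset of samples.
The variables at step k need only samples before k; the trackers need those of step k as well. -/
theorem measurable_iterates {Ω : Type*} {mΩ : MeasurableSpace Ω} {V : Matrix (Fin N) (Fin N) ℝ}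
    {α β : ℝ} {X Y : ℕ → Ω → Fin N → Mat n r} {S : ℕ → Fin N → Ω → Mat n r → Mat n r}
    {X₀ : Fin N → Mat n r} (hX₀ : ∀ ω, X 0 ω = X₀)
    (hX : ∀ k ω, X (k + 1) ω = retrStep V α β (X k ω) (Y k ω))
    (hY₀ : ∀ ω i, Y 0 ω i = S 0 i ω (X 0 ω i))
    (hY : ∀ k ω i, Y (k + 1) ω i
      = mix V (Y k ω) i + S (k + 1) i ω (X (k + 1) ω i) - S k i ω (X k ω i))
    (hSt : ∀ k ω i, X k ω i ∈ St n r) (k : ℕ)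
    (hS : ∀ l < k, ∀ i, ∀ x : Ω → Mat n r, Measurable x → Measurable fun ω => S l i ω (x ω)) :
    Measurable (X k) ∧ ((∀ i, ∀ x : Ω → Mat n r, Measurable x → Measurable fun ω => S k i ω (x ω))
      → Measurable (Y k)) := by
  have hmix : ∀ {Z : Ω → Fin N → Mat n r}, Measurable Z → ∀ i,
      Measurable fun ω => mix V (Z ω) i := fun hZ i =>
    Finset.measurable_fun_sum _ fun j _ => ((measurable_pi_apply j).comp hZ).const_smul (V i j)
  induction k with
  | zero =>
    have hX' : X 0 = fun _ => X₀ := funext hX₀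
    have h0 : Measurable (X 0) := by rw [hX']; exact measurable_const
    refine ⟨h0, fun h => measurable_pi_iff.2 fun i => ?_⟩
    simp only [hY₀]
    exact h i _ ((measurable_pi_apply i).comp h0)
  | succ k ih =>
    obtain ⟨h1, h2⟩ := ih fun l hl => hS l (hl.trans k.lt_succ_self)
    have h3 := h2 (hS k k.lt_succ_self)
    have h4 : Measurable (X (k + 1)) := by
      refine measurable_pi_iff.2 fun i => ?_
      simp only [hX]
      have hi : ∀ {Z : Ω → Fin N → Mat n r}, Measurable Z → Measurable fun ω => Z ω i :=
        fun hZ => (measurable_pi_apply i).comp hZ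
      refine measurable_polarRetr (hi h1) ?_ (fun ω => hSt k ω i)
        fun ω => disp_mem_tangent (hSt k ω) i
      exact ((measurable_projT (hi h1) (hmix h1 i)).const_smul α).sub
        ((measurable_projT (hi h1) (hi h3)).const_smul β)
    refine ⟨h4, fun h => measurable_pi_iff.2 fun i => ?_⟩
    simp only [hY]
    exact ((hmix h3 i).add (h i _ ((measurable_pi_apply i).comp h4))).sub
      (hS k k.lt_succ_self i _ ((measurable_pi_apply i).comp h1))

theorem measurable_batch {Ω Ξ : Type*} {mΩ : MeasurableSpace Ω} [MeasurableSpace Ξ] {m : ℕ}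
    {G : Mat n r → Ξ → Mat n r} (hG : Measurable (Function.uncurry G)) {ξ : ℕ → Ω → Ξ}
    (hξ : ∀ j, Measurable (ξ j)) {x : Ω → Mat n r} (hx : Measurable x) :
    Measurable fun ω => (1 / (m : ℝ)) • ∑ j ∈ Finset.range m, G (x ω) (ξ j ω) :=
  Measurable.fun_const_smul (Finset.measurable_fun_sum _ fun j _ => hG.comp (hx.prodMk (hξ j))) _

/-- Induced arithmetic means depend continuously on nearly aligned stacks. -/
theorem continuousOn_iam (hN : 0 < N) {M : ℝ} (hM : 0 < M) (hR : RetrBound n r M)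
    {iam : (Fin N → Mat n r) → Mat n r} (h : ∀ Z, (∀ i, Z i ∈ St n r) → IsIAM Z (iam Z)) :
    ContinuousOn iam {Z | (∀ i, Z i ∈ St n r) ∧ (msq fun i => Z i - iam Z) ≤ 1} := by
  intro Z₀ hZ₀
  refine tendsto_iff_norm_sub_tendsto_zero.2 ?_
  have hcont : Continuous fun Z : Fin N → Mat n r => 2 * ‖avg Z - avg Z₀‖ := by
    unfold avg
    fun_prop
  have h1 : Filter.Tendsto (fun Z : Fin N → Mat n r => 2 * ‖avg Z - avg Z₀‖)
      (nhdsWithin Z₀ {Z | (∀ i, Z i ∈ St n r) ∧ (msq fun i => Z i - iam Z) ≤ 1}) (nhds 0) := by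
    simpa using (hcont.tendsto Z₀).mono_left nhdsWithin_le_nhds
  refine squeeze_zero' (Filter.Eventually.of_forall fun _ => norm_nonneg _) ?_ h1
  filter_upwards [self_mem_nhdsWithin] with Z hZ
  have a := h Z hZ.1
  have b := h Z₀ hZ₀.1
  exact a.norm_sub_le hN hZ.1 hZ₀.1 b (a.projT_avg_eq_zero hN hZ.1 hM hR)
    (b.projT_avg_eq_zero hN hZ₀.1 hM hR) hZ.2 hZ₀.2

end Iterates

namespace Model

variable {N n r : ℕ} {Ω : Type*} {Ξ : Fin N → Type*}
  [MeasurableSpace Ω] [∀ i, MeasurableSpace (Ξ i)] (p : Model N n r Ω Ξ)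

/-! ### The samples of the algorithm -/

/-- The information carried by the samples with index in `S`. -/
@[reducible] def info (S : Set (Fin N × ℕ × ℕ)) : MeasurableSpace Ω :=
  ⨆ q ∈ S, MeasurableSpace.comap (p.ξ q.1 q.2.1 q.2.2) inferInstance

variable {p}

theorem measurable_info {S : Set (Fin N × ℕ × ℕ)} {i : Fin N} {k j : ℕ} (h : (i, k, j) ∈ S) :
    Measurable[p.info S] (p.ξ i k j) :=
  measurable_iff_comap_le.2 (le_iSup₂_of_le (i, k, j) h le_rfl)

theorem Sampling.info_le (hs : p.Sampling) (S : Set (Fin N × ℕ × ℕ)) :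
    p.info S ≤ (inferInstance : MeasurableSpace Ω) :=
  iSup₂_le fun q _ => (hs.measurable q.1 q.2.1 q.2.2).comap_le

theorem Sampling.indepFun (hs : p.Sampling) {S T : Set (Fin N × ℕ × ℕ)} (hST : Disjoint S T)
    {A B : Type*} [MeasurableSpace A] [MeasurableSpace B] {u : Ω → A} {v : Ω → B}
    (hu : Measurable[p.info S] u) (hv : Measurable[p.info T] v) : IndepFun u v p.μ := by
  have h1 := indep_iSup_of_disjoint (fun q => (hs.measurable q.1 q.2.1 q.2.2).comap_le)
    ((iIndepFun_iff_iIndep _ _ _).1 hs.indep) hST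
  rw [IndepFun_iff_Indep]
  exact indep_of_indep_of_le h1 hu.comap_le hv.comap_le

theorem measurable_sampGrad (ho : p.Oracle) {S : Set (Fin N × ℕ × ℕ)} {i : Fin N} {k : ℕ}
    (hS : ∀ j, (i, k, j) ∈ S) {x : Ω → Mat n r} (hx : Measurable[p.info S] x) :
    Measurable[p.info S] fun ω => p.sampGrad i k ω (x ω) :=
  measurable_batch (mΩ := p.info S) (ho.measurable i) (fun j => measurable_info (hS j)) hx

theorem Admissible.X_mem (ha : p.Admissible) (k : ℕ) (ω : Ω) (i : Fin N) :
    p.X k ω i ∈ St n r := by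
  induction k generalizing i with
  | zero => exact ha.init.1 i
  | succ k ih => exact retrStep_mem (V := p.W ^ p.t) (α := p.α) (β := p.β) (B := p.Y k ω) ih i

theorem Admissible.measurable_iterates (ha : p.Admissible) (ho : p.Oracle) (k : ℕ)
    (S : Set (Fin N × ℕ × ℕ)) (hS : ∀ i, ∀ l < k, ∀ j, (i, l, j) ∈ S) :
    Measurable[p.info S] (p.X k) ∧
      ((∀ i j, (i, k, j) ∈ S) → Measurable[p.info S] (p.Y k)) := by
  have h := DRSGT.measurable_iterates (mΩ := p.info S) (V := p.W ^ p.t) (α := p.α) (β := p.β)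
    (X := p.X) (Y := p.Y) (S := fun k i ω => p.sampGrad i k ω) (X₀ := p.X₀) (fun _ => rfl)
    (fun _ _ => rfl) (fun _ _ => rfl) (fun _ _ _ => rfl) ha.X_mem k
    (fun l hl i x hx => measurable_sampGrad ho (hS i l hl) hx)
  exact ⟨h.1, fun hk => h.2 fun i x hx =>
    measurable_sampGrad ho (hk i) hx⟩

theorem Admissible.measurable_X (ha : p.Admissible) (ho : p.Oracle) (hs : p.Sampling) (k : ℕ) :
    Measurable (p.X k) :=
  ((ha.measurable_iterates ho k Set.univ (by simp)).1).mono (hs.info_le _) le_rfl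

/-- The sampled gradients `F_i(X_{i,k})`. -/
noncomputable def F (p : Model N n r Ω Ξ) (k : ℕ) (ω : Ω) (i : Fin N) : Mat n r :=
  p.sampGrad i k ω (p.X k ω i)

/-- The errors of the sampled gradients. -/
noncomputable def noise (p : Model N n r Ω Ξ) (k : ℕ) (ω : Ω) (i : Fin N) : Mat n r :=
  p.F k ω i - rGrad (p.fLoc i) (p.X k ω i)

theorem Admissible.measurable_F (ha : p.Admissible) (ho : p.Oracle) (hs : p.Sampling) (k : ℕ) :
    Measurable (p.F k) :=
  measurable_pi_iff.2 fun i => measurable_batch (ho.measurable i) (hs.measurable i k)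
    ((measurable_pi_apply i).comp (ha.measurable_X ho hs k))

theorem Admissible.measurable_noise (ha : p.Admissible) (hf : p.Smooth) (ho : p.Oracle)
    (hs : p.Sampling) (k : ℕ) : Measurable (p.noise k) :=
  measurable_pi_iff.2 fun i => ((measurable_pi_apply i).comp (ha.measurable_F ho hs k)).sub
    ((continuous_rGrad (hf.smooth i)).measurable.comp
      ((measurable_pi_apply i).comp (ha.measurable_X ho hs k)))

theorem Bounded.norm_rGrad_le (hb : p.Bounded) (i : Fin N) {X : Mat n r} (hX : X ∈ St n r) :
    ‖rGrad (p.fLoc i) X‖ ≤ p.A₂ := (norm_projT_le hX _).trans (hb.gradient i X hX)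

theorem Bounded.norm_sub_le (hb : p.Bounded) {i : Fin N} {X Z : Mat n r} (hX : X ∈ St n r)
    (hZ : ‖Z‖ ≤ p.A₁) : ‖Z - rGrad (p.fLoc i) X‖ ≤ p.A₁ + p.A₂ :=
  (_root_.norm_sub_le _ _).trans (add_le_add hZ (hb.norm_rGrad_le i hX))

/-- The exceptional null set does not depend on the point X, so after a countable intersection over
samples the bound may be used at the random iterates. -/
theorem Bounded.ae_oracle_le (hb : p.Bounded) (hs : p.Sampling) :
    ∀ᵐ ω ∂p.μ, ∀ i k j, ∀ X ∈ St n r, ‖p.G i X (p.ξ i k j ω)‖ ≤ p.A₁ := by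
  simp only [ae_all_iff (ι := Fin N), ae_all_iff (ι := ℕ)]
  intro i k j
  have h := hb.oracle i
  rw [← hs.law i k j] at h
  exact ae_of_ae_map (hs.measurable i k j).aemeasurable h

theorem Sampling.noise_eq (hs : p.Sampling) (k : ℕ) (ω : Ω) (i : Fin N) :
    p.noise k ω i = (1 / (p.batch k : ℝ)) • ∑ j ∈ Finset.range (p.batch k),
      (p.G i (p.X k ω i) (p.ξ i k j ω) - rGrad (p.fLoc i) (p.X k ω i)) := by
  have hb : (p.batch k : ℝ) ≠ 0 := by
    have := hs.batch_pos k
    positivity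
  rw [Finset.sum_sub_distrib, smul_sub, Finset.sum_const, Finset.card_range,
    ← Nat.cast_smul_eq_nsmul ℝ, smul_smul, one_div_mul_cancel hb, one_smul]
  rfl

theorem norm_sampGrad_le (hs : p.Sampling) {ω : Ω} {i : Fin N} {k : ℕ} {X : Mat n r}
    (h : ∀ j, ‖p.G i X (p.ξ i k j ω)‖ ≤ p.A₁) : ‖p.sampGrad i k ω X‖ ≤ p.A₁ := by
  have hb : (0 : ℝ) < p.batch k := by exact_mod_cast hs.batch_pos k
  rw [sampGrad, norm_smul, Real.norm_of_nonneg (by positivity), one_div_mul_eq_div,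
    div_le_iff₀ hb]
  refine (norm_sum_le _ _).trans ((Finset.sum_le_card_nsmul _ _ p.A₁ fun j _ => h j).trans_eq ?_)
  rw [Finset.card_range, nsmul_eq_mul, mul_comm]

/-- The error of the averaged samples of an agent has second moment at most `σ² / N_k`. -/
theorem Admissible.integral_norm_sq_noise_le (ha : p.Admissible) (hf : p.Smooth) (ho : p.Oracle)
    (hb : p.Bounded) (hs : p.Sampling) (k : ℕ) (i : Fin N) :
    ∫ ω, ‖p.noise k ω i‖ ^ 2 ∂p.μ ≤ p.σ ^ 2 / p.batch k := by
  have := hs.prob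
  have := ho.prob i
  simp only [hs.noise_eq]
  -- An outcome provides a point of the manifold, and with it the sign of `A₂`; without outcomes the
  -- measure is zero.
  by_cases hne : ∃ ω : Ω, True
  swap
  · have : IsEmpty Ω := ⟨fun ω => hne ⟨ω, trivial⟩⟩
    rw [Measure.eq_zero_of_isEmpty p.μ, integral_zero_measure]
    positivity
  obtain ⟨ω₀, -⟩ := hne
  have hA2 : 0 ≤ p.A₂ := (norm_nonneg _).trans (hb.gradient i _ (ha.X_mem 0 ω₀ i))
  -- Indices of earlier iterations. They determine the iterate at step k and are disjoint from the
  -- samples drawn at step k, which yields the required independence.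
  set past : Set (Fin N × ℕ × ℕ) := {q | q.2.1 < k} with hpast
  have hxp : ∀ S, past ⊆ S → Measurable[p.info S] fun ω => p.X k ω i := fun S hS =>
    (measurable_pi_apply i).comp
      (ha.measurable_iterates ho k S fun i l hl j => hS (show l < k from hl)).1
  have hr : Measurable (rGrad (p.fLoc i)) := (continuous_rGrad (hf.smooth i)).measurable
  have hGX : ∀ X, Measurable (p.G i X) := fun X => (ho.measurable i).comp measurable_prodMk_left
  refine integral_norm_sq_batch_le (P := p.P i) (S := St n r) (C := p.A₁ + p.A₂)
    (x := fun ω => p.X k ω i) (ξ := fun j => p.ξ i k j)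
    (H := fun X y => p.G i X y - rGrad (p.fLoc i) X)
    (hs.batch_pos k) (add_nonneg hb.pos.le hA2)
    ((hxp past le_rfl).mono (hs.info_le _) le_rfl) (hs.measurable i k) (hs.law i k)
    ((ho.measurable i).sub (hr.comp measurable_fst)) (fun ω => ha.X_mem k ω i) (fun j => ?_)
    (fun j l hjl => ?_) ?_ (fun X hX => ?_) (fun X hX => ho.variance i X hX)
  · refine hs.indepFun (S := past) (T := {(i, k, j)}) ?_ (hxp _ le_rfl)
      (measurable_info (Set.mem_singleton _))
    simp [hpast]
  · have h1 : Measurable[p.info (past ∪ {(i, k, j)})] (p.ξ i k j) :=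
      measurable_info (Set.mem_union_right _ (Set.mem_singleton _))
    have h2 := Measurable.prodMk (m := p.info (past ∪ {(i, k, j)}))
      (hxp _ Set.subset_union_left) h1
    refine hs.indepFun (S := past ∪ {(i, k, j)}) (T := {(i, k, l)}) ?_ h2
      (measurable_info (Set.mem_singleton _))
    simp [hpast, hjl.symm]
  · filter_upwards [hb.oracle i] with y hy X hX
    exact hb.norm_sub_le hX (hy X hX)
  · refine integral_sub_const_eq_zero (hGX X) ?_ (ho.unbiased i X hX) (C := p.A₁)
    filter_upwards [hb.oracle i] with y hy
    exact hy X hX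

end Model

theorem integrable_msq {N n r : ℕ} {Ω : Type*} [MeasurableSpace Ω] {μ : Measure Ω}
    [IsFiniteMeasure μ] (hN : 0 < N) {Z : Ω → Fin N → Mat n r} {C : ℝ}
    (hZ : ∀ i, AEMeasurable (fun ω => Z ω i) μ) (hC : ∀ᵐ ω ∂μ, ∀ i, ‖Z ω i‖ ≤ C) :
    Integrable (fun ω => msq (Z ω)) μ := by
  have hm : AEMeasurable (fun ω => msq (Z ω)) μ :=
    (Finset.aemeasurable_fun_sum _ fun i _ => (hZ i).norm.pow_const 2).const_mul _
  refine Integrable.of_bound hm.aestronglyMeasurable (C ^ 2) ?_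
  filter_upwards [hC] with ω hω
  rw [Real.norm_of_nonneg (msq_nonneg _)]
  exact msq_le_of_le hN hω

namespace Model

variable {N n r : ℕ} {Ω : Type*} {Ξ : Fin N → Type*}
  [MeasurableSpace Ω] [∀ i, MeasurableSpace (Ξ i)] {p : Model N n r Ω Ξ}

theorem f_eq_tot (p : Model N n r Ω Ξ) : p.f = tot p.fLoc := rfl

theorem consErr_eq (p : Model N n r Ω Ξ) (Z : Fin N → Mat n r) :
    1 / (N : ℝ) * p.consErr Z = msq fun i => Z i - p.iam Z := rfl

theorem Admissible.Xhat_mem (ha : p.Admissible) (k : ℕ) (ω : Ω) : p.Xhat k ω ∈ St n r :=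
  (ha.iam _ (ha.X_mem k ω)).1

theorem Admissible.trajectory (ha : p.Admissible) (hN : 0 < N) (hs : p.Sampling) {ω : Ω}
    (hω : ∀ i k j, ∀ X ∈ St n r, ‖p.G i X (p.ξ i k j ω)‖ ≤ p.A₁) :
    Trajectory (p.W ^ p.t) p.α p.β p.A p.δ₁ p.δ₂ (fun k => p.X k ω) (fun k => p.Y k ω)
      (fun k => p.F k ω) fun k => p.Xhat k ω where
  X_succ _ := rfl
  Y_zero := rfl
  Y_succ _ := rfl
  F_le _ k i := (norm_sampGrad_le hs fun j => hω i k j _ (ha.X_mem k ω i)).trans (le_max_left _ _)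
  near := ha.init.1
  near_msq := by
    have h : p.consErr p.X₀ ≤ N * p.δ₁ ^ 2 := ha.init.2.1
    have hN' : (0 : ℝ) < N := by exact_mod_cast hN
    refine (p.consErr_eq p.X₀).symm.trans_le ?_
    rwa [one_div_mul_eq_div, div_le_iff₀' hN']
  near_max := ha.init.2.2
  iam k hk := ha.iam _ hk

/-! ### Expectations -/

/-- The standing assumptions, with the numerical conditions in the form used for a trajectory. -/
structure Regular (p : Model N n r Ω Ξ) (s Λ : ℝ) : Prop where
  smooth : p.Smooth
  oracle : p.Oracle
  bounded : p.Bounded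
  sampling : p.Sampling
  admissible : p.Admissible
  mixing : Mixing (p.W ^ p.t) s
  steps : StepSizes p.α p.β p.A p.M p.δ₁ p.δ₂
  costs : CostSizes p.α p.β p.A p.M p.L Λ

section Expectations

variable {s Λ : ℝ}

theorem Regular.goodCosts (h : p.Regular s Λ) : GoodCosts p.fLoc p.L p.A :=
  ⟨h.smooth.smooth, fun i X hX => (h.bounded.gradient i X hX).trans (le_max_right _ _)⟩

theorem Regular.ae_trajectory (h : p.Regular s Λ) : ∀ᵐ ω ∂p.μ,
    Trajectory (p.W ^ p.t) p.α p.β p.A p.δ₁ p.δ₂ (fun k => p.X k ω) (fun k => p.Y k ω)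
      (fun k => p.F k ω) fun k => p.Xhat k ω := by
  filter_upwards [h.bounded.ae_oracle_le h.sampling] with ω hω
  exact h.admissible.trajectory h.mixing.pos h.sampling hω

/-- An arbitrary selection of induced means need not be measurable, but near consensus it is
continuous, and the iterates almost surely stay near consensus. -/
theorem Regular.aemeasurable_Xhat (h : p.Regular s Λ) (k : ℕ) : AEMeasurable (p.Xhat k) p.μ := by
  have ha := h.admissible
  refine aemeasurable_comp_of_continuousOn (ha.measurable_X h.oracle h.sampling k)
    (continuousOn_iam h.mixing.pos ha.retr.1 ha.retr.2 ha.iam) ?_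
  filter_upwards [h.ae_trajectory] with ω hω
  have hn := hω.near_all h.mixing h.steps ha.retr.2 k
  exact ⟨hn.mem, hn.msq_le_one h.steps⟩

theorem Regular.integrable_msq_sub_Xhat (h : p.Regular s Λ) (k : ℕ) :
    Integrable (fun ω => msq fun i => p.X k ω i - p.Xhat k ω) p.μ := by
  have := h.sampling.prob
  have ha := h.admissible
  refine integrable_msq h.mixing.pos (C := √r + √r) (fun i => ?_) (Filter.Eventually.of_forall
    fun ω i => ?_)
  · exact ((measurable_pi_apply i).comp
      (ha.measurable_X h.oracle h.sampling k)).aemeasurable.sub (h.aemeasurable_Xhat k)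
  · have h : ∀ {Z : Mat n r}, Z ∈ St n r → ‖Z‖ ≤ √r := fun hZ => by
      rw [← norm_sq_of_mem_St hZ, Real.sqrt_sq (norm_nonneg _)]
    exact (norm_sub_le _ _).trans (add_le_add (h (ha.X_mem k ω i)) (h (ha.Xhat_mem k ω)))

theorem Regular.integrable_norm_sq_rGrad (h : p.Regular s Λ) (k : ℕ) :
    Integrable (fun ω => ‖rGrad p.f (p.Xhat k ω)‖ ^ 2) p.μ := by
  have := h.sampling.prob
  have h1 : Measurable (rGrad p.f) :=
    (continuous_rGrad (LSmooth.tot h.mixing.pos h.smooth.smooth)).measurable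
  have h2 : AEMeasurable (fun ω => rGrad p.f (p.Xhat k ω)) p.μ :=
    h1.comp_aemeasurable (h.aemeasurable_Xhat k)
  refine Integrable.of_bound (h2.norm.pow_const 2).aestronglyMeasurable (p.A ^ 2)
    (Filter.Eventually.of_forall fun ω => ?_)
  rw [Real.norm_of_nonneg (by positivity)]
  gcongr
  exact h.goodCosts.norm_rGrad_tot_le h.mixing.pos (h.admissible.Xhat_mem k ω)

theorem Regular.integrable_norm_sq_noise (h : p.Regular s Λ) (k : ℕ) (i : Fin N) :
    Integrable (fun ω => ‖p.noise k ω i‖ ^ 2) p.μ := by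
  have := h.sampling.prob
  have h1 : Measurable fun ω => p.noise k ω i := (measurable_pi_apply i).comp
    (h.admissible.measurable_noise h.smooth h.oracle h.sampling k)
  refine Integrable.of_bound (h1.norm.pow_const 2).aestronglyMeasurable ((p.A₁ + p.A₂) ^ 2) ?_
  filter_upwards [h.bounded.ae_oracle_le h.sampling] with ω hω
  rw [Real.norm_of_nonneg (by positivity)]
  gcongr
  exact h.bounded.norm_sub_le (h.admissible.X_mem k ω i)
    (norm_sampGrad_le h.sampling fun j => hω i k j _ (h.admissible.X_mem k ω i))

theorem Regular.integrable_msq_noise (h : p.Regular s Λ) (k : ℕ) :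
    Integrable (fun ω => msq (p.noise k ω)) p.μ :=
  (integrable_finsetSum _ fun i _ => h.integrable_norm_sq_noise k i).const_mul _

theorem Regular.integral_msq_noise_le (h : p.Regular s Λ) (k : ℕ) :
    ∫ ω, msq (p.noise k ω) ∂p.μ ≤ p.σ ^ 2 / p.batch k := by
  have h1 : ∫ ω, msq (p.noise k ω) ∂p.μ = mean fun i => ∫ ω, ‖p.noise k ω i‖ ^ 2 ∂p.μ := by
    rw [mean, ← integral_finsetSum _ fun i _ => h.integrable_norm_sq_noise k i,
      ← integral_const_mul]
    rfl
  rw [h1]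
  exact mean_le_of_le h.mixing.pos fun i => h.admissible.integral_norm_sq_noise_le h.smooth
    h.oracle h.bounded h.sampling k i

theorem Regular.integrable_msq_Y_sub (h : p.Regular s Λ) :
    Integrable (fun ω => msq fun i => p.Y 0 ω i - avg (p.F 0 ω)) p.μ := by
  have := h.sampling.prob
  have hF : ∀ i, Measurable fun ω => p.F 0 ω i := fun i =>
    (measurable_pi_apply i).comp (h.admissible.measurable_F h.oracle h.sampling 0)
  refine integrable_msq h.mixing.pos (C := p.A + p.A) (fun i => ?_) ?_
  · exact ((hF i).sub (Measurable.fun_const_smul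
      (Finset.measurable_fun_sum _ fun j _ => hF j) _)).aemeasurable
  · filter_upwards [h.ae_trajectory] with ω hω i
    exact (norm_sub_le _ _).trans (add_le_add (hω.norm_F_le 0 i)
      (norm_avg_le h.mixing.pos fun j => hω.norm_F_le 0 j))

theorem sum_integral_le_of_ae {μ : Measure Ω} [IsProbabilityMeasure μ] {U ν : ℕ → Ω → ℝ}
    {T : Ω → ℝ} {c₀ c₁ c₂ : ℝ} {m : ℕ} (hU : ∀ k, Integrable (U k) μ)
    (hν : ∀ k, Integrable (ν k) μ) (hT : Integrable T μ)
    (hle : ∀ᵐ ω ∂μ, ∑ k ∈ Finset.range m, U k ω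
      ≤ c₀ + c₁ * ∑ k ∈ Finset.range m, ν k ω + c₂ * T ω) :
    ∑ k ∈ Finset.range m, ∫ ω, U k ω ∂μ
      ≤ c₀ + c₁ * ∑ k ∈ Finset.range m, ∫ ω, ν k ω ∂μ + c₂ * ∫ ω, T ω ∂μ := by
  have hν' : Integrable (fun ω => c₁ * ∑ k ∈ Finset.range m, ν k ω) μ :=
    (integrable_finsetSum _ fun k _ => hν k).const_mul _
  have h1 := integral_mono_ae (integrable_finsetSum _ fun k _ => hU k)
    (((integrable_const c₀).add hν').add (hT.const_mul c₂)) hle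
  rw [integral_finsetSum _ fun k _ => hU k] at h1
  refine h1.trans_eq ?_
  rw [integral_add' ((integrable_const c₀).add hν') (hT.const_mul c₂),
    integral_add' (integrable_const c₀) hν', integral_const_mul, integral_const_mul,
    integral_finsetSum _ fun k _ => hν k]
  simp

/-- The mean deviation of the initial trackers. -/
noncomputable def T₀ (p : Model N n r Ω Ξ) : ℝ :=
  ∫ ω, (msq fun i => p.Y 0 ω i - avg (p.F 0 ω)) ∂p.μ

/-- The almost sure estimates are linear in the noise and the initial tracking error, so they can be
integrated term by term; then the batch variance bound is inserted. -/
theorem Regular.expected_sums_le (h : p.Regular s Λ) {Γ e₀ : ℝ} (hΓ : 109 / 100 ≤ Γ * p.α ^ 2)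
    (hβΛΓ : 1600 * (p.β * Λ * Γ) ≤ 1)
    (he₀ : (msq fun i => p.X₀ i - p.iam p.X₀)
      = (1 - (1 - 11 / 20 * p.α) * (1 - 11 / 20 * p.α / 4)) * e₀) (K : ℕ) :
    ∑ k ∈ Finset.range (K + 1), 1 / (N : ℝ) * ∫ ω, p.consErr (p.X k ω) ∂p.μ
      ≤ e₀ + Γ * p.β * (7 * (p.f (p.iam p.X₀) - p.fStar)
        + 170 * (p.β * ∑ k ∈ Finset.range (K + 1), p.σ ^ 2 / p.batch k)
        + 45 / 10 * (p.β * (p.T₀ / (1 - s))) + 120 * (Λ * e₀)) ∧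
    p.β * ∑ k ∈ Finset.range (K + 1), ∫ ω, ‖rGrad p.f (p.Xhat k ω)‖ ^ 2 ∂p.μ
      ≤ 5 / 3 * (p.f (p.iam p.X₀) - p.fStar)
        + 15 * (p.β * ∑ k ∈ Finset.range (K + 1), p.σ ^ 2 / p.batch k)
        + 3 / 10 * (p.β * (p.T₀ / (1 - s))) + 30 * (Λ * e₀) := by
  have := h.sampling.prob
  have hβ := h.steps.β_pos
  have hΓ0 : 0 ≤ Γ := by
    by_contra! hneg
    nlinarith [sq_nonneg p.α]
  have hsums : ∀ᵐ ω ∂p.μ, _ := h.ae_trajectory.mono fun ω hω =>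
    hω.sums_le h.mixing h.steps h.admissible.retr.2 h.goodCosts h.costs hΓ hβΛΓ he₀ K
  have hnoise : ∑ k ∈ Finset.range (K + 1), ∫ ω, msq (p.noise k ω) ∂p.μ
      ≤ ∑ k ∈ Finset.range (K + 1), p.σ ^ 2 / p.batch k :=
    Finset.sum_le_sum fun k _ => h.integral_msq_noise_le k
  constructor
  · have h1 := sum_integral_le_of_ae (m := K + 1) h.integrable_msq_sub_Xhat h.integrable_msq_noise
      h.integrable_msq_Y_sub (c₀ := e₀ + Γ * p.β * (7 * (p.f (p.iam p.X₀) - p.fStar)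
        + 120 * (Λ * e₀))) (c₁ := Γ * p.β * (170 * p.β))
      (c₂ := Γ * p.β * (45 / 10 * (p.β / (1 - s)))) <| by
        filter_upwards [hsums] with ω hω
        refine hω.1.trans_eq ?_
        simp only [f_eq_tot, fStar]
        ring!
    have h2 := mul_le_mul_of_nonneg_left hnoise
      (by positivity : 0 ≤ Γ * p.β * (170 * p.β))
    have h3 : ∑ k ∈ Finset.range (K + 1), 1 / (N : ℝ) * ∫ ω, p.consErr (p.X k ω) ∂p.μ
        = ∑ k ∈ Finset.range (K + 1), ∫ ω, (msq fun i => p.X k ω i - p.Xhat k ω) ∂p.μ :=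
      Finset.sum_congr rfl fun k _ => by rw [← integral_const_mul]; rfl
    rw [h3]
    refine (h1.trans (add_le_add (add_le_add le_rfl h2) le_rfl)).trans_eq ?_
    rw [T₀]
    ring
  · have h1 := sum_integral_le_of_ae (m := K + 1)
      (fun k => (h.integrable_norm_sq_rGrad k).const_mul p.β) h.integrable_msq_noise
      h.integrable_msq_Y_sub (c₀ := 5 / 3 * (p.f (p.iam p.X₀) - p.fStar)
        + 30 * (Λ * e₀)) (c₁ := 15 * p.β) (c₂ := 3 / 10 * (p.β / (1 - s))) <| by
        filter_upwards [hsums] with ω hω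
        rw [← Finset.mul_sum]
        refine hω.2.trans_eq ?_
        simp only [f_eq_tot, fStar]
        ring!
    have h2 := mul_le_mul_of_nonneg_left hnoise (by positivity : 0 ≤ 15 * p.β)
    simp only [integral_const_mul] at h1
    rw [← Finset.mul_sum] at h1
    refine (h1.trans (add_le_add (add_le_add le_rfl h2) le_rfl)).trans_eq ?_
    rw [T₀]
    ring

end Expectations

end Model

namespace Model

/-! ### The constants -/

variable {N n r : ℕ} {Ω : Type*} {Ξ : Fin N → Type*}
  [MeasurableSpace Ω] [∀ i, MeasurableSpace (Ξ i)] {p : Model N n r Ω Ξ}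

theorem Network.gossip (h : p.Network) : Gossip p.graph p.W where
  connected := h.connected
  pos := h.pos
  nonneg i j := by
    by_cases hij : i = j ∨ p.graph.Adj i j
    · exact (h.pos i j hij).le
    · exact (h.zero i j hij).ge
  symm := h.symm
  rowSum := h.rowSum

/-- For a single agent L_t = 0, and the quotient Φ / L_t takes its default value 0, which
contradicts α > 0. -/
theorem Network.two_le (h : p.Network) (ha : p.Admissible) : 2 ≤ N := by
  obtain ⟨i⟩ := h.connected.nonempty
  have h1 : 1 ≤ N := i.pos
  by_contra! h2
  obtain rfl : N = 1 := by omega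
  have h3 : p.Lt = 0 := h.gossip.one_sub_sInf_eq_zero p.t
  have h4 := ha.α_le.trans ((min_le_right _ _).trans (min_le_right _ _))
  rw [h3, div_zero] at h4
  exact absurd ha.α_pos h4.not_gt

theorem Network.mixing (h : p.Network) (ha : p.Admissible) :
    Mixing (p.W ^ p.t) (p.σ₂ ^ p.t) :=
  h.gossip.mixing_pow (h.two_le ha) ha.one_le_t ha.le_t

/-- A real supremum of nonnegative numbers is nonnegative even when the set is empty or unbounded,
by its default value. This yields L ≤ L_G. -/
theorem Ln_nonneg (p : Model N n r Ω Ξ) : 0 ≤ p.Ln := by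
  refine Real.sSup_nonneg ?_
  rintro _ ⟨i, X, -, rfl⟩
  exact norm_nonneg _

theorem Admissible.Φ_le_two (ha : p.Admissible) (hN : 0 < N) : p.Φ ≤ 2 :=
  (ha.Φ_le ⟨0, hN⟩).trans (by linarith [sq_nonneg ‖p.X₀ ⟨0, hN⟩ - p.iam p.X₀‖])

/-- The basic consequences of the choice of the parameters. -/
structure Scales (p : Model N n r Ω Ξ) : Prop where
  A_pos : 0 < p.A
  LG_pos : 0 < p.LG
  δ₁_pos : 0 < p.δ₁
  one_le_r : (1 : ℝ) ≤ r
  δ₁_le : 5 * p.δ₁ ≤ p.δ₂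
  Lt_pos : 0 < p.Lt
  ρ_lt : p.ρ < 1
  ρ_sq : p.ρ ^ 2 = 1 - (p.α * p.Lt * p.Φ - p.α ^ 2 * p.Lt ^ 2)
  β_le : 5 * (p.β * (10 * p.A + p.LG)) ≤ p.α * p.δ₁

/-- A positive step size below each bound forces the bounds to be positive. This gives the signs of
L_G, δ₁, 1 - ρ and L_t; r = 0 is excluded because division by zero would make the bound on δ₁ zero.
-/
theorem Admissible.scales (ha : p.Admissible) (hb : p.Bounded) (hN : 0 < N) : p.Scales := by
  have hα := ha.α_pos
  have hβ := ha.β_pos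
  have hA : 0 < p.A := hb.pos.trans_le (le_max_left _ _)
  have hβ1 := ha.β_le.trans (min_le_left _ _)
  have hβ2 := ha.β_le.trans ((min_le_right _ _).trans (min_le_left _ _))
  have hLG : 0 < p.LG := by
    have := one_div_pos.1 (hβ.trans_le hβ2)
    linarith
  have hΛ : 0 < 10 * p.A + p.LG := by positivity
  have hβ3 : p.β ≤ p.α * p.δ₁ / (5 * (10 * p.A + p.LG)) := hβ1.trans (min_le_right _ _)
  have hβ4 : p.β ≤ (1 - p.ρ) / (10 * p.A + p.LG) * p.δ₁ := hβ1.trans (min_le_left _ _)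
  rw [le_div_iff₀ (by positivity)] at hβ3
  have hδ₁ : 0 < p.δ₁ := by
    have h1 : 0 < p.β * (5 * (10 * p.A + p.LG)) := by positivity
    exact pos_of_mul_pos_right (h1.trans_le hβ3) hα.le
  have hρ : p.ρ < 1 := by
    have h1 := pos_of_mul_pos_left (hβ.trans_le hβ4) hδ₁.le
    have h2 := (div_pos_iff_of_pos_right hΛ).1 h1
    linarith
  have hr : (1 : ℝ) ≤ r := by
    rcases Nat.eq_zero_or_pos r with h0 | h0
    · have h1 := ha.δ₁_le
      have h2 : √(r : ℝ) = 0 := by simp [h0]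
      rw [h2, mul_zero, div_zero, zero_mul] at h1
      exact absurd hδ₁ h1.not_gt
    · exact_mod_cast h0
  have hsr : 1 ≤ √(r : ℝ) := Real.one_le_sqrt.2 hr
  have hδ : 5 * p.δ₁ ≤ p.δ₂ := by
    have h1 := ha.δ₁_le
    rw [one_div_mul_eq_div, le_div_iff₀ (by positivity)] at h1
    nlinarith
  have hΦ : 0 < p.Φ := zero_lt_one.trans_le ha.one_le_Φ
  have hΦ2 := ha.Φ_le_two hN
  have hα3 := ha.α_le.trans ((min_le_right _ _).trans (min_le_right _ _))
  have hLt : 0 < p.Lt := (div_pos_iff_of_pos_left hΦ).1 (hα.trans_le hα3)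
  rw [le_div_iff₀ hLt] at hα3
  have hy : 0 < p.α * p.Lt := by positivity
  refine ⟨hA, hLG, hδ₁, hr, hδ, hLt, hρ, Real.sq_sqrt ?_, by linarith⟩
  -- With y = αL_t and Φ ≤ 2, the radicand of ρ is at least (1 - y)².
  nlinarith [sq_nonneg (1 - p.α * p.Lt)]

theorem ρ_nonneg (p : Model N n r Ω Ξ) : 0 ≤ p.ρ := Real.sqrt_nonneg _

theorem Scales.two_le_Γ₀ (hS : p.Scales) : 2 ≤ p.Γ₀ := by
  have h1 : 0 < 1 - p.ρ := by linarith [hS.ρ_lt]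
  have h2 : (1 - p.ρ) ^ 2 ≤ 1 := pow_le_one₀ h1.le (by linarith [p.ρ_nonneg])
  rw [Γ₀, le_div_iff₀ (by positivity)]
  linarith

theorem Scales.D₁_ge (hS : p.Scales) : 2 * p.M * p.A ≤ p.D₁ := by
  have := hS.LG_pos
  have : 0 ≤ (p.δ₁ ^ 2 + 5) * p.LG := by positivity
  rw [D₁]
  linarith

/-- The bound on β gives 5βΛ ≤ δ₁ with Λ = 10A + L_G; inserted into D₄, the powers of β cancel and
leave 100Λ²/L_G ≥ 100Λ. -/
theorem Scales.D₄_ge (hS : p.Scales) (ha : p.Admissible) : 100 * (10 * p.A + p.LG) ≤ p.D₄ := by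
  have hα := ha.α_pos
  have hβ := ha.β_pos
  have hA := hS.A_pos
  have hLG := hS.LG_pos
  have hδ := hS.δ₁_pos
  have hα1 : p.α ≤ 1 := ha.α_le.trans (min_le_left _ _)
  set Λ := 10 * p.A + p.LG with hΛ
  have hΛ0 : 0 < Λ := by positivity
  have h1 : 5 * (p.β * Λ) ≤ p.δ₁ := hS.β_le.trans (by nlinarith)
  have h2 : (5 * (p.β * Λ)) ^ 2 ≤ p.δ₁ ^ 2 := by gcongr
  have h3 : p.LG ≤ Λ := by linarith
  rw [D₄, le_div_iff₀ (by positivity)]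
  calc 100 * Λ * (p.β ^ 2 * p.LG) ≤ 100 * Λ * (p.β ^ 2 * Λ) := by gcongr
    _ = 4 * 1 * (5 * (p.β * Λ)) ^ 2 := by ring
    _ ≤ 4 * r * p.δ₁ ^ 2 := by gcongr; exact hS.one_le_r

theorem Scales.D₄_le_D₂ (hS : p.Scales) (ha : p.Admissible) : p.D₄ ≤ p.D₂ := by
  have h1 := ha.α_pos
  have h2 := hS.LG_pos
  have h3 := hS.A_pos
  have : 0 ≤ 3 * p.LG + 2 * p.α * p.A + 13 * p.LG * (p.δ₂ ^ 2 / r) * p.α ^ 2 := by positivity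
  rw [D₂]
  linarith

/-- C₁ contains D₄Γ₀ twice, once inside D₂Γ₀, and also 2MA; the last bound on β includes 8βC₁ ≤ 1.
-/
theorem Scales.β_le_inv (hS : p.Scales) (ha : p.Admissible) :
    16 * (p.β * p.Γ₀ * p.D₄) ≤ 1 ∧ 16 * (p.β * p.M * p.A) ≤ 1 := by
  have hα := ha.α_pos
  have hβ := ha.β_pos
  have hA := hS.A_pos
  have hLG := hS.LG_pos
  have hδ := hS.δ₁_pos
  have hM := ha.retr.1
  have hΓ := hS.two_le_Γ₀
  have hD4 : 0 < p.D₄ := lt_of_lt_of_le (by positivity) (hS.D₄_ge ha)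
  have hD1 := hS.D₁_ge
  have hD2 := hS.D₄_le_D₂ ha
  have hΓ2 : 0 ≤ p.Γ₂ := div_nonneg zero_le_two (sq_nonneg _)
  have hMA : 0 < p.M * p.A := by positivity
  have h1 : p.D₄ * p.Γ₀ ≤ p.D₂ * p.Γ₀ := by gcongr
  have h2 : 0 < p.D₄ * p.Γ₀ := by positivity
  have hC : 2 * (p.D₄ * p.Γ₀) + 2 * (p.M * p.A) ≤ p.C₁ := by rw [C₁]; linarith
  have hB : 0 ≤ p.α * p.δ₁ * p.LG * (16 * p.Γ₀ + p.Γ₂) := by positivity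
  have h3 := ha.β_le.trans ((min_le_right _ _).trans (min_le_right _ _))
  rw [le_div_iff₀ (by linarith)] at h3
  have h4 : p.β * (8 * p.C₁) ≤ 1 := (mul_le_mul_of_nonneg_left (by linarith) hβ.le).trans h3
  have h5 := mul_le_mul_of_nonneg_left hC hβ.le
  have h6 : 0 < p.β * (p.D₄ * p.Γ₀) := by positivity
  have h7 : 0 < p.β * (p.M * p.A) := by positivity
  constructor <;> linarith

theorem Scales.βΛΓ₀_le (hS : p.Scales) (ha : p.Admissible) :
    1600 * (p.β * (10 * p.A + p.LG) * p.Γ₀) ≤ 1 := by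
  have h1 := (hS.β_le_inv ha).1
  have h2 := mul_le_mul_of_nonneg_left (hS.D₄_ge ha)
    (mul_nonneg ha.β_pos.le (zero_le_two.trans hS.two_le_Γ₀))
  linarith

/-- From Γ₀ ≥ 2 follows 32βD₄ ≤ 1, that is 128rδ₁² ≤ βL_G. Since βL_G ≤ αδ₁/5, one factor δ₁
cancels. -/
theorem Scales.δ₁_le_α (hS : p.Scales) (ha : p.Admissible) : 640 * p.δ₁ ≤ p.α := by
  have hβ := ha.β_pos
  have hA := hS.A_pos
  have hLG := hS.LG_pos
  have hδ := hS.δ₁_pos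
  have hr := hS.one_le_r
  have h1 := (hS.β_le_inv ha).1
  have hD4 : 0 < p.D₄ := lt_of_lt_of_le (by positivity) (hS.D₄_ge ha)
  have h2 : 32 * (p.β * p.D₄) ≤ 1 := by
    have := mul_le_mul_of_nonneg_left hS.two_le_Γ₀ (mul_nonneg hβ.le hD4.le)
    linarith
  have h3 : p.D₄ * (p.β ^ 2 * p.LG) = 4 * r * p.δ₁ ^ 2 := by
    rw [D₄, div_mul_cancel₀ _ (by positivity)]
  have h4 : 32 * (4 * r * p.δ₁ ^ 2) ≤ p.β * p.LG := by
    rw [← h3]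
    calc 32 * (p.D₄ * (p.β ^ 2 * p.LG)) = 32 * (p.β * p.D₄) * (p.β * p.LG) := by ring
      _ ≤ 1 * (p.β * p.LG) := by gcongr
      _ = _ := one_mul _
  have h5 : 128 * p.δ₁ ^ 2 ≤ 32 * (4 * r * p.δ₁ ^ 2) := by nlinarith [sq_nonneg p.δ₁]
  have h6 := hS.β_le
  have h7 : 0 < p.β * p.A := by positivity
  have h8 : 640 * p.δ₁ * p.δ₁ ≤ p.α * p.δ₁ := by nlinarith
  exact le_of_mul_le_mul_right h8 hδ

theorem Scales.stepSizes (hS : p.Scales) (ha : p.Admissible) :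
    StepSizes p.α p.β p.A p.M p.δ₁ p.δ₂ where
  α_pos := ha.α_pos
  α_le := ha.α_le.trans (min_le_left _ _)
  β_pos := ha.β_pos
  A_nonneg := hS.A_pos.le
  M_pos := ha.retr.1
  Mα := by
    have := ha.α_le.trans ((min_le_right _ _).trans (min_le_left _ _))
    rwa [le_div_iff₀' ha.retr.1] at this
  δ₁_pos := hS.δ₁_pos
  δ₁_le_α := hS.δ₁_le_α ha
  δ₁_le := hS.δ₁_le
  δ₂_le := ha.δ₂_le
  βA := by
    have h1 := hS.β_le
    have h2 := mul_pos ha.β_pos hS.LG_pos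
    linarith

theorem Scales.costSizes (hS : p.Scales) (ha : p.Admissible) :
    CostSizes p.α p.β p.A p.M p.L (10 * p.A + p.LG) where
  Λ_pos := by linarith [hS.A_pos, hS.LG_pos]
  A_le := by linarith [hS.LG_pos]
  L_le := by rw [LG]; linarith [p.Ln_nonneg, hS.A_pos]
  βΛ := by
    have h1 := hS.βΛΓ₀_le ha
    have h2 : 0 < p.β * (10 * p.A + p.LG) :=
      mul_pos ha.β_pos (by linarith [hS.A_pos, hS.LG_pos])
    have h3 := mul_le_mul_of_nonneg_left hS.two_le_Γ₀ h2.le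
    linarith
  βMA := (hS.β_le_inv ha).2

/-- Φ ≤ 2 gives ρ² ≥ (1 - αL_t)², so ρ is no faster than the linear rate. -/
theorem Scales.one_sub_ρ_le (hS : p.Scales) (ha : p.Admissible) (hN : 0 < N) :
    1 - p.ρ ≤ p.α * p.Lt := by
  have hy : 0 < p.α * p.Lt := mul_pos ha.α_pos hS.Lt_pos
  have h1 := ha.Φ_le_two hN
  have h2 : (1 - p.α * p.Lt) ^ 2 ≤ p.ρ ^ 2 := by
    rw [hS.ρ_sq]
    nlinarith
  have h3 := (le_abs_self _).trans (abs_le_of_sq_le_sq h2 p.ρ_nonneg)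
  linarith

theorem Scales.le_Γ₀_mul (hS : p.Scales) (ha : p.Admissible) (hN : 0 < N)
    (hLt : p.Lt ≤ 1354 / 1000) : 109 / 100 ≤ p.Γ₀ * p.α ^ 2 := by
  have h0 : 0 < 1 - p.ρ := by linarith [hS.ρ_lt]
  have h1 : 1 - p.ρ ≤ p.α * (1354 / 1000) := (hS.one_sub_ρ_le ha hN).trans
    (mul_le_mul_of_nonneg_left hLt ha.α_pos.le)
  have h2 : (1 - p.ρ) ^ 2 ≤ (p.α * (1354 / 1000)) ^ 2 := by gcongr
  rw [Γ₀, div_mul_eq_mul_div, le_div_iff₀ (by positivity)]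
  nlinarith [sq_nonneg p.α]

/-- For a ≤ 1/2 the left side is increasing in y and can be evaluated at the upper bound; for larger
a it is at most 1, and the right side exceeds 1. -/
theorem consensus_rate_le {a y : ℝ} (ha : 0 < a) (ha1 : a ≤ 1)
    (hya : y ≤ a * (1354 / 1000)) :
    2 * y - y ^ 2 ≤ 4 * (1 - (1 - 11 / 20 * a) * (1 - 11 / 20 * a / 4)) := by
  rcases le_total a (1 / 2) with h | h
  · have : 2 * y - y ^ 2 ≤ 2 * (a * (1354 / 1000)) - (a * (1354 / 1000)) ^ 2 := by nlinarith
    nlinarith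
  · nlinarith [sq_nonneg (1 - y)]

/-- The initial consensus error, scaled by the contraction rate. -/
theorem Scales.le_Γ₁ (hS : p.Scales) (ha : p.Admissible) (hN : 2 ≤ N)
    (hLt : p.Lt ≤ 1354 / 1000) :
    (msq fun i => p.X₀ i - p.iam p.X₀)
      / (1 - (1 - 11 / 20 * p.α) * (1 - 11 / 20 * p.α / 4)) ≤ p.Γ₁ := by
  have hα := ha.α_pos
  have hα1 : p.α ≤ 1 := ha.α_le.trans (min_le_left _ _)
  have hy : 0 < p.α * p.Lt := mul_pos hα hS.Lt_pos
  have hE : 0 ≤ p.consErr p.X₀ := Finset.sum_nonneg fun i _ => by positivity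
  have hN' : (2 : ℝ) ≤ N := by exact_mod_cast hN
  have hκ := consensus_rate_le hα hα1 (mul_le_mul_of_nonneg_left hLt hα.le)
  have hρ : 1 - p.ρ ^ 2 ≤ 2 * (p.α * p.Lt) - (p.α * p.Lt) ^ 2 := by
    rw [hS.ρ_sq]
    have := mul_le_mul_of_nonneg_left (ha.Φ_le_two (by omega)) hy.le
    nlinarith
  have hρ0 : 0 < 1 - p.ρ ^ 2 := by nlinarith [hS.ρ_lt, p.ρ_nonneg]
  set κ := 1 - (1 - 11 / 20 * p.α) * (1 - 11 / 20 * p.α / 4)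
  have hκ0 : 0 < κ := by linarith
  rw [← p.consErr_eq, Γ₁, div_le_iff₀ hκ0, one_div_mul_eq_div, div_le_iff₀ (by positivity),
    div_mul_eq_mul_div, div_mul_eq_mul_div, div_mul_eq_mul_div, le_div_iff₀ hρ0]
  -- Γ₁ uses the sum over the agents and not the mean, so a factor N ≥ 2 is available here.
  have h1 : 1 - p.ρ ^ 2 ≤ 2 * κ * N := by nlinarith
  nlinarith

end Model

/-! ### Comparison with the stated bounds -/

theorem inf'_range_le_div {u : ℕ → ℝ} {K : ℕ} {B : ℝ}
    (h : ∑ k ∈ Finset.range (K + 1), u k ≤ B) :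
    (Finset.range (K + 1)).inf' Finset.nonempty_range_add_one u ≤ B / ((K : ℝ) + 1) := by
  rw [le_div_iff₀ (by positivity), mul_comm]
  have h1 := Finset.card_nsmul_le_sum (Finset.range (K + 1)) u
    ((Finset.range (K + 1)).inf' Finset.nonempty_range_add_one u) fun k hk => Finset.inf'_le u hk
  rw [Finset.card_range, nsmul_eq_mul] at h1
  push_cast at h1
  exact h1.trans h

namespace Model

variable {N n r : ℕ} {Ω : Type*} {Ξ : Fin N → Type*}
  [MeasurableSpace Ω] [∀ i, MeasurableSpace (Ξ i)] {p : Model N n r Ω Ξ}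

theorem T₀_eq (p : Model N n r Ω Ξ) :
    1 / (N : ℝ) * ∫ ω, ∑ i, ‖p.Y 0 ω i - p.Fbar 0 ω‖ ^ 2 ∂p.μ = p.T₀ := by
  rw [← integral_const_mul]
  rfl

/-- Γ₃ carries 1/(1 - s²), so the claim reduces to 1 + s ≤ 14/10. -/
theorem T₀_div_le (hV : Mixing (p.W ^ p.t) (p.σ₂ ^ p.t)) :
    p.T₀ / (1 - p.σ₂ ^ p.t) ≤ 7 / 10 * p.Γ₃ := by
  have hT : 0 ≤ p.T₀ := integral_nonneg fun _ => msq_nonneg _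
  have h0 := hV.s_nonneg
  have h1 := hV.s_le_const
  rw [Γ₃, T₀_eq, mul_comm 2 p.t, pow_mul]
  set s := p.σ₂ ^ p.t
  have h2 : 0 < 1 - s := by linarith
  have h3 : 0 < 1 - s ^ 2 := by nlinarith
  have h5 : 7 / 10 * (2 / (1 - s ^ 2) * p.T₀) = 14 / 10 * p.T₀ / (1 - s ^ 2) := by ring
  rw [h5, div_le_div_iff₀ h2 h3]
  have h4 : 0 ≤ p.T₀ * (1 - s) := mul_nonneg hT h2.le
  nlinarith

theorem Γ₃_nonneg (hV : Mixing (p.W ^ p.t) (p.σ₂ ^ p.t)) : 0 ≤ p.Γ₃ := by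
  have h1 : 0 < 1 - p.σ₂ ^ p.t := by linarith [hV.s_le_const]
  have h2 : 0 ≤ p.T₀ / (1 - p.σ₂ ^ p.t) :=
    div_nonneg (integral_nonneg fun _ => msq_nonneg _) h1.le
  linarith [T₀_div_le hV]

theorem Γ₂_nonneg (p : Model N n r Ω Ξ) : 0 ≤ p.Γ₂ := div_nonneg zero_le_two (sq_nonneg _)

theorem Scales.Γ₁_nonneg (hS : p.Scales) : 0 ≤ p.Γ₁ := by
  have h1 : 0 < 1 - p.ρ ^ 2 := by nlinarith [hS.ρ_lt, p.ρ_nonneg]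
  have h2 : 0 ≤ p.consErr p.X₀ := Finset.sum_nonneg fun i _ => by positivity
  exact mul_nonneg (div_nonneg zero_le_two h1.le) h2

/-- C₀ contains Γ₁(D₂ + D₄), and each of D₂ and D₄ is at least 100Λ. -/
theorem Scales.Γ₃'_ge (hS : p.Scales) (ha : p.Admissible) :
    200 * ((10 * p.A + p.LG) * p.Γ₁) + p.β / 2 * p.Γ₃ ≤ p.Γ₃' := by
  have hβ := ha.β_pos
  have hG1 := hS.Γ₁_nonneg
  have hG2 := p.Γ₂_nonneg
  have hG0 : 0 ≤ p.Γ₀ := zero_le_two.trans hS.two_le_Γ₀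
  have h1 := hS.D₄_ge ha
  have hD4 : 0 ≤ p.D₄ := le_trans (by linarith [hS.A_pos, hS.LG_pos]) h1
  have h2 := mul_le_mul_of_nonneg_right (h1.trans (hS.D₄_le_D₂ ha)) hG1
  have h3 := mul_le_mul_of_nonneg_right h1 hG1
  have h4 : 0 ≤ p.D₄ * p.Γ₀ * p.α ^ 2 * p.δ₁ ^ 2 / 25 := by positivity
  have h5 : 0 ≤ p.β / 2 * (16 * p.α ^ 2 * p.LG ^ 2 * p.Γ₂ * p.Γ₁) := by positivity
  rw [Γ₃', C₀]
  linarith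

/-- D₃ ≥ 1/(2L_G), and 3200βΛ ≤ 1 with L_G ≤ Λ makes it large compared with β; it pays for the
sampling noise. -/
theorem Scales.D₃_ge (hS : p.Scales) (ha : p.Admissible) : 1600 * p.β ≤ p.D₃ := by
  have hLG := hS.LG_pos
  have hβ := ha.β_pos
  have h1 := (hS.costSizes ha).βΛ
  have h2 : 0 < p.β * p.A := mul_pos hβ hS.A_pos
  have h3 : 0 ≤ 4 * p.LG ^ 2 * p.β ^ 2 := by positivity
  rw [D₃, le_div_iff₀ (by positivity)]
  linarith

theorem Scales.Γ₁'_nonneg (hS : p.Scales) (ha : p.Admissible) : 0 ≤ p.Γ₁' := by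
  have := ha.β_pos
  have := hS.Γ₁_nonneg
  rw [Γ₁']
  positivity

/-- The weighted sums of the variances dominate the unweighted one. -/
theorem sum_variance_le (p : Model N n r Ω Ξ) {c a b : ℝ} (ha : c ≤ a) (hb : 0 ≤ b) (K : ℕ) :
    c * ∑ k ∈ Finset.range (K + 1), p.σ ^ 2 / p.batch k
      ≤ p.σ ^ 2 * ∑ k ∈ Finset.range (K + 1),
          (a / (p.batch k : ℝ) + b / (p.batch (k + 1) : ℝ)) := by
  rw [Finset.mul_sum, Finset.mul_sum]
  refine Finset.sum_le_sum fun k _ => ?_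
  have h1 : c / (p.batch k : ℝ) ≤ a / (p.batch k : ℝ) := by gcongr
  have h2 : 0 ≤ b / (p.batch (k + 1) : ℝ) := by positivity
  calc c * (p.σ ^ 2 / p.batch k) = p.σ ^ 2 * (c / (p.batch k : ℝ)) := by ring
    _ ≤ _ := by gcongr; linarith

theorem regular (hnet : p.Network) (hsmooth : p.Smooth) (horacle : p.Oracle) (hbdd : p.Bounded)
    (hsamp : p.Sampling) (hadm : p.Admissible) (hS : p.Scales) :
    p.Regular (p.σ₂ ^ p.t) (10 * p.A + p.LG) :=
  ⟨hsmooth, horacle, hbdd, hsamp, hadm, hnet.mixing hadm, hS.stepSizes hadm, hS.costSizes hadm⟩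

end Model

end DRSGT

theorem theorem1 {N n r : ℕ} {Ω : Type*} {Ξ : Fin N → Type*}
    [MeasurableSpace Ω] [∀ i, MeasurableSpace (Ξ i)] (p : DRSGT.Model N n r Ω Ξ)
    (hnet : p.Network) (hsmooth : p.Smooth) (horacle : p.Oracle) (hbdd : p.Bounded)
    (hsamp : p.Sampling) (hadm : p.Admissible) (K : ℕ) :
    (∀ k, Integrable (fun ω => p.consErr (p.X k ω)) p.μ) ∧
    (∀ k, Integrable (fun ω => ‖DRSGT.rGrad p.f (p.Xhat k ω)‖ ^ 2) p.μ) ∧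
    (Finset.range (K + 1)).inf' Finset.nonempty_range_add_one
        (fun k => (1 / (N : ℝ)) * ∫ ω, p.consErr (p.X k ω) ∂p.μ)
      ≤ (8 * p.β * p.Γ₀ * (p.f (p.iam p.X₀) - p.fStar + p.Γ₃'
            + p.σ ^ 2 * ∑ k ∈ Finset.range (K + 1),
              ((2 * p.Γ₂ * p.β + p.D₃ + p.β / 2) / (p.batch k : ℝ)
                + 2 * p.β * p.Γ₂ / (p.batch (k + 1) : ℝ)))
          + p.Γ₁) / ((K : ℝ) + 1) ∧
    (Finset.range (K + 1)).inf' Finset.nonempty_range_add_one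
        (fun k => ∫ ω, ‖DRSGT.rGrad p.f (p.Xhat k ω)‖ ^ 2 ∂p.μ)
      ≤ (p.Γ₁' + (16 + p.Γ₀ * p.α ^ 2 * p.δ₁ ^ 2) * (p.f (p.iam p.X₀) - p.fStar + p.Γ₃'))
          / (p.β * ((K : ℝ) + 1))
        + (p.σ ^ 2 * ∑ k ∈ Finset.range (K + 1),
              ((2 * p.β * p.Γ₂ + p.D₃') / (p.batch k : ℝ)
                + 2 * p.β * p.Γ₂ / (p.batch (k + 1) : ℝ)))
          / (p.β * ((K : ℝ) + 1)) := by
  have hN := hnet.two_le hadm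
  have hV := hnet.mixing hadm
  have hS := hadm.scales hbdd hV.pos
  have hR := DRSGT.Model.regular hnet hsmooth horacle hbdd hsamp hadm hS
  have hLt : p.Lt ≤ 1354 / 1000 := hV.one_sub_sInf_le
  have hα := hadm.α_pos
  have hβ := hadm.β_pos
  have hα1 : p.α ≤ 1 := hadm.α_le.trans (min_le_left _ _)
  have hκ : 0 < 1 - (1 - 11 / 20 * p.α) * (1 - 11 / 20 * p.α / 4) := by nlinarith
  have he₁ := hS.le_Γ₁ hadm hN hLt
  have h1 := hR.expected_sums_le (hS.le_Γ₀_mul hadm hV.pos hLt) (hS.βΛΓ₀_le hadm)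
    (mul_div_cancel₀ (DRSGT.msq fun i => p.X₀ i - p.iam p.X₀) hκ.ne').symm K
  set e₀ := (DRSGT.msq fun i => p.X₀ i - p.iam p.X₀)
    / (1 - (1 - 11 / 20 * p.α) * (1 - 11 / 20 * p.α / 4))
  obtain ⟨hX, hG⟩ := h1
  have hΓ₀ := hS.two_le_Γ₀
  have hΓ₀' : 0 ≤ p.Γ₀ := zero_le_two.trans hΓ₀
  have hΓ₂ := p.Γ₂_nonneg
  have hΓ₃ := DRSGT.Model.Γ₃_nonneg hV
  have hΓ₃' := hS.Γ₃'_ge hadm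
  have hΛ := (hS.costSizes hadm).Λ_pos
  have hT := mul_le_mul_of_nonneg_left (DRSGT.Model.T₀_div_le hV) hβ.le
  have hΛe := mul_le_mul_of_nonneg_left he₁ hΛ.le
  have hΛΓ : 0 ≤ (10 * p.A + p.LG) * p.Γ₁ := mul_nonneg hΛ.le hS.Γ₁_nonneg
  have hF : 0 ≤ p.f (p.iam p.X₀) - p.fStar :=
    sub_nonneg.2 (DRSGT.sInf_tot_le hV.pos hR.goodCosts (hadm.iam _ hadm.init.1).1)
  have hβΓ : 0 ≤ p.β * p.Γ₃ := mul_nonneg hβ.le hΓ₃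
  have hβΓ₂ : 0 ≤ p.β * p.Γ₂ := mul_nonneg hβ.le hΓ₂
  have hD₃ := hS.D₃_ge hadm
  refine ⟨fun k => ?_, fun k => hR.integrable_norm_sq_rGrad k, ?_, ?_⟩
  · have h2 := (hR.integrable_msq_sub_Xhat k).const_mul (N : ℝ)
    refine h2.congr (Filter.Eventually.of_forall fun ω => ?_)
    have hN0 : (N : ℝ) ≠ 0 := by exact_mod_cast hV.pos.ne'
    change (N : ℝ) * (1 / (N : ℝ) * p.consErr (p.X k ω)) = _
    rw [← mul_assoc, mul_one_div_cancel hN0, one_mul]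
  · refine DRSGT.inf'_range_le_div (hX.trans ?_)
    have h2 := p.sum_variance_le (c := 200 * p.β) (a := 2 * p.Γ₂ * p.β + p.D₃ + p.β / 2)
      (b := 2 * p.β * p.Γ₂) (by linarith) (by linarith) K
    have h3 : 0 ≤ p.β * ∑ k ∈ Finset.range (K + 1), p.σ ^ 2 / p.batch k := by positivity
    -- Each term fits under the factor 8: noise 170β against 8 · 200β, tracking 45/10 · 7/10 = 3.15
    -- against 8/2, and initial error 120 against 8 · 200.
    have h4 : 7 * (p.f (p.iam p.X₀) - p.fStar)
        + 170 * (p.β * ∑ k ∈ Finset.range (K + 1), p.σ ^ 2 / p.batch k)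
        + 45 / 10 * (p.β * (p.T₀ / (1 - p.σ₂ ^ p.t))) + 120 * ((10 * p.A + p.LG) * e₀)
        ≤ 8 * (p.f (p.iam p.X₀) - p.fStar + p.Γ₃'
            + p.σ ^ 2 * ∑ k ∈ Finset.range (K + 1),
              ((2 * p.Γ₂ * p.β + p.D₃ + p.β / 2) / (p.batch k : ℝ)
                + 2 * p.β * p.Γ₂ / (p.batch (k + 1) : ℝ))) := by
      linarith
    have h5 := mul_le_mul_of_nonneg_left h4 (mul_nonneg hΓ₀' hβ.le)
    linarith
  · rw [← add_div, ← div_div]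
    refine DRSGT.inf'_range_le_div ?_
    rw [le_div_iff₀' hβ]
    refine hG.trans ?_
    -- The variance sum stands outside the factor 16 + Γ₀α²δ₁², so it must absorb the coefficient
    -- 15β alone; D₃ ≥ 1600β suffices.
    have h2 := p.sum_variance_le (c := 15 * p.β) (a := 2 * p.β * p.Γ₂ + p.D₃')
      (b := 2 * p.β * p.Γ₂) (by rw [DRSGT.Model.D₃']; linarith) (by linarith) K
    have h3 := hS.Γ₁'_nonneg hadm
    have h4 : 0 ≤ p.Γ₀ * p.α ^ 2 * p.δ₁ ^ 2 * (p.f (p.iam p.X₀) - p.fStar + p.Γ₃') :=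
      mul_nonneg (by positivity) (by linarith)
    linarith
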